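/- Let $N\ge 1$ and $d\ge 0$ be integers, let $S=\mathbb{C}[X_1,\dots,X_N]$ with its standard grading, let $\mathfrak{m}=(X_1,\dots,X_N)$, and let $\operatorname{GL}_N(\mathbb{C})$ act on $S$ by linear changes of coordinates, so that the span of the variables $X_1,\dots,X_N$ is the standard representation $\mathbb{C}^N$ (that is, $g\cdot X_j=\sum_i g_{ij}X_i$). The ideal $\mathfrak{m}^d$ is homogeneous and $\operatorname{GL}_N(\mathbb{C})$-invariant, so each $\operatorname{Ext}^j_S(S/\mathfrak{m}^d,S)$ carries an induced grading and an induced action of $\operatorname{GL}_N(\mathbb{C})$. For a dominant weight $\lambda=(\lambda_1\ge\cdots\ge\lambda_N)\in\mathbb{Z}^N$ let $\mathbb{S}_\lambda\mathbb{C}^N$ be the associated irreducible representation of $\operatorname{GL}_N(\mathbb{C})$: the Schur functor of the partition $\lambda-(\lambda_N^N)$ applied to $\mathbb{C}^N$, tensored with $\det^{\lambda_N}$ (with the conventions $\mathbb{S}_{(k)}\mathbb{C}^N=\operatorname{Sym}^k\mathbb{C}^N$ and $\mathbb{S}_{(1^k)}\mathbb{C}^N=\bigwedge^k\mathbb{C}^N$).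 Then there is a $\operatorname{GL}_N(\mathbb{C})$-equivariant isomorphism of graded complex vector spaces $$\operatorname{Ext}^N_S(S/\mathfrak{m}^d,S)\;\simeq\;\bigoplus_{i=0}^{d-1}\mathbb{S}_{(-1^{N-1},-i-1)}\mathbb{C}^N,$$ where $(-1^{N-1},-i-1)$ is the weight with $N-1$ entries equal to $-1$ followed by $-i-1$, and where the summand $\mathbb{S}_{(-1^{N-1},-i-1)}\mathbb{C}^N$ is placed in degree $-i-N$. Moreover, $\operatorname{Ext}^j_S(S/\mathfrak{m}^d,S)=0$ for all $j\ne N$. -/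

import Mathlib

open CategoryTheory
open scoped ModuleCat.Algebra DirectSum TensorProduct

noncomputable section

namespace PowerExt

/-! ## The polynomial ring, its grading, and linear changes of coordinates -/

/-- The polynomial ring `S = ℂ[X_1, …, X_N]`. -/
abbrev Poly (N : ℕ) : Type := MvPolynomial (Fin N) ℂ

/-- The maximal homogeneous ideal `𝔪 = (X_1, …, X_N)` of `S`. -/
def maxIdeal (N : ℕ) : Ideal (Poly N) :=
  Ideal.span (Set.range fun j : Fin N => (MvPolynomial.X j : Poly N))

/-- The linear substitution `X_j ↦ ∑ i, A i j • X_i`. On the span of the variables it is the action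
of the matrix `A` on column vectors, where `X_j` is the `j`-th standard basis vector of `ℂ^N`. -/
def linSubst {N : ℕ} (A : Matrix (Fin N) (Fin N) ℂ) : Poly N →ₐ[ℂ] Poly N :=
  MvPolynomial.aeval fun j => ∑ i, A i j • (MvPolynomial.X i : Poly N)

theorem linSubst_X {N : ℕ} (A : Matrix (Fin N) (Fin N) ℂ) (j : Fin N) :
    linSubst A (MvPolynomial.X j) = ∑ i, A i j • (MvPolynomial.X i : Poly N) := by
  simp [linSubst]

theorem linSubst_one (N : ℕ) : linSubst (1 : Matrix (Fin N) (Fin N) ℂ) = AlgHom.id ℂ _ := by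
  ext1 j
  rw [linSubst_X, Finset.sum_eq_single j]
  · simp
  · intro i _ hij
    simp [Matrix.one_apply_ne hij]
  · simp

theorem linSubst_mul {N : ℕ} (A B : Matrix (Fin N) (Fin N) ℂ) :
    linSubst (A * B) = (linSubst A).comp (linSubst B) := by
  ext1 j
  rw [linSubst_X, AlgHom.comp_apply, linSubst_X, map_sum]
  simp only [map_smul, linSubst_X, Matrix.mul_apply, Finset.sum_smul, Finset.smul_sum, smul_smul]
  rw [Finset.sum_comm]
  refine Finset.sum_congr rfl fun i _ => Finset.sum_congr rfl fun k _ => ?_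
  rw [mul_comm]

/-- The action of `GL_N(ℂ)` on `S` by linear changes of coordinates. -/
def polyAct (N : ℕ) : GL (Fin N) ℂ →* (Poly N ≃ₐ[ℂ] Poly N) where
  toFun g := AlgEquiv.ofAlgHom (linSubst g.val) (linSubst g.inv)
    (by rw [← linSubst_mul, g.val_inv, linSubst_one])
    (by rw [← linSubst_mul, g.inv_val, linSubst_one])
  map_one' := by
    ext1 x
    exact DFunLike.congr_fun (linSubst_one N) x
  map_mul' g h := by
    ext1 x
    exact DFunLike.congr_fun (linSubst_mul g.val h.val) x

theorem polyAct_apply {N : ℕ} (g : GL (Fin N) ℂ) (p : Poly N) :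
    polyAct N g p = linSubst g.val p := rfl

theorem polyAct_mul_apply {N : ℕ} (g h : GL (Fin N) ℂ) (p : Poly N) :
    polyAct N (g * h) p = polyAct N g (polyAct N h p) := by
  rw [map_mul]; rfl

theorem maxIdeal_pow_le_comap {N : ℕ} (d : ℕ) (g : GL (Fin N) ℂ) :
    maxIdeal N ^ d ≤ (maxIdeal N ^ d).comap (polyAct N g : Poly N →+* Poly N) := by
  rw [← Ideal.map_le_iff_le_comap, Ideal.map_pow]
  refine Ideal.pow_right_mono ?_ d
  rw [maxIdeal, Ideal.map_span, Ideal.span_le]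
  rintro _ ⟨_, ⟨j, rfl⟩, rfl⟩
  change polyAct N g (MvPolynomial.X j) ∈ Ideal.span _
  rw [polyAct_apply, linSubst_X]
  refine Ideal.sum_mem _ fun i _ => ?_
  rw [MvPolynomial.smul_eq_C_mul]
  exact Ideal.mul_mem_left _ _ (Ideal.subset_span ⟨i, rfl⟩)

/-- The ring `S / 𝔪^d`. -/
abbrev PowQuot (N d : ℕ) : Type := Poly N ⧸ (maxIdeal N ^ d)

/-- The action of `GL_N(ℂ)` on `S / 𝔪^d` induced by its action on `S`. -/
def quotAct {N : ℕ} (d : ℕ) (g : GL (Fin N) ℂ) : PowQuot N d →+* PowQuot N d :=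
  Ideal.quotientMap _ (polyAct N g : Poly N →+* Poly N) (maxIdeal_pow_le_comap d g)

/-- The graded piece `S_k` of `S`, for an integer `k` (zero if `k < 0`). -/
def polyGrading (N : ℕ) (k : ℤ) : AddSubgroup (Poly N) :=
  if 0 ≤ k then (MvPolynomial.homogeneousSubmodule (Fin N) ℂ k.toNat).toAddSubgroup else ⊥

/-- The grading of `S / 𝔪^d` by the images of the graded pieces of `S`. -/
def quotGrading (N d : ℕ) (k : ℤ) : AddSubgroup (PowQuot N d) :=
  (polyGrading N k).map (Ideal.Quotient.mk (maxIdeal N ^ d)).toAddMonoidHom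

/-! ## The grading of `Ext` -/

/-- The family `𝓜` of additive subgroups makes the `S`-module `M` a graded `S`-module. -/
structure IsGradedModule {N : ℕ} (M : ModuleCat.{0} (Poly N)) (𝓜 : ℤ → AddSubgroup M) :
    Prop where
  isInternal : DirectSum.IsInternal 𝓜
  smul_mem : ∀ (a k : ℤ) (s : Poly N) (x : M),
    s ∈ polyGrading N a → x ∈ 𝓜 k → s • x ∈ 𝓜 (a + k)

/-- The `S`-linear map `f` is homogeneous of degree `k`. -/
def IsHomogeneousMap {N : ℕ} {M M' : ModuleCat.{0} (Poly N)} (𝓜 : ℤ → AddSubgroup M)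
    (𝓜' : ℤ → AddSubgroup M') (k : ℤ) (f : M ⟶ M') : Prop :=
  ∀ (a : ℤ) (x : M), x ∈ 𝓜 a → f.hom x ∈ 𝓜' (a + k)

/-- The graded piece of degree `k` of `Ext^j_S(M, M')`, for graded `S`-modules `M` and `M'`: the
classes of the cocycles `P_j ⟶ M'` that are homogeneous of degree `k`, where `P_•` is a graded
projective resolution of `M` (with differentials and augmentation homogeneous of degree `0`). -/
def extGrading {N : ℕ} {M M' : ModuleCat.{0} (Poly N)} (𝓜 : ℤ → AddSubgroup M)
    (𝓜' : ℤ → AddSubgroup M') (j : ℕ) (k : ℤ) : Set (Abelian.Ext.{0} M M' j) :=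
  {x | ∃ (P : ProjectiveResolution M) (𝓟 : ∀ n : ℕ, ℤ → AddSubgroup (P.complex.X n)),
    (∀ n, IsGradedModule (P.complex.X n) (𝓟 n)) ∧
    (∀ n, IsHomogeneousMap (𝓟 (n + 1)) (𝓟 n) 0 (P.complex.d (n + 1) n)) ∧
    IsHomogeneousMap (M' := M) (𝓟 0) 𝓜 0 (P.π.f 0) ∧
    ∃ (f : P.complex.X j ⟶ M') (hf : P.complex.d (j + 1) j ≫ f = 0),
      IsHomogeneousMap (𝓟 j) 𝓜' k f ∧ P.extMk f (j + 1) rfl hf = x}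

/-! ## The action of `GL_N(ℂ)` on `Ext` -/

/-- The exact functor that twists an `S`-module by `g`: the module `M` with the scalar
multiplication `s * x := (g⁻¹ s) x`. -/
abbrev twist {N : ℕ} (g : GL (Fin N) ℂ) : ModuleCat.{0} (Poly N) ⥤ ModuleCat.{0} (Poly N) :=
  (ModuleCat.restrictScalarsEquivalenceOfRingEquiv (polyAct N g⁻¹).toRingEquiv).functor

/-- For an `S`-module `M` and an additive map `ρ` with `ρ (s x) = (g⁻¹ s) (ρ x)`, the `S`-linear
map `x ↦ ρ x` from `M` to its twist by `g`. -/
def toTwist {N : ℕ} (g : GL (Fin N) ℂ) (M : ModuleCat.{0} (Poly N)) (ρ : M →+ M)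
    (hρ : ∀ (s : Poly N) (x : M), ρ (s • x) = polyAct N g⁻¹ s • ρ x) :
    M ⟶ (twist g).obj M :=
  @ModuleCat.ofHom (Poly N) _ M ((twist g).obj M) _ M.isModule _ ((twist g).obj M).isModule
    { toFun := ρ
      map_add' := ρ.map_add
      map_smul' := hρ }

/-- For an `S`-module `M` and an additive map `ρ` with `ρ (s x) = (g s) (ρ x)`, the `S`-linear
map `x ↦ ρ x` from the twist of `M` by `g` to `M`. -/
def ofTwist {N : ℕ} (g : GL (Fin N) ℂ) (M : ModuleCat.{0} (Poly N)) (ρ : M →+ M)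
    (hρ : ∀ (s : Poly N) (x : M), ρ (s • x) = polyAct N g s • ρ x) :
    (twist g).obj M ⟶ M :=
  @ModuleCat.ofHom (Poly N) _ ((twist g).obj M) M _ ((twist g).obj M).isModule _ M.isModule
    { toFun := ρ
      map_add' := ρ.map_add
      map_smul' := fun s x => by
        refine (hρ (polyAct N g⁻¹ s) x).trans ?_
        rw [← polyAct_mul_apply, mul_inv_cancel, map_one]
        rfl }

/-- `S / 𝔪^d` as an `S`-module. -/
abbrev quotModule (N d : ℕ) : ModuleCat.{0} (Poly N) := ModuleCat.of (Poly N) (PowQuot N d)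

/-- `S` as an `S`-module. -/
abbrev freeModule (N : ℕ) : ModuleCat.{0} (Poly N) := ModuleCat.of (Poly N) (Poly N)

theorem quotAct_smul {N : ℕ} (d : ℕ) (g : GL (Fin N) ℂ) (s : Poly N) (x : PowQuot N d) :
    quotAct d g (s • x) = polyAct N g s • quotAct d g x := by
  obtain ⟨p, rfl⟩ := Ideal.Quotient.mk_surjective x
  change quotAct d g (Ideal.Quotient.mk _ (s * p)) =
    Ideal.Quotient.mk _ (polyAct N g s * polyAct N g p)
  rw [← map_mul]
  rfl

/-- The module `Ext^j_S(S / 𝔪^d, S)`. -/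
abbrev ExtPow (N d j : ℕ) : Type := Abelian.Ext.{0} (quotModule N d) (freeModule N) j

/-- The action of `g ∈ GL_N(ℂ)` on `Ext^j_S(S / 𝔪^d, S)` by transport of structure: the class `x`
is mapped by the twist functor and then composed on both sides with the actions of `g⁻¹` on
`S / 𝔪^d` and of `g` on `S`. For `j = 0` this is `f ↦ g ∘ f ∘ g⁻¹`. -/
def extAct (N d j : ℕ) (g : GL (Fin N) ℂ) (x : ExtPow N d j) : ExtPow N d j :=
  ((Abelian.Ext.mk₀ (toTwist g (quotModule N d) (quotAct d g⁻¹).toAddMonoidHom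
      (quotAct_smul d g⁻¹))).comp (x.mapExactFunctor (twist g)) (zero_add j)).comp
    (Abelian.Ext.mk₀ (ofTwist g (freeModule N) (polyAct N g : Poly N →+* Poly N).toAddMonoidHom
      (fun s p => map_mul (polyAct N g) s p))) (add_zero j)

/-- The grading of `Ext^j_S(S / 𝔪^d, S)`. -/
def extPowGrading (N d j : ℕ) (k : ℤ) : Set (ExtPow N d j) :=
  extGrading (M := quotModule N d) (M' := freeModule N) (quotGrading N d) (polyGrading N) j k

/-! ## Schur functors -/

/-- The boxes of the Young diagram with `μ k` boxes in row `k`. -/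
abbrev Box {N : ℕ} (μ : Fin N → ℕ) : Type := Σ k : Fin N, Fin (μ k)

/-- The tensor power of `ℂ^N` whose factors are indexed by the boxes of the diagram of `μ`. -/
abbrev BoxTensor {N : ℕ} (μ : Fin N → ℕ) : Type := ⨂[ℂ] _ : Box μ, (Fin N → ℂ)

/-- The permutation of the tensor factors given by a permutation of the boxes. -/
def permFactors {N : ℕ} (μ : Fin N → ℕ) (σ : Equiv.Perm (Box μ)) :
    BoxTensor μ →ₗ[ℂ] BoxTensor μ :=
  (PiTensorProduct.reindex ℂ (fun _ : Box μ => (Fin N → ℂ)) σ).toLinearMap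

/-- The permutations of the boxes that preserve each row. -/
def rowPerms {N : ℕ} (μ : Fin N → ℕ) : Finset (Equiv.Perm (Box μ)) :=
  Finset.univ.filter fun σ => ∀ b, (σ b).1 = b.1

/-- The permutations of the boxes that preserve each column. -/
def colPerms {N : ℕ} (μ : Fin N → ℕ) : Finset (Equiv.Perm (Box μ)) :=
  Finset.univ.filter fun σ => ∀ b, ((σ b).2 : ℕ) = (b.2 : ℕ)

/-- The Young symmetrizer of the diagram of `μ`, acting on the tensor power: antisymmetrize along
the columns, then symmetrize along the rows. -/
def youngSymmetrizer {N : ℕ} (μ : Fin N → ℕ) : BoxTensor μ →ₗ[ℂ] BoxTensor μ :=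
  (∑ σ ∈ rowPerms μ, permFactors μ σ) ∘ₗ
    (∑ τ ∈ colPerms μ, ((Equiv.Perm.sign τ : ℤ) : ℂ) • permFactors μ τ)

/-- The diagonal action of a matrix on the tensor power. -/
def tensorAct {N : ℕ} (μ : Fin N → ℕ) (A : Matrix (Fin N) (Fin N) ℂ) :
    BoxTensor μ →ₗ[ℂ] BoxTensor μ :=
  PiTensorProduct.map fun _ => Matrix.toLin' A

theorem tensorAct_permFactors {N : ℕ} (μ : Fin N → ℕ) (A : Matrix (Fin N) (Fin N) ℂ)
    (σ : Equiv.Perm (Box μ)) (x : BoxTensor μ) :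
    tensorAct μ A (permFactors μ σ x) = permFactors μ σ (tensorAct μ A x) :=
  PiTensorProduct.map_reindex (fun _ => Matrix.toLin' A) σ x

theorem tensorAct_youngSymmetrizer {N : ℕ} (μ : Fin N → ℕ) (A : Matrix (Fin N) (Fin N) ℂ)
    (x : BoxTensor μ) :
    tensorAct μ A (youngSymmetrizer μ x) = youngSymmetrizer μ (tensorAct μ A x) := by
  simp [youngSymmetrizer, tensorAct_permFactors]

theorem tensorAct_one {N : ℕ} (μ : Fin N → ℕ) : tensorAct μ 1 = LinearMap.id := by
  simp only [tensorAct, Matrix.toLin'_one]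
  exact PiTensorProduct.map_id

theorem tensorAct_mul {N : ℕ} (μ : Fin N → ℕ) (A B : Matrix (Fin N) (Fin N) ℂ) :
    tensorAct μ (A * B) = tensorAct μ A ∘ₗ tensorAct μ B := by
  simp only [tensorAct, Matrix.toLin'_mul]
  exact PiTensorProduct.map_comp _ _

/-- For a partition `μ` with at most `N` parts, the Schur functor `𝕊_μ` applied to `ℂ^N`: the image
of the Young symmetrizer in the tensor power. -/
def schurSpace {N : ℕ} (μ : Fin N → ℕ) : Submodule ℂ (BoxTensor μ) :=
  LinearMap.range (youngSymmetrizer μ)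

theorem tensorAct_mem_schurSpace {N : ℕ} (μ : Fin N → ℕ) (A : Matrix (Fin N) (Fin N) ℂ) :
    ∀ x ∈ schurSpace μ, tensorAct μ A x ∈ schurSpace μ := by
  rintro _ ⟨y, rfl⟩
  exact ⟨tensorAct μ A y, (tensorAct_youngSymmetrizer μ A y).symm⟩

/-- The representation of `GL_N(ℂ)` on `𝕊_μ ℂ^N`, for a partition `μ` with at most `N` parts. -/
def schurRep {N : ℕ} (μ : Fin N → ℕ) : Representation ℂ (GL (Fin N) ℂ) (schurSpace μ) where
  toFun g := (tensorAct μ g.val).restrict (tensorAct_mem_schurSpace μ g.val)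
  map_one' := by
    ext1 x
    apply Subtype.ext
    exact LinearMap.congr_fun (tensorAct_one μ) x
  map_mul' g h := by
    ext1 x
    apply Subtype.ext
    exact LinearMap.congr_fun (tensorAct_mul μ g.val h.val) x

/-- For a dominant weight `w = (w_1 ≥ ⋯ ≥ w_N)`, the partition `w - (w_N, …, w_N)`. -/
def weightPartition {N : ℕ} [NeZero N] (w : Fin N → ℤ) : Fin N → ℕ :=
  fun k => (w k - w ⊤).toNat

/-- The space of the representation `𝕊_w ℂ^N`, for a dominant weight `w`. -/
abbrev WeightSpace {N : ℕ} [NeZero N] (w : Fin N → ℤ) : Type :=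
  schurSpace (weightPartition w)

/-- The representation `𝕊_w ℂ^N` of `GL_N(ℂ)`, for a dominant weight `w`: the representation
`𝕊_{w - (w_N, …, w_N)} ℂ^N` tensored with the power of exponent `w_N` of the determinant. -/
def weightRep {N : ℕ} [NeZero N] (w : Fin N → ℤ) :
    Representation ℂ (GL (Fin N) ℂ) (WeightSpace w) where
  toFun g := ((Matrix.GeneralLinearGroup.det g ^ w ⊤ : ℂˣ) : ℂ) • schurRep (weightPartition w) g
  map_one' := by simp
  map_mul' g h := by
    rw [map_mul, map_mul, mul_zpow, Units.val_mul, smul_mul_smul_comm]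

/-- The dominant weight `(-1, …, -1, -i-1)`, with `N - 1` entries equal to `-1`. -/
def extWeight (N : ℕ) [NeZero N] (i : ℕ) : Fin N → ℤ :=
  fun k => if k = ⊤ then -(i : ℤ) - 1 else -1

end PowerExt

end

/-!
Write `S = ℂ[X_1, …, X_N]` and `F_d = Ext^N(S / 𝔪^d, S)`. The short exact sequences
`0 → 𝔪^d / 𝔪^(d+1) → S / 𝔪^(d+1) → S / 𝔪^d → 0`, whose first term is a finite power of the residue
field `S / 𝔪`, reduce everything to the residue field.

*The residue field.* Killing the variables one at a time (`ext_firstVars`) shows that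
`Ext^j(S / 𝔪, S)` vanishes for `j ≠ N` and is a line for `j = N`, and gives the action of the
diagonal torus on the line. A transvection is conjugate to its square, so it acts trivially on the
line, which is therefore `det⁻¹` (`character_eq_det_inv`, `extAct_residueGen`).

*The filtration.* Hence `Ext^j(S / 𝔪^d, S) = 0` for `j ≠ N`, and `F_d → F_(d+1)` is injective. For a
linear form `ℓ` with coefficient vector `η`, the multiplication by `ℓ^d` maps `S / 𝔪` to
`S / 𝔪^(d+1)`; pulling back a class of `F_(d+1)` along it gives a function of `η`, which is a
homogeneous polynomial of degree `d`. This identifies `F_(d+1) / F_d` with the space of such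
functions, with the action `F ↦ det(g)⁻¹ F(g⁻¹ ·)` (`topFun`). The scalar matrix `2` acts on the
successive quotients by distinct powers of `2` and commutes with `GL_N(ℂ)`, so the filtration splits
equivariantly (`exists_splitting`).

*Schur functors.* The weight `(-1, …, -1, -i-1)` is a twist of the rectangular partition with
`N - 1` rows of length `i`. A pure tensor on its boxes gives the function of `η` that is the product
over the columns of the determinants `det[v_1, …, v_(N-1), η]`. Comparing with the evaluations of
tensors at matrices, which detect the tensors that are symmetric along the rows, shows that this map
and the Young symmetrizer have the same kernel; its image consists of all homogeneous polynomial
functions of degree `i` (`exists_weightSpace_equiv`).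

*The grading.* The scalar matrix `t` acts by `t^k` on a homogeneous class of degree `k`
(`extAct_scalarGL`), as a computation with cocycles on a graded resolution shows. Conversely every
class is a sum of homogeneous ones, because `S / 𝔪^d` has a graded resolution by free modules of
finite rank (`exists_eq_sum_homogeneous`). So the graded pieces are the eigenspaces of the scalar
matrix `2`.

The action on `Ext` is defined through the twist functors. It is computed on cocycles, and shown to
be multiplicative and compatible with connecting homomorphisms, by means of general facts on the
maps induced on `Ext` by exact functors.
-/

/-! ### Exact functors and `Ext` classes -/

section

open Limits Abelian

namespace CategoryTheory.Abelian.Ext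
universe w₁ w₂ w₃ v₁ v₂ v₃ u₁ u₂ u₃
variable {C : Type u₁} [Category.{v₁} C] [Abelian C] {D : Type u₂} [Category.{v₂} D] [Abelian D]
  {E : Type u₃} [Category.{v₃} E] [Abelian E] [HasExt.{w₁} C] [HasExt.{w₂} D] [HasExt.{w₃} E]

/-- Dimension shifting: a class of positive degree is the product of the class of a short exact
sequence with a class of degree one less. -/
lemma exists_extClass_comp_eq [EnoughProjectives C] {X Y : C} {n : ℕ} (x : Ext.{w₁} X Y (n + 1)) :
    ∃ (S : ShortComplex C) (hS : S.ShortExact) (hX : S.X₃ = X) (y : Ext S.X₁ Y n),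
      hX ▸ hS.extClass.comp y (add_comm 1 n) = x := by
  let S := ShortComplex.mk _ _ (kernel.condition (Projective.π X))
  have hS : S.ShortExact := { exact := ShortComplex.exact_of_f_is_kernel _ (kernelIsKernel S.g) }
  obtain ⟨y, hy⟩ := contravariant_sequence_exact₃ hS Y x (eq_zero_of_projective _) (add_comm 1 n)
  exact ⟨S, hS, rfl, y, hy⟩

/-- The map induced on `Ext` by an exact functor is natural in the functor. -/
lemma mapExactFunctor_comp_natTrans [EnoughProjectives C] (F G : C ⥤ D) [F.Additive] [G.Additive]
    [PreservesFiniteLimits F] [PreservesFiniteColimits F] [PreservesFiniteLimits G]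
    [PreservesFiniteColimits G] (α : F ⟶ G) {X Y : C} {n : ℕ} (x : Ext.{w₁} X Y n) :
    (x.mapExactFunctor F).comp (mk₀ (α.app Y)) (add_zero n) =
      (mk₀ (α.app X)).comp (x.mapExactFunctor G) (zero_add n) := by
  induction n generalizing X with
  | zero =>
    obtain ⟨f, rfl⟩ := (mk₀_bijective X Y).2 x
    simp only [mapExactFunctor_mk₀, mk₀_comp_mk₀, α.naturality]
  | succ n ih =>
    obtain ⟨S, hS, rfl, y, rfl⟩ := exists_extClass_comp_eq x
    obtain ⟨u, hu⟩ : ∃ u : Ext (F.obj S.X₃) (F.obj S.X₁) 1, u = (hS.map_of_exact F).extClass :=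
      ⟨_, rfl⟩
    obtain ⟨v, hv⟩ : ∃ v : Ext (G.obj S.X₃) (G.obj S.X₁) 1, v = (hS.map_of_exact G).extClass :=
      ⟨_, rfl⟩
    have h : u.comp (mk₀ (α.app S.X₁)) (add_zero 1) = (mk₀ (α.app S.X₃)).comp v (zero_add 1) := by
      rw [hu, hv]
      exact ShortComplex.ShortExact.extClass_naturality (hS.map_of_exact F) (hS.map_of_exact G)
        (S.mapNatTrans α)
    have hu' : hS.extClass.mapExactFunctor F = u := (mapExactFunctor_extClass F hS).trans hu.symm
    have hv' : hS.extClass.mapExactFunctor G = v := (mapExactFunctor_extClass G hS).trans hv.symm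
    rw [mapExactFunctor_comp, mapExactFunctor_comp, hu', hv', comp_assoc_of_third_deg_zero, ih,
      ← comp_assoc_of_second_deg_zero, h, comp_assoc]
    omega

lemma mapExactFunctor_mapExactFunctor [EnoughProjectives C] (F : C ⥤ D) (G : D ⥤ E) [F.Additive]
    [G.Additive] [PreservesFiniteLimits F] [PreservesFiniteColimits F] [PreservesFiniteLimits G]
    [PreservesFiniteColimits G] [PreservesFiniteLimits (F ⋙ G)] [PreservesFiniteColimits (F ⋙ G)]
      {X Y : C} {n : ℕ} (x : Ext.{w₁} X Y n) :
    (x.mapExactFunctor F).mapExactFunctor G = x.mapExactFunctor (F ⋙ G) := by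
  induction n generalizing X with
  | zero =>
    obtain ⟨f, rfl⟩ := (mk₀_bijective X Y).2 x
    rw [mapExactFunctor_mk₀, mapExactFunctor_mk₀, mapExactFunctor_mk₀]
    rfl
  | succ n ih =>
    obtain ⟨S, hS, rfl, y, rfl⟩ := exists_extClass_comp_eq x
    have h : (hS.extClass.mapExactFunctor F).mapExactFunctor G =
        hS.extClass.mapExactFunctor (F ⋙ G) := by
      refine (congrArg (mapExactFunctor G) (mapExactFunctor_extClass F hS)).trans ?_
      exact (mapExactFunctor_extClass G (hS.map_of_exact F)).trans
        (mapExactFunctor_extClass (F ⋙ G) hS).symm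
    rw [mapExactFunctor_comp, mapExactFunctor_comp, mapExactFunctor_comp, h, ih]
end CategoryTheory.Abelian.Ext

end

/-! ### Exact functors and cocycles on projective resolutions -/

section

open Limits Abelian CochainComplex HomComplex Localization

namespace CategoryTheory

section

universe u₁ u₂ u₃ u₄ v₁ v₂ v₃ v₄

lemma map_iso_comp_augmentation {C : Type u₁} [Category.{v₁} C] {D : Type u₂} [Category.{v₂} D]
    (F : C ⥤ D)
    {a' b' x' s' s'' : D} {a b x s : C} (e' : a' ≅ b') (θ : b' ⟶ F.obj b) (e : a ≅ b) (ε : b ⟶ x)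
    (i : s ≅ x) (j : s'' ≅ F.obj x) (ε' : b' ⟶ x') (k : s' ≅ x') (g : x' ⟶ F.obj x)
    (h : θ ≫ F.map ε = ε' ≫ g) :
    (e'.hom ≫ θ ≫ F.map e.inv) ≫ F.map (e.hom ≫ ε ≫ i.inv) ≫ F.map i.hom ≫ j.inv =
      (e'.hom ≫ ε' ≫ k.inv) ≫ k.hom ≫ g ≫ j.inv := by
  simp only [Category.assoc, Iso.inv_hom_id_assoc]
  rw [← F.map_comp_assoc, ← F.map_comp_assoc, ← reassoc_of% h]
  simp

lemma map_iso_comp_cochain {C : Type u₁} [Category.{v₁} C] {D : Type u₂} [Category.{v₂} D]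
    (F : C ⥤ D)
    {a' b' s' : D} {a b y s : C} (e' : a' ≅ b') (θ : b' ⟶ F.obj b) (e : a ≅ b) (f : b ⟶ y)
    (i : s ≅ y) (j : s' ≅ F.obj y) :
    ((e'.hom ≫ θ ≫ F.map e.inv) ≫ F.map ((e.hom ≫ f) ≫ i.inv)) ≫ F.map i.hom ≫ j.inv =
      (e'.hom ≫ θ ≫ F.map f) ≫ j.inv := by
  simp only [Category.assoc]
  rw [← F.map_comp_assoc, ← F.map_comp_assoc]
  simp

lemma map_iso_comp_differential {C : Type u₁} [Category.{v₁} C] {D : Type u₂} [Category.{v₂} D]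
    (F : C ⥤ D)
    {a' b' c' d' : D} {a b c d : C} (e' : a' ≅ b') (θ : b' ⟶ F.obj b) (e : a ≅ b) (δ : b ⟶ d)
    (i : c ≅ d) (k : c' ≅ d') (δ' : b' ⟶ d') (θ' : d' ⟶ F.obj d)
    (h : θ ≫ F.map δ = δ' ≫ θ') :
    (e'.hom ≫ θ ≫ F.map e.inv) ≫ F.map (e.hom ≫ δ ≫ i.inv) =
      (e'.hom ≫ δ' ≫ k.inv) ≫ k.hom ≫ θ' ≫ F.map i.inv := by
  simp only [Category.assoc, Iso.inv_hom_id_assoc]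
  rw [← F.map_comp, Iso.inv_hom_id_assoc, F.map_comp, reassoc_of% h]

variable {K₁ : Type u₁} {K₂ : Type u₂} {D₁ : Type u₃} {D₂ : Type u₄} [Category.{v₁} K₁]
    [Category.{v₂} K₂]
  [Category.{v₃} D₁] [Category.{v₄} D₂] [HasShift K₁ ℤ] [HasShift K₂ ℤ] [HasShift D₁ ℤ]
    [HasShift D₂ ℤ]
  (Q₁ : K₁ ⥤ D₁) (Q₂ : K₂ ⥤ D₂) (Φ : K₁ ⥤ K₂) (G : D₁ ⥤ D₂)
  [Q₁.CommShift ℤ] [Q₂.CommShift ℤ] [Φ.CommShift ℤ] [G.CommShift ℤ]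
  (e : Q₁ ⋙ G ≅ Φ ⋙ Q₂) [NatTrans.CommShift e.hom ℤ]

/-- If `Φ` induces `G` on localizations `Q₁`, `Q₂`, then `G` maps the fraction `φ ∘ π⁻¹` to the
fraction `Φ(φ) ∘ Φ(π)⁻¹`; here the latter is rewritten along a morphism `θ` of the source and
along identifications `a`, `b`, `c`, `d` of the images of the objects involved. -/
lemma shiftedHom_map_fraction {K M L : K₁} {K' M' N L' : K₂} {M₀ L₀ : D₁} {M₀' N₀ L₀' : D₂} (n : ℤ)
   (π : K ⟶ M) [IsIso (Q₁.map π)] (π' : K' ⟶ M') [IsIso (Q₂.map π')] (φ : K ⟶ L⟦n⟧)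
   (θ : K' ⟶ Φ.obj K) (γ : M' ⟶ N) (a : Φ.obj M ⟶ N) (b : Φ.obj L ⟶ L')
   (hπ : θ ≫ Φ.map π ≫ a = π' ≫ γ) (φ' : K' ⟶ L'⟦n⟧)
   (hφ' : θ ≫ Φ.map φ ≫ (Φ.commShiftIso n).hom.app L ≫ b⟦n⟧' = φ')
   (u : M₀ ≅ Q₁.obj M) (w : L₀ ≅ Q₁.obj L) (u' : M₀' ≅ Q₂.obj M') (v : N₀ ≅ Q₂.obj N)
    (w' : L₀' ≅ Q₂.obj L')
   (c : G.obj M₀ ≅ N₀) (d : G.obj L₀ ≅ L₀')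
   (hc : e.inv.app M ≫ G.map u.inv ≫ c.hom ≫ v.hom = Q₂.map a)
   (hd : e.inv.app L ≫ G.map w.inv ≫ d.hom ≫ w'.hom = Q₂.map b)
   (γ₀ : M₀' ⟶ N₀) (hγ : u'.hom ≫ Q₂.map γ = γ₀ ≫ v.hom) :
   (ShiftedHom.mk₀ (0 : ℤ) rfl γ₀).comp (c.inv ≫ ShiftedHom.map
       ((ShiftedHom.mk₀ (0 : ℤ) rfl (u.hom ≫ inv (Q₁.map π))).comp
         ((ShiftedHom.map φ Q₁).comp (ShiftedHom.mk₀ (0 : ℤ) rfl w.inv) (zero_add n)) (add_zero n))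
           G ≫
       d.hom⟦n⟧') (add_zero n) =
   (ShiftedHom.mk₀ (0 : ℤ) rfl (u'.hom ≫ inv (Q₂.map π'))).comp
      ((ShiftedHom.map φ' Q₂).comp (ShiftedHom.mk₀ (0 : ℤ) rfl w'.inv) (zero_add n)) (add_zero n)
        := by
  subst hφ'
  have hγ' : u'.inv ≫ γ₀ = Q₂.map γ ≫ v.inv := by rw [Iso.inv_comp_eq, ← Category.assoc,
      Iso.eq_comp_inv, hγ]
  have hc' : Q₂.map a ≫ v.inv ≫ c.inv = e.inv.app M ≫ G.map u.inv := by
    rw [← hc]; simp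
  have hd' : Q₂.map b ≫ w'.inv = e.inv.app L ≫ G.map w.inv ≫ d.hom := by
    rw [← hd]; simp
  rw [← cancel_epi u'.inv, ← cancel_epi (Q₂.map π')]
  simp only [ShiftedHom.map, ShiftedHom.comp_mk₀, ShiftedHom.mk₀_comp, Category.assoc,
      Functor.map_comp,
    Iso.inv_hom_id_assoc, IsIso.hom_inv_id_assoc, Functor.commShiftIso_hom_naturality]
  rw [reassoc_of% hγ', ← Q₂.map_comp_assoc, ← hπ]
  simp only [Functor.map_comp, Category.assoc]
  rw [reassoc_of% hc']
  have n1 := e.inv.naturality π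
  have n2 := e.inv.naturality φ
  have n3 := NatTrans.app_shift e.inv n L
  simp only [Functor.comp_map] at n1 n2
  rw [← G.map_comp_assoc u.inv, Iso.inv_hom_id, G.map_id, Category.id_comp, reassoc_of% n1,
    ← G.map_comp_assoc, IsIso.hom_inv_id, G.map_id,
    Category.id_comp]
  simp only [Functor.comp_obj] at n3
  have n4 : e.inv.app (L⟦n⟧) ≫ G.map ((Q₁.commShiftIso n).hom.app L) ≫
      (G.commShiftIso n).hom.app (Q₁.obj L) =
    Q₂.map ((Φ.commShiftIso n).hom.app L) ≫ (Q₂.commShiftIso n).hom.app (Φ.obj L) ≫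
      (e.inv.app L)⟦n⟧' := by
    have h1 : G.map ((Q₁.commShiftIso n).inv.app L) ≫ G.map ((Q₁.commShiftIso n).hom.app L) = 𝟙 _
        := by
      rw [← G.map_comp, Iso.inv_hom_id_app, G.map_id]
    have h2 := (G.commShiftIso n).inv_hom_id_app (Q₁.obj L)
    simp only [Functor.comp_obj] at h1 h2
    rw [n3, Functor.commShiftIso_comp_hom_app, Functor.commShiftIso_comp_inv_app]
    simp only [Category.assoc]
    rw [reassoc_of% h1, h2, Category.comp_id]
  simp only [← Functor.map_comp]
  rw [hd']
  simp only [Functor.map_comp]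
  rw [← reassoc_of% n2, reassoc_of% n4]
end
end CategoryTheory

namespace CategoryTheory.ProjectiveResolution

lemma equivHomShift_map_v {C : Type u} [Category.{v} C] [Preadditive C] {D : Type u'}
    [Category.{v'} D] [Preadditive D]
    (F : C ⥤ D) [F.Additive] {K L : CochainComplex C ℤ} (n : ℤ) (φ : K ⟶ L⟦n⟧) (p q : ℤ)
      (hpq : p + n = q) :
    (Cocycle.equivHomShift ((F.mapHomologicalComplex (ComplexShape.up ℤ)).map φ ≫
      ((F.mapHomologicalComplex (ComplexShape.up ℤ)).commShiftIso n).hom.app L)).1.v p q hpq =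
      F.map ((Cocycle.equivHomShift φ).1.v p q hpq) := by
  rw [Cocycle.equivHomShift_apply, Cocycle.equivHomShift_apply]
  subst hpq
  rw [Cocycle.rightUnshift_coe]
  rw [Cocycle.rightUnshift_coe]
  rw [Cochain.rightUnshift_v _ _ _ _ _ _ p (add_zero p), Cochain.rightUnshift_v _ _ _ _ _ _ p
      (add_zero p)]
  -- in these degrees the identifications of the terms of a shifted complex are identity maps
  have h2 : ∀ {a b : C} (u : a ⟶ b), F.map (u ≫ 𝟙 b) = F.map u := fun u => by simp
  rw [Cocycle.ofHom_coe, Cocycle.ofHom_coe, Cochain.ofHom_v, Cochain.ofHom_v]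
  have h3 : (((F.mapHomologicalComplex (ComplexShape.up ℤ)).map φ ≫
                (Functor.commShiftIso (F.mapHomologicalComplex (ComplexShape.up ℤ)) n).hom.app
                  L)).f p = F.map (φ.f p) := Category.comp_id (F.map (φ.f p))
  rw [h3]
  exact (Category.comp_id _).trans (h2 (φ.f p)).symm

universe w w' v v' u u'
variable {C : Type u} [Category.{v} C] [Abelian C] {D : Type u'} [Category.{v'} D] [Abelian D]

/-- The augmentation `P_0 ⟶ X` of a projective resolution, as a morphism of the abelian category. -/
noncomputable def augmentation {X : C} (R : ProjectiveResolution X) : R.complex.X 0 ⟶ X :=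
  R.π.f 0

variable (F : C ⥤ D) [F.Additive] {X Y : C} {X' : D} (R : ProjectiveResolution X)
    (R' : ProjectiveResolution X')

open Classical in
/-- The morphism of cochain complexes indexed by `ℤ` given by a morphism `θ` from the projective
resolution `R'` to the image of the projective resolution `R` under `F`. -/
noncomputable def toMapCochainComplex (θ : ∀ n, R'.complex.X n ⟶ F.obj (R.complex.X n))
   (hθ : ∀ i j, θ i ≫ F.map (R.complex.d i j) = R'.complex.d i j ≫ θ j) : R'.cochainComplex ⟶
    (F.mapHomologicalComplex (ComplexShape.up ℤ)).obj R.cochainComplex where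
  f i := if h : ∃ n : ℕ, -(n : ℤ) = i then
      (R'.cochainComplexXIso i h.choose h.choose_spec).hom ≫ θ _ ≫
        F.map (R.cochainComplexXIso i h.choose h.choose_spec).inv
    else 0
  comm' i j hij := by
    by_cases hi : ∃ n : ℕ, -(n : ℤ) = i
    · by_cases hj : ∃ n : ℕ, -(n : ℤ) = j
      · rw [dif_pos hi, dif_pos hj, cochainComplex_d _ i j _ _ hi.choose_spec hj.choose_spec,
          Functor.mapHomologicalComplex_obj_d,
          cochainComplex_d _ i j _ _ hi.choose_spec hj.choose_spec]
        exact map_iso_comp_differential F _ _ _ _ _ _ _ _ (hθ _ _)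
      · have : IsZero (R.cochainComplex.X j) := by
          refine CochainComplex.isZero_of_isStrictlyLE _ 0 j ?_
          by_contra h
          exact hj ⟨j.natAbs, by omega⟩
        exact (F.map_isZero this).eq_of_tgt _ _
    · have : IsZero (R'.cochainComplex.X i) := by
          refine CochainComplex.isZero_of_isStrictlyLE _ 0 i ?_
          by_contra h
          exact hi ⟨i.natAbs, by omega⟩
      exact this.eq_of_src _ _

variable {F R R'}

lemma toMapCochainComplex_f (θ : ∀ n, R'.complex.X n ⟶ F.obj (R.complex.X n))
   (hθ : ∀ i j, θ i ≫ F.map (R.complex.d i j) = R'.complex.d i j ≫ θ j) (n : ℕ) (i : ℤ)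
    (h : -(n : ℤ) = i) :
    (toMapCochainComplex F R R' θ hθ).f i =
      (R'.cochainComplexXIso i n h).hom ≫ θ n ≫
        F.map (R.cochainComplexXIso i n h).inv := by
  have hi : ∃ n : ℕ, -(n : ℤ) = i := ⟨n, h⟩
  obtain rfl : hi.choose = n := by have := hi.choose_spec; omega
  exact dif_pos hi

lemma toMapCochainComplex_comp_π' (θ : ∀ n, R'.complex.X n ⟶ F.obj (R.complex.X n))
   (hθ : ∀ i j, θ i ≫ F.map (R.complex.d i j) = R'.complex.d i j ≫ θ j) (g : X' ⟶ F.obj X)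
   (hg : θ 0 ≫ F.map R.augmentation = R'.augmentation ≫ g) :
    toMapCochainComplex F R R' θ hθ ≫ (F.mapHomologicalComplex _).map R.π' ≫
      (F.mapCochainComplexSingleFunctor 0).hom.app X =
      R'.π' ≫ (CochainComplex.singleFunctor D 0).map g := by
  have h1 : R.π'.f 0 = (R.cochainComplexXIso 0 0).hom ≫ R.augmentation ≫
      (HomologicalComplex.singleObjXSelf (.up ℤ) 0 X).inv := π'_f_zero R
  have h2 : R'.π'.f 0 = (R'.cochainComplexXIso 0 0).hom ≫ R'.augmentation ≫
      (HomologicalComplex.singleObjXSelf (.up ℤ) 0 X').inv := π'_f_zero R'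
  have h3 : ((F.mapCochainComplexSingleFunctor 0).hom.app X).f 0 = F.map
      (HomologicalComplex.singleObjXSelf (.up ℤ) 0 X).hom ≫ (HomologicalComplex.singleObjXSelf
      (.up ℤ) 0 (F.obj X)).inv :=
    HomologicalComplex.singleMapHomologicalComplex_hom_app_self ..
  have h4 : ((CochainComplex.singleFunctor D 0).map g).f 0 = (HomologicalComplex.singleObjXSelf
      (.up ℤ) 0 X').hom ≫ g ≫ (HomologicalComplex.singleObjXSelf (.up ℤ) 0 _).inv :=
    HomologicalComplex.single_map_f_self ..
  apply HomologicalComplex.to_single_hom_ext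
  rw [HomologicalComplex.comp_f, HomologicalComplex.comp_f, HomologicalComplex.comp_f,
      toMapCochainComplex_f θ hθ 0 0 rfl,
    Functor.mapHomologicalComplex_map_f, h1, h2, h3, h4]
  exact map_iso_comp_augmentation F _ _ _ _ _ _ _ _ _ hg

/-- An exact functor `F` maps the class of a cocycle `f` on a projective resolution `R` of `X` to
the class of the cocycle `F f`; this is expressed on a projective resolution `R'` of an object `X'`
that maps to `F X`, by means of a lift `θ` of `X' ⟶ F X` to the resolutions. -/
lemma mk₀_comp_mapExactFunctor_extMk [PreservesFiniteLimits F] [PreservesFiniteColimits F]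
    [HasExt.{w} C] [HasExt.{w'} D] (θ : ∀ n, R'.complex.X n ⟶ F.obj (R.complex.X n))
   (hθ : ∀ i j, θ i ≫ F.map (R.complex.d i j) = R'.complex.d i j ≫ θ j) (g : X' ⟶ F.obj X)
   (hg : θ 0 ≫ F.map R.augmentation = R'.augmentation ≫ g) {n : ℕ} (f : R.complex.X n ⟶ Y) (m : ℕ)
    (hm : n + 1 = m)
    (hf : R.complex.d m n ≫ f = 0) :
    (Ext.mk₀ g).comp ((R.extMk f m hm hf).mapExactFunctor F) (zero_add n) =
      R'.extMk (θ n ≫ F.map f) m hm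
        (by rw [← reassoc_of% hθ, ← F.map_comp, hf, F.map_zero, comp_zero]) := by
  let := HasDerivedCategory.standard C
  let := HasDerivedCategory.standard D
  ext
  rw [Ext.comp_hom, Ext.mk₀_hom, Ext.mapExactFunctor_hom, extMk_hom, extMk_hom]
  generalize hφ : (Cocycle.equivHomShift (K := R.cochainComplex)
    (L := (singleFunctor C 0).obj Y) (n := n)).symm
      (Cocycle.toSingleMk ((R.cochainComplexXIso (-n) n rfl).hom ≫ f) _ _ _ _) = φ
  generalize hφ' : (Cocycle.equivHomShift (K := R'.cochainComplex)
    (L := (singleFunctor D 0).obj (F.obj Y)) (n := n)).symm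
      (Cocycle.toSingleMk ((R'.cochainComplexXIso (-n) n rfl).hom ≫ _) _ _ _ _) = φ'
  have key : toMapCochainComplex F R R' θ hθ ≫ (F.mapHomologicalComplex _).map φ ≫
      ((F.mapHomologicalComplex (ComplexShape.up ℤ)).commShiftIso (n:ℤ)).hom.app _ ≫
      ((F.mapCochainComplexSingleFunctor 0).hom.app Y)⟦(n:ℤ)⟧' = φ' := by
    subst hφ hφ'
    apply Cocycle.equivHomShift.injective
    rw [AddEquiv.apply_symm_apply, ← Category.assoc, ← Category.assoc,
        Cocycle.equivHomShift_comp_shift, Category.assoc,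
      Cocycle.equivHomShift_comp]
    ext p q hpq
    rw [Cocycle.postcomp_coe, Cocycle.precomp_coe]
    rw [Cochain.comp_zero_cochain_v, Cochain.zero_cochain_comp_v, Cochain.ofHom_v, Cochain.ofHom_v,
        equivHomShift_map_v, AddEquiv.apply_symm_apply]
    rw [Cocycle.toSingleMk_coe, Cocycle.toSingleMk_coe]
    by_cases hq : q = 0
    · subst hq
      obtain rfl : p = -n := by omega
      rw [Cochain.toSingleMk_v, Cochain.toSingleMk_v, toMapCochainComplex_f θ hθ n _ rfl]
      have h3 : ((F.mapCochainComplexSingleFunctor 0).hom.app Y).f 0 = F.map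
          (HomologicalComplex.singleObjXSelf (.up ℤ) 0 Y).hom ≫
          (HomologicalComplex.singleObjXSelf (.up ℤ) 0 (F.obj Y)).inv :=
        HomologicalComplex.singleMapHomologicalComplex_hom_app_self ..
      rw [h3]
      exact map_iso_comp_cochain F _ _ _ _ _ _
    · exact (HomologicalComplex.isZero_single_obj_X _ _ _ _ hq).eq_of_tgt _ _
  have hπ := toMapCochainComplex_comp_π' θ hθ g hg
  refine shiftedHom_map_fraction DerivedCategory.Q DerivedCategory.Q
      (F.mapHomologicalComplex (ComplexShape.up ℤ))
    F.mapDerivedCategory F.mapDerivedCategoryFactors n R.π' R'.π' φ _ _ _ _ hπ φ' key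
      ((DerivedCategory.singleFunctorIsoCompQ C 0).app X)
      ((DerivedCategory.singleFunctorIsoCompQ C 0).app Y)
        ((DerivedCategory.singleFunctorIsoCompQ D 0).app X')
      ((DerivedCategory.singleFunctorIsoCompQ D 0).app _)
        ((DerivedCategory.singleFunctorIsoCompQ D 0).app _) ((F.mapDerivedCategorySingleFunctor 0).app X)
      ((F.mapDerivedCategorySingleFunctor 0).app Y) ?_ ?_ _ ?_
  · have := F.mapDerivedCategoryFactors_inv_app_mapDerivedCategorySingleFunctor_hom_app X
    rw [Iso.app_inv, Iso.app_hom, Iso.app_hom]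
    refine Eq.trans ?_ this
    refine congrArg (F.mapDerivedCategoryFactors.inv.app _ ≫ ·) ?_
    refine (congrArg (· ≫ _) (F.mapDerivedCategory.map_id _)).trans
        ((Category.id_comp _).trans (Category.comp_id _))
  · have := F.mapDerivedCategoryFactors_inv_app_mapDerivedCategorySingleFunctor_hom_app Y
    rw [Iso.app_inv, Iso.app_hom, Iso.app_hom]
    refine Eq.trans ?_ this
    refine congrArg (F.mapDerivedCategoryFactors.inv.app _ ≫ ·) ?_
    refine (congrArg (· ≫ _) (F.mapDerivedCategory.map_id _)).trans
        ((Category.id_comp _).trans (Category.comp_id _))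
  · exact ((DerivedCategory.singleFunctorIsoCompQ D 0).hom.naturality g).symm
end CategoryTheory.ProjectiveResolution

end

/-! ### The action on `Ext` of a module with a semilinear automorphism -/

noncomputable section

namespace PowerExt

open Abelian

variable {N : ℕ}

/-- The action of `g` on `S`, as a morphism from the twist of `S` by `g` to `S`. -/
def ofTwistFree (g : GL (Fin N) ℂ) : (twist g).obj (freeModule N) ⟶ freeModule N :=
  ofTwist g (freeModule N) (polyAct N g : Poly N →+* Poly N).toAddMonoidHom
    (fun s p => map_mul (polyAct N g) s p)

/-- The action of `g` on `Ext^j_S(M, S)`, by transport of structure, for an `S`-module `M` on which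
`g⁻¹` acts semilinearly by `ρ`. -/
def genAct (g : GL (Fin N) ℂ) (M : ModuleCat.{0} (Poly N)) (ρ : M →+ M)
    (hρ : ∀ (s : Poly N) (x : M), ρ (s • x) = polyAct N g⁻¹ s • ρ x) (j : ℕ)
    (x : Ext.{0} M (freeModule N) j) : Ext.{0} M (freeModule N) j :=
  ((Ext.mk₀ (toTwist g M ρ hρ)).comp (x.mapExactFunctor (twist g)) (zero_add j)).comp
    (Ext.mk₀ (ofTwistFree g)) (add_zero j)

theorem extAct_eq_genAct (d j : ℕ) (g : GL (Fin N) ℂ) (x : ExtPow N d j) :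
    extAct N d j g x = genAct g (quotModule N d) (quotAct d g⁻¹).toAddMonoidHom
      (quotAct_smul d g⁻¹) j x := rfl

section

variable {g : GL (Fin N) ℂ} {M M' : ModuleCat.{0} (Poly N)} {ρ : M →+ M} {ρ' : M' →+ M'}
  (hρ : ∀ (s : Poly N) (x : M), ρ (s • x) = polyAct N g⁻¹ s • ρ x)
  (hρ' : ∀ (s : Poly N) (x : M'), ρ' (s • x) = polyAct N g⁻¹ s • ρ' x) {j : ℕ}

theorem genAct_add (x y : Ext.{0} M (freeModule N) j) :
    genAct g M ρ hρ j (x + y) = genAct g M ρ hρ j x + genAct g M ρ hρ j y := by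
  simp [genAct]

theorem genAct_smul (s : Poly N) (x : Ext.{0} M (freeModule N) j) :
    genAct g M ρ hρ j (s • x) = polyAct N g s • genAct g M ρ hρ j x := by
  have h : (twist g).map (s • 𝟙 (freeModule N)) ≫ ofTwistFree g =
      ofTwistFree g ≫ (polyAct N g s • 𝟙 (freeModule N)) := by
    refine ModuleCat.hom_ext (LinearMap.ext fun p => ?_)
    exact map_mul (polyAct N g) s p
  rw [Ext.smul_eq_comp_mk₀, Ext.smul_eq_comp_mk₀]
  unfold genAct
  rw [Ext.mapExactFunctor_comp, Ext.mapExactFunctor_mk₀]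
  simp only [Ext.comp_assoc_of_third_deg_zero, Ext.mk₀_comp_mk₀, h]

theorem complex_smul_eq (c : ℂ) (x : Ext.{0} M (freeModule N) j) :
    c • x = (MvPolynomial.C c : Poly N) • x := by
  rw [Ext.smul_eq_comp_mk₀, Ext.smul_eq_comp_mk₀]
  congr 2

theorem genAct_complex_smul (c : ℂ) (x : Ext.{0} M (freeModule N) j) :
    genAct g M ρ hρ j (c • x) = c • genAct g M ρ hρ j x := by
  rw [complex_smul_eq, complex_smul_eq, genAct_smul, ← MvPolynomial.algebraMap_eq,
    AlgEquiv.commutes]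

/-- Naturality of the action in the module. -/
theorem genAct_mk₀_comp (f f' : M ⟶ M') (hf : ∀ m, f.hom (ρ m) = ρ' (f'.hom m))
    (x : Ext.{0} M' (freeModule N) j) :
    genAct g M ρ hρ j ((Ext.mk₀ f).comp x (zero_add j)) =
      (Ext.mk₀ f').comp (genAct g M' ρ' hρ' j x) (zero_add j) := by
  have h : toTwist g M ρ hρ ≫ (twist g).map f = f' ≫ toTwist g M' ρ' hρ' := by
    ext m
    exact hf m
  unfold genAct
  rw [Ext.mapExactFunctor_comp, Ext.mapExactFunctor_mk₀]
  simp only [Ext.comp_assoc_of_third_deg_zero, Ext.mk₀_comp_mk₀_assoc, h]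

theorem genAct_mk₀ (f : M ⟶ freeModule N) (f' : M ⟶ freeModule N)
    (hf : ∀ m, polyAct N g (f.hom (ρ m)) = f'.hom m) :
    genAct g M ρ hρ 0 (Ext.mk₀ f) = Ext.mk₀ f' := by
  unfold genAct
  rw [Ext.mapExactFunctor_mk₀, Ext.mk₀_comp_mk₀, Ext.mk₀_comp_mk₀]
  congr 1
  exact ModuleCat.hom_ext (LinearMap.ext hf)

end

/-- Compatibility of the action with the connecting homomorphism of a short exact sequence of
modules with semilinear automorphisms. -/
theorem genAct_extClass_comp {g : GL (Fin N) ℂ} {S : ShortComplex (ModuleCat.{0} (Poly N))}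
    (hS : S.ShortExact) {ρ₁ : S.X₁ →+ S.X₁} {ρ₂ : S.X₂ →+ S.X₂} {ρ₃ : S.X₃ →+ S.X₃}
    (h₁ : ∀ (s : Poly N) (x : S.X₁), ρ₁ (s • x) = polyAct N g⁻¹ s • ρ₁ x)
    (h₂ : ∀ (s : Poly N) (x : S.X₂), ρ₂ (s • x) = polyAct N g⁻¹ s • ρ₂ x)
    (h₃ : ∀ (s : Poly N) (x : S.X₃), ρ₃ (s • x) = polyAct N g⁻¹ s • ρ₃ x)
    (hf : ∀ x, ρ₂ (S.f.hom x) = S.f.hom (ρ₁ x)) (hg : ∀ x, ρ₃ (S.g.hom x) = S.g.hom (ρ₂ x))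
    {j k : ℕ} (hjk : 1 + j = k) (x : Ext.{0} S.X₁ (freeModule N) j) :
    genAct g S.X₃ ρ₃ h₃ k (hS.extClass.comp x hjk) =
      hS.extClass.comp (genAct g S.X₁ ρ₁ h₁ j x) hjk := by
  let φ : S ⟶ S.map (twist g) :=
    { τ₁ := toTwist g S.X₁ ρ₁ h₁
      τ₂ := toTwist g S.X₂ ρ₂ h₂
      τ₃ := toTwist g S.X₃ ρ₃ h₃
      comm₁₂ := by ext x; exact (hf x).symm
      comm₂₃ := by ext x; exact (hg x).symm }
  obtain ⟨u, hu⟩ : ∃ u : Ext ((twist g).obj S.X₃) ((twist g).obj S.X₁) 1,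
      u = (hS.map_of_exact (twist g)).extClass := ⟨_, rfl⟩
  have hu' : hS.extClass.mapExactFunctor (twist g) = u :=
    (Ext.mapExactFunctor_extClass (twist g) hS).trans hu.symm
  have h : hS.extClass.comp (Ext.mk₀ (toTwist g S.X₁ ρ₁ h₁)) (add_zero 1) =
      (Ext.mk₀ (toTwist g S.X₃ ρ₃ h₃)).comp u (zero_add 1) := by
    rw [hu]
    exact ShortComplex.ShortExact.extClass_naturality hS (hS.map_of_exact (twist g)) φ
  unfold genAct
  rw [Ext.mapExactFunctor_comp, hu', ← Ext.comp_assoc (a₁₂ := 1) _ _ _ (zero_add 1) hjk (by omega),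
      ← h]
  simp only [Ext.comp_assoc_of_third_deg_zero]
  rw [Ext.comp_assoc (a₁₂ := 1) (a₂₃ := j) _ _ _ (add_zero 1) (zero_add j) (by omega)]

/-- The action on the class of a cocycle `f` on a projective resolution `P` on which `g⁻¹` acts
semilinearly by `σ`: it is the class of the cocycle `p ↦ g (f (g⁻¹ p))`. -/
theorem genAct_extMk {g : GL (Fin N) ℂ} {M : ModuleCat.{0} (Poly N)} {ρ : M →+ M}
    (hρ : ∀ (s : Poly N) (x : M), ρ (s • x) = polyAct N g⁻¹ s • ρ x) (P : ProjectiveResolution M)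
    (σ : ∀ n, P.complex.X n →+ P.complex.X n)
    (hσ : ∀ n (s : Poly N) (x : P.complex.X n), σ n (s • x) = polyAct N g⁻¹ s • σ n x)
    (hd : ∀ i j x, σ j ((P.complex.d i j).hom x) = (P.complex.d i j).hom (σ i x))
    (hε : ∀ x, ρ (P.augmentation.hom x) = P.augmentation.hom (σ 0 x))
    {j : ℕ} (f f' : P.complex.X j ⟶ freeModule N) (hf : P.complex.d (j + 1) j ≫ f = 0)
    (hf' : P.complex.d (j + 1) j ≫ f' = 0) (hff' : ∀ x, polyAct N g (f.hom (σ j x)) = f'.hom x) :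
    genAct g M ρ hρ j (P.extMk f (j + 1) rfl hf) = P.extMk f' (j + 1) rfl hf' := by
  unfold genAct
  rw [ProjectiveResolution.mk₀_comp_mapExactFunctor_extMk (R' := P)
      (fun n => toTwist g (P.complex.X n) (σ n) (hσ n))
      (fun i j => ModuleCat.hom_ext (LinearMap.ext fun x => (hd i j x).symm))
      (toTwist g M ρ hρ) (ModuleCat.hom_ext (LinearMap.ext fun x => (hε x).symm)),
    ProjectiveResolution.extMk_comp_mk₀]
  congr 1
  exact ModuleCat.hom_ext (LinearMap.ext hff')

/-- The identity map, as a natural transformation from the twist by `g * h` to the twist by `h`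
followed by the twist by `g`. -/
def twistMul (g h : GL (Fin N) ℂ) : twist (g * h) ⟶ twist h ⋙ twist g :=
  (ModuleCat.restrictScalarsComp' (polyAct N g⁻¹).toRingEquiv.toRingHom
    (polyAct N h⁻¹).toRingEquiv.toRingHom (polyAct N (g * h)⁻¹).toRingEquiv.toRingHom
    (RingHom.ext fun s => by
      change polyAct N (g * h)⁻¹ s = polyAct N h⁻¹ (polyAct N g⁻¹ s)
      rw [mul_inv_rev, polyAct_mul_apply])).hom

theorem genAct_mul (g h : GL (Fin N) ℂ) (M : ModuleCat.{0} (Poly N)) {ρg ρh ρgh : M →+ M}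
    (hg : ∀ (s : Poly N) (x : M), ρg (s • x) = polyAct N g⁻¹ s • ρg x)
    (hh : ∀ (s : Poly N) (x : M), ρh (s • x) = polyAct N h⁻¹ s • ρh x)
    (hgh : ∀ (s : Poly N) (x : M), ρgh (s • x) = polyAct N (g * h)⁻¹ s • ρgh x)
    (hmul : ∀ x, ρgh x = ρh (ρg x)) (j : ℕ) (x : Ext.{0} M (freeModule N) j) :
    genAct (g * h) M ρgh hgh j x = genAct g M ρg hg j (genAct h M ρh hh j x) := by
  have h1 : toTwist g M ρg hg ≫ (twist g).map (toTwist h M ρh hh) =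
      toTwist (g * h) M ρgh hgh ≫ (twistMul g h).app M := by
    exact ModuleCat.hom_ext (LinearMap.ext fun m => (hmul m).symm)
  have h2 : (twistMul g h).app (freeModule N) ≫ (twist g).map (ofTwistFree h) ≫ ofTwistFree g =
      ofTwistFree (g * h) := by
    exact ModuleCat.hom_ext (LinearMap.ext fun m => (polyAct_mul_apply g h m).symm)
  have h3 := Ext.mapExactFunctor_comp_natTrans _ _ (twistMul g h) x
  unfold genAct
  rw [Ext.mapExactFunctor_comp, Ext.mapExactFunctor_comp, Ext.mapExactFunctor_mk₀,
    Ext.mapExactFunctor_mk₀, Ext.mapExactFunctor_mapExactFunctor]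
  rw [← h2, ← Ext.mk₀_comp_mk₀]
  have h4 : (x.mapExactFunctor (twist (g * h))).comp ((Ext.mk₀
      ((twistMul g h).app (freeModule N))).comp
      (Ext.mk₀ ((twist g).map (ofTwistFree h) ≫ ofTwistFree g)) (zero_add 0)) (add_zero j) =
      (Ext.mk₀ ((twistMul g h).app M)).comp ((x.mapExactFunctor (twist h ⋙ twist g)).comp
        (Ext.mk₀ ((twist g).map (ofTwistFree h) ≫ ofTwistFree g)) (add_zero j)) (zero_add j) := by
    rw [← Ext.comp_assoc_of_third_deg_zero, h3, Ext.comp_assoc_of_third_deg_zero]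
  rw [Ext.comp_assoc_of_third_deg_zero, h4, Ext.mk₀_comp_mk₀_assoc, ← h1,
    ← Ext.mk₀_comp_mk₀_assoc, ← Ext.mk₀_comp_mk₀]
  simp only [Ext.comp_assoc_of_third_deg_zero]

end PowerExt

end

/-! ### `Ext` of the quotients by the first variables, and of the residue field -/

noncomputable section

namespace PowerExt

open Abelian

variable {N : ℕ}

theorem mk₀_smul_id_comp {M : ModuleCat.{0} (Poly N)} (s : Poly N) {j : ℕ}
    (x : Ext.{0} M (freeModule N) j) :
    (Ext.mk₀ (s • 𝟙 M)).comp x (zero_add j) = s • x := by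
  rw [Ext.mk₀_smul, Ext.smul_comp, Ext.mk₀_id_comp]

theorem genAct_of_eq_smul {g : GL (Fin N) ℂ} {M : ModuleCat.{0} (Poly N)} {ρ ρ' : M →+ M}
    (hρ : ∀ (s : Poly N) (x : M), ρ (s • x) = polyAct N g⁻¹ s • ρ x)
    (hρ' : ∀ (s : Poly N) (x : M), ρ' (s • x) = polyAct N g⁻¹ s • ρ' x) (c : ℂ)
    (h : ∀ x, ρ' x = (MvPolynomial.C c : Poly N) • ρ x) {j : ℕ} (x : Ext.{0} M (freeModule N) j) :
    genAct g M ρ' hρ' j x = c • genAct g M ρ hρ j x := by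
  have := genAct_mk₀_comp hρ' hρ (𝟙 M) ((MvPolynomial.C c : Poly N) • 𝟙 M) (fun m => by
    refine (h m).trans ?_
    refine Eq.trans ?_ (hρ (MvPolynomial.C c) m).symm
    rw [← MvPolynomial.algebraMap_eq, AlgEquiv.commutes]) x
  rw [Ext.mk₀_id_comp, mk₀_smul_id_comp] at this
  rw [this, complex_smul_eq]

/-- The quotient of `S` by an ideal, as an `S`-module. -/
abbrev idealQuot (I : Ideal (Poly N)) : ModuleCat.{0} (Poly N) := ModuleCat.of (Poly N) (Poly N ⧸ I)

/-- The action of `g` on the quotient of `S` by an ideal preserved by `g`. -/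
def idealQuotAct (I : Ideal (Poly N)) (g : GL (Fin N) ℂ)
    (h : I ≤ I.comap (polyAct N g : Poly N →+* Poly N)) : idealQuot I →+ idealQuot I :=
  (Ideal.quotientMap I (polyAct N g : Poly N →+* Poly N) h).toAddMonoidHom

theorem idealQuotAct_smul (I : Ideal (Poly N)) (g : GL (Fin N) ℂ)
    (h : I ≤ I.comap (polyAct N g : Poly N →+* Poly N)) (s : Poly N) (x : idealQuot I) :
    idealQuotAct I g h (s • x) = polyAct N g s • idealQuotAct I g h x := by
  obtain ⟨p, rfl⟩ := Ideal.Quotient.mk_surjective x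
  change idealQuotAct I g h (Ideal.Quotient.mk _ (s * p)) =
    Ideal.Quotient.mk _ (polyAct N g s * polyAct N g p)
  rw [← map_mul]
  rfl

/-- The ideal generated by the first `k` variables. -/
def firstVars (N k : ℕ) : Ideal (Poly N) :=
  Ideal.span (MvPolynomial.X '' {i : Fin N | (i : ℕ) < k})

theorem firstVars_succ {k : ℕ} (hk : k < N) :
    firstVars N (k + 1) = firstVars N k ⊔ Ideal.span {(MvPolynomial.X ⟨k, hk⟩ : Poly N)} := by
  rw [firstVars, firstVars, ← Ideal.span_union]
  congr 1
  have : {i : Fin N | (i : ℕ) < k + 1} = {i : Fin N | (i : ℕ) < k} ∪ {⟨k, hk⟩} := by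
    ext i
    simp only [Set.mem_ofPred_eq, Set.mem_union, Set.mem_singleton_iff, Fin.ext_iff]
    omega
  rw [this, Set.image_union, Set.image_singleton]

theorem mem_firstVars_of_X_mul_mem {k : ℕ} (hk : k < N) (p : Poly N)
    (h : MvPolynomial.X ⟨k, hk⟩ * p ∈ firstVars N k) : p ∈ firstVars N k := by
  rw [firstVars, MvPolynomial.mem_ideal_span_X_image] at h ⊢
  intro m hm
  obtain ⟨i, hi, hmi⟩ := h (Finsupp.single ⟨k, hk⟩ 1 + m) (by
    rw [MvPolynomial.mem_support_iff, MvPolynomial.coeff_X_mul]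
    exact MvPolynomial.mem_support_iff.mp hm)
  refine ⟨i, hi, ?_⟩
  have : (⟨k, hk⟩ : Fin N) ≠ i := by
    rintro rfl
    exact lt_irrefl _ (Set.mem_ofPred_eq ▸ hi)
  rwa [Finsupp.add_apply, Finsupp.single_eq_of_ne this.symm, zero_add] at hmi

/-- The short exact sequence `0 → S/I → S/I → S/J → 0` given by the multiplication by a variable
that is a nonzerodivisor modulo `I = (X_1, …, X_k)`, where `J = (X_1, …, X_{k+1})`. -/
def firstVarsSeq {k : ℕ} (hk : k < N) : ShortComplex (ModuleCat.{0} (Poly N)) where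
  X₁ := idealQuot (firstVars N k)
  X₂ := idealQuot (firstVars N k)
  X₃ := idealQuot (firstVars N (k + 1))
  f := (MvPolynomial.X ⟨k, hk⟩ : Poly N) • 𝟙 _
  g := ModuleCat.ofHom (Submodule.factor (firstVars_succ hk ▸ le_sup_left))
  zero := by
    refine ModuleCat.hom_ext (LinearMap.ext fun x => ?_)
    obtain ⟨p, rfl⟩ := Ideal.Quotient.mk_surjective x
    refine Ideal.Quotient.eq_zero_iff_mem.mpr (?_ : MvPolynomial.X ⟨k, hk⟩ * p ∈ _)
    refine Ideal.mul_mem_right _ _ (Ideal.subset_span ⟨⟨k, hk⟩, ?_, rfl⟩)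
    simp

theorem firstVarsSeq_shortExact {k : ℕ} (hk : k < N) : (firstVarsSeq hk).ShortExact where
  exact := by
    rw [ShortComplex.moduleCat_exact_iff]
    intro x hx
    obtain ⟨p, rfl⟩ := Ideal.Quotient.mk_surjective x
    have hp : p ∈ firstVars N (k + 1) := Ideal.Quotient.eq_zero_iff_mem.mp hx
    rw [firstVars_succ hk, Submodule.mem_sup] at hp
    obtain ⟨a, ha, b, hb, rfl⟩ := hp
    obtain ⟨c, rfl⟩ := Ideal.mem_span_singleton.mp hb
    refine ⟨Ideal.Quotient.mk _ c, ?_⟩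
    refine Ideal.Quotient.eq.mpr (?_ : MvPolynomial.X ⟨k, hk⟩ * c - (a + _) ∈ _)
    rw [show ∀ u : Poly N, u - (a + u) = -a from fun u => by ring]
    exact neg_mem ha
  mono_f := by
    rw [ModuleCat.mono_iff_injective, ← LinearMap.ker_eq_bot, LinearMap.ker_eq_bot']
    intro x hx
    obtain ⟨p, rfl⟩ := Ideal.Quotient.mk_surjective x
    exact Ideal.Quotient.eq_zero_iff_mem.mpr
      (mem_firstVars_of_X_mul_mem hk p (Ideal.Quotient.eq_zero_iff_mem.mp hx))
  epi_g := by
    rw [ModuleCat.epi_iff_surjective]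
    intro x
    obtain ⟨p, rfl⟩ := Ideal.Quotient.mk_surjective x
    exact ⟨Ideal.Quotient.mk _ p, rfl⟩

/-- The diagonal matrix with diagonal entries `t`, as an element of `GL_N`. -/
def torus (t : Fin N → ℂˣ) : GL (Fin N) ℂ where
  val := Matrix.diagonal fun i => (t i : ℂ)
  inv := Matrix.diagonal fun i => ((t i)⁻¹ : ℂˣ)
  val_inv := by simp
  inv_val := by simp

theorem torus_inv (t : Fin N → ℂˣ) : (torus t)⁻¹ = torus t⁻¹ := Units.ext (by rfl)

theorem polyAct_torus_X (t : Fin N → ℂˣ) (i : Fin N) :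
    polyAct N (torus t) (MvPolynomial.X i) = MvPolynomial.C (t i : ℂ) * MvPolynomial.X i := by
  rw [polyAct_apply, linSubst_X, Finset.sum_eq_single i]
  · rw [← MvPolynomial.smul_eq_C_mul]
    simp [torus]
  · intro j _ hj
    simp [torus, Matrix.diagonal_apply_ne _ hj]
  · simp

theorem firstVars_le_comap (k : ℕ) (t : Fin N → ℂˣ) :
    firstVars N k ≤ (firstVars N k).comap (polyAct N (torus t) : Poly N →+* Poly N) := by
  rw [firstVars, Ideal.span_le]
  rintro _ ⟨i, hi, rfl⟩
  change polyAct N (torus t) (MvPolynomial.X i) ∈ Ideal.span _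
  rw [polyAct_torus_X]
  exact Ideal.mul_mem_left _ _ (Ideal.subset_span ⟨i, hi, rfl⟩)

/-- If `0 → A → A → B → 0` is the short exact sequence given by a scalar `p`, and the only nonzero
`Ext^j(A, S)` is cyclic with annihilator `I`, for `j = k`, where `p` is a nonzerodivisor modulo `I`,
then the only nonzero `Ext^j(B, S)` is cyclic with annihilator `I + (p)`, for `j = k + 1`. -/
theorem ext_of_smul_shortExact {A B : ModuleCat.{0} (Poly N)} (p : Poly N) (q : A ⟶ B)
    (w : (p • 𝟙 A) ≫ q = 0) (hS : (ShortComplex.mk (p • 𝟙 A) q w).ShortExact) (I : Ideal (Poly N))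
    (hI : ∀ s, p * s ∈ I → s ∈ I) {k : ℕ}
    (hvan : ∀ j ≠ k, ∀ x : Ext.{0} A (freeModule N) j, x = 0) (ω : Ext.{0} A (freeModule N) k)
    (hgen : ∀ x, ∃ s : Poly N, x = s • ω) (hann : ∀ s : Poly N, s • ω = 0 ↔ s ∈ I) :
    (∀ j ≠ k + 1, ∀ x : Ext.{0} B (freeModule N) j, x = 0) ∧
    (∀ x : Ext.{0} B (freeModule N) (k + 1),
      ∃ s : Poly N, x = s • hS.extClass.comp ω (add_comm 1 k)) ∧
    (∀ s : Poly N, s • hS.extClass.comp ω (add_comm 1 k) = 0 ↔ s ∈ I ⊔ Ideal.span {p}) := by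
  have hgk : ∀ x : Ext.{0} B (freeModule N) k, (Ext.mk₀ q).comp x (zero_add k) = 0 := by
    intro x
    obtain ⟨s, hs⟩ := hgen ((Ext.mk₀ q).comp x (zero_add k))
    have h0 : (Ext.mk₀ (p • 𝟙 A)).comp ((Ext.mk₀ q).comp x (zero_add k)) (zero_add k) = 0 := by
      rw [Ext.mk₀_comp_mk₀_assoc, w, Ext.mk₀_zero, Ext.zero_comp]
    rw [hs, mk₀_smul_id_comp, smul_smul, hann] at h0
    rw [hs, hann]
    exact hI s h0
  have hg : ∀ (j : ℕ) (x : Ext.{0} B (freeModule N) j), (Ext.mk₀ q).comp x (zero_add j) = 0 := by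
    intro j x
    by_cases hj : j = k
    · subst hj
      exact hgk x
    · exact hvan j hj _
  have hδ : ∀ (j : ℕ) (x : Ext.{0} B (freeModule N) (j + 1)),
      ∃ y : Ext.{0} A (freeModule N) j, hS.extClass.comp y (add_comm 1 j) = x :=
    fun j x => Ext.contravariant_sequence_exact₃ hS _ x (hg _ x) (add_comm 1 j)
  refine ⟨?_, ?_, ?_⟩
  · intro j hj x
    cases j with
    | zero =>
      have : Epi q := hS.epi_g
      exact Ext.precomp_mk₀_injective_of_epi (freeModule N) q ((hg 0 x).trans (map_zero _).symm)
    | succ j =>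
      obtain ⟨y, rfl⟩ := hδ j x
      rw [hvan j (by omega) y, Ext.comp_zero]
  · intro x
    obtain ⟨y, rfl⟩ := hδ k x
    obtain ⟨s, rfl⟩ := hgen y
    exact ⟨s, Ext.comp_smul _ _ _ _⟩
  · intro s
    rw [← Ext.comp_smul, Submodule.mem_sup]
    constructor
    · intro h
      obtain ⟨y, hy⟩ := Ext.contravariant_sequence_exact₁ hS _ (s • ω) (add_comm 1 k) h
      obtain ⟨s', rfl⟩ := hgen y
      rw [mk₀_smul_id_comp, smul_smul, ← sub_eq_zero, ← sub_smul, hann] at hy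
      exact ⟨_, neg_mem hy, _, Ideal.mem_span_singleton.mpr ⟨s', rfl⟩, by ring⟩
    · rintro ⟨a, ha, b, hb, rfl⟩
      obtain ⟨c, rfl⟩ := Ideal.mem_span_singleton.mp hb
      rw [add_smul, (hann a).mpr ha, zero_add, mul_smul, ← mk₀_smul_id_comp]
      exact hS.extClass_comp_assoc _

/-- The quotient of `S` by the first `k` variables has a single nonzero `Ext^j(-, S)`, for `j = k`;
it is generated by a class with annihilator the ideal of the first `k` variables, on which the
diagonal torus acts by the inverse of the product of the first `k` characters. -/
theorem ext_firstVars {k : ℕ} (hk : k ≤ N) :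
    (∀ j ≠ k, ∀ x : Ext.{0} (idealQuot (firstVars N k)) (freeModule N) j, x = 0) ∧
    ∃ ω : Ext.{0} (idealQuot (firstVars N k)) (freeModule N) k,
      (∀ x, ∃ s : Poly N, x = s • ω) ∧ (∀ s : Poly N, s • ω = 0 ↔ s ∈ firstVars N k) ∧
      ∀ (t : Fin N → ℂˣ) (h : firstVars N k ≤ (firstVars N k).comap
          (polyAct N (torus t)⁻¹ : Poly N →+* Poly N)),
        genAct (torus t) (idealQuot (firstVars N k)) (idealQuotAct (firstVars N k) (torus t)⁻¹ h)
          (idealQuotAct_smul _ _ _) k ω =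
        (∏ i ∈ Finset.univ.filter (fun i : Fin N => (i : ℕ) < k), ((t i : ℂ))⁻¹) • ω := by
  induction k with
  | zero =>
    have h0 : firstVars N 0 = ⊥ := by simp [firstVars]
    have h0' : ∀ s, s ∈ firstVars N 0 ↔ s = 0 := fun s => by rw [h0, Ideal.mem_bot]
    let u : idealQuot (firstVars N 0) ≅ freeModule N :=
      LinearEquiv.toModuleIso (Submodule.quotEquivOfEqBot _ h0)
    have hu : ∀ p : Poly N, u.hom.hom (Ideal.Quotient.mk _ p) = p := fun p => rfl
    have : Projective (idealQuot (firstVars N 0)) := Projective.of_iso u.symm inferInstance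
    refine ⟨?_, Ext.mk₀ u.hom, ?_, ?_, ?_⟩
    · intro j hj x
      obtain ⟨j, rfl⟩ := Nat.exists_eq_succ_of_ne_zero hj
      exact Ext.eq_zero_of_projective x
    · intro x
      obtain ⟨f, rfl⟩ := (Ext.mk₀_bijective _ _).2 x
      refine ⟨f.hom (Ideal.Quotient.mk _ 1), ?_⟩
      rw [← Ext.mk₀_smul]
      congr 1
      refine ModuleCat.hom_ext (LinearMap.ext fun m => ?_)
      obtain ⟨p, rfl⟩ := Ideal.Quotient.mk_surjective m
      have := f.hom.map_smul p (Ideal.Quotient.mk _ 1)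
      rw [show p • Ideal.Quotient.mk (firstVars N 0) 1 = Ideal.Quotient.mk _ p from
        congrArg (Ideal.Quotient.mk _) (mul_one p)] at this
      exact this.trans (mul_comm _ _)
    · intro s
      rw [← Ext.mk₀_smul, Ext.mk₀_eq_zero_iff, h0']
      constructor
      · intro h
        have := congrArg (fun f => f.hom (Ideal.Quotient.mk _ 1)) h
        exact (mul_one s).symm.trans this
      · rintro rfl
        exact zero_smul _ _
    · intro t h
      rw [show Finset.univ.filter (fun i : Fin N => (i : ℕ) < 0) = ∅ by simp, Finset.prod_empty,
        one_smul]
      refine genAct_mk₀ _ _ _ fun m => ?_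
      obtain ⟨p, rfl⟩ := Ideal.Quotient.mk_surjective m
      change polyAct N (torus t) (polyAct N (torus t)⁻¹ p) = p
      rw [← polyAct_mul_apply, mul_inv_cancel, map_one]
      rfl
  | succ k ih =>
    obtain ⟨hvan, ω, hgen, hann, hact⟩ := ih (by omega)
    have hk' : k < N := hk
    have hS := firstVarsSeq_shortExact hk'
    obtain ⟨hvan', hgen', hann'⟩ := ext_of_smul_shortExact _ _ (firstVarsSeq hk').zero hS _
      (mem_firstVars_of_X_mul_mem hk') hvan ω hgen hann
    refine ⟨hvan', hS.extClass.comp ω (add_comm 1 k), hgen', ?_, ?_⟩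
    · exact fun s => (hann' s).trans (by rw [firstVars_succ hk'])
    · intro t h
      have h₂ : firstVars N k ≤ (firstVars N k).comap
          (polyAct N (torus t)⁻¹ : Poly N →+* Poly N) := by
        rw [torus_inv]
        exact firstVars_le_comap k _
      let ρ := idealQuotAct (firstVars N k) (torus t)⁻¹ h₂
      have hρ : ∀ (s : Poly N) x, ρ (s • x) = polyAct N (torus t)⁻¹ s • ρ x :=
        idealQuotAct_smul _ _ _
      let c : ℂ := (t ⟨k, hk'⟩ : ℂ)⁻¹
      let ρ₁ := (DistribSMul.toAddMonoidHom (idealQuot (firstVars N k))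
        (MvPolynomial.C c : Poly N)).comp ρ
      have hρ₁ : ∀ (s : Poly N) x, ρ₁ (s • x) = polyAct N (torus t)⁻¹ s • ρ₁ x := by
        intro s x
        change (MvPolynomial.C c : Poly N) • ρ (s • x) =
          polyAct N (torus t)⁻¹ s • ((MvPolynomial.C c : Poly N) • ρ x)
        rw [hρ, smul_comm]
      have hX : ∀ x, ρ ((MvPolynomial.X ⟨k, hk'⟩ : Poly N) • x) =
          (MvPolynomial.X ⟨k, hk'⟩ : Poly N) • ρ₁ x := by
        intro x
        change _ = (MvPolynomial.X ⟨k, hk'⟩ : Poly N) • ((MvPolynomial.C c : Poly N) • ρ x)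
        rw [hρ, torus_inv, polyAct_torus_X, smul_smul, mul_comm]
        simp [c]
      have hprod : ∏ i ∈ Finset.univ.filter (fun i : Fin N => (i : ℕ) < k + 1), ((t i : ℂ))⁻¹ =
          c * ∏ i ∈ Finset.univ.filter (fun i : Fin N => (i : ℕ) < k), ((t i : ℂ))⁻¹ := by
        rw [show Finset.univ.filter (fun i : Fin N => (i : ℕ) < k + 1) =
            insert ⟨k, hk'⟩ (Finset.univ.filter (fun i : Fin N => (i : ℕ) < k)) by
          ext i
          simp only [Finset.mem_filter, Finset.mem_univ, true_and, Finset.mem_insert, Fin.ext_iff]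
          omega]
        exact Finset.prod_insert (by simp)
      refine (genAct_extClass_comp hS hρ₁ hρ _ hX ?_ _ ω).trans ?_
      · intro x
        obtain ⟨p, rfl⟩ := Ideal.Quotient.mk_surjective x
        rfl
      · have h1 := genAct_of_eq_smul hρ hρ₁ c (fun _ => rfl) ω
        have h2 : genAct (torus t) (idealQuot (firstVars N k)) ρ hρ k ω = _ := hact t h₂
        refine (congrArg (fun y => hS.extClass.comp y (add_comm 1 k)) h1).trans ?_
        rw [h2, smul_smul, hprod]
        exact Ext.comp_smul _ _ _ _

end PowerExt

end

/-! ### The action of the general linear group on `Ext` of the residue field -/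

noncomputable section

namespace PowerExt

open Abelian

variable {N : ℕ}

theorem extAct_add {d j : ℕ} (g : GL (Fin N) ℂ) (x y : ExtPow N d j) :
    extAct N d j g (x + y) = extAct N d j g x + extAct N d j g y :=
  genAct_add _ x y

theorem extAct_smul {d j : ℕ} (g : GL (Fin N) ℂ) (c : ℂ) (x : ExtPow N d j) :
    extAct N d j g (c • x) = c • extAct N d j g x :=
  genAct_complex_smul _ c x

theorem quotAct_mul (d : ℕ) (g h : GL (Fin N) ℂ) (x : PowQuot N d) :
    quotAct d (g * h) x = quotAct d g (quotAct d h x) := by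
  obtain ⟨p, rfl⟩ := Ideal.Quotient.mk_surjective x
  exact congrArg (Ideal.Quotient.mk _) (polyAct_mul_apply g h p)

theorem extAct_mul {d j : ℕ} (g h : GL (Fin N) ℂ) (x : ExtPow N d j) :
    extAct N d j (g * h) x = extAct N d j g (extAct N d j h x) :=
  genAct_mul g h _ _ _ _ (fun x => by
    change quotAct d (g * h)⁻¹ x = quotAct d h⁻¹ (quotAct d g⁻¹ x)
    rw [mul_inv_rev, quotAct_mul]) j x

/-- A character of `GL_N(ℂ)` that restricts to the inverse of the determinant on the diagonal
matrices is the inverse of the determinant: each transvection is conjugate to its square, so that it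
has trivial image. -/
theorem character_eq_det_inv (χ : GL (Fin N) ℂ → ℂ) (hmul : ∀ g h, χ (g * h) = χ g * χ h)
    (htorus : ∀ t : Fin N → ℂˣ, χ (torus t) = ∏ i, (t i : ℂ)⁻¹) (g : GL (Fin N) ℂ) :
    χ g = (g.val.det)⁻¹ := by
  have h1 : χ 1 = 1 := by
    rw [show (1 : GL (Fin N) ℂ) = torus 1 from Units.ext (by simp [torus]), htorus]
    simp
  have hne : ∀ g, χ g ≠ 0 := fun g hg => one_ne_zero (by
    rw [← h1, ← mul_inv_cancel g, hmul, hg, zero_mul] : (1 : ℂ) = 0)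
  suffices ∀ h : GL (Fin N) ℂ, h.val = g.val → χ h = (h.val.det)⁻¹ from this g rfl
  refine Matrix.diagonal_transvection_induction_of_det_ne_zero
    (fun M => ∀ h : GL (Fin N) ℂ, h.val = M → χ h = (h.val.det)⁻¹) g.val
    (Matrix.GeneralLinearGroup.det g).ne_zero ?_ ?_ ?_
  · intro D hD h hh
    rw [Matrix.det_diagonal, Finset.prod_ne_zero_iff] at hD
    obtain rfl : h = torus fun i => Units.mk0 (D i) (hD i (Finset.mem_univ i)) :=
      Units.ext (by rw [hh]; rfl)
    rw [htorus, hh, Matrix.det_diagonal, Finset.prod_inv_distrib]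
    rfl
  · rintro ⟨i, j, hij, c⟩ u hu
    rw [Matrix.TransvectionStruct.toMatrix_mk] at hu
    have hconj : torus (fun k => if k = i then Units.mk0 2 two_ne_zero else 1) * u =
        u * u * torus (fun k => if k = i then Units.mk0 2 two_ne_zero else 1) := by
      refine Units.ext ?_
      rw [Units.val_mul, Units.val_mul, Units.val_mul, hu,
        Matrix.transvection_mul_transvection_same _ _ hij]
      ext a b
      simp only [torus, Matrix.diagonal_mul, Matrix.mul_diagonal, Matrix.transvection,
        Matrix.add_apply, Matrix.one_apply, Matrix.single_apply]
      by_cases hai : a = i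
      · subst hai
        by_cases hbj : j = b
        · subst hbj
          simp [hij, hij.symm]
          ring
        · by_cases hba : a = b
          · subst hba
            simp [hbj]
          · simp [hbj, hba]
      · by_cases hab : a = b
        · subst hab
          simp [hai, Ne.symm hai]
        · simp [hai, Ne.symm hai, hab]
    have := congrArg χ hconj
    rw [hmul, hmul, hmul, mul_comm, mul_left_inj' (hne _)] at this
    rw [hu, Matrix.det_transvection_of_ne _ _ hij, inv_one]
    exact mul_left_cancel₀ (hne u) (by rw [← this, mul_one])
  · intro A B hA hB hPA hPB h hh
    let a := Matrix.GeneralLinearGroup.mkOfDetNeZero A hA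
    let b := Matrix.GeneralLinearGroup.mkOfDetNeZero B hB
    obtain rfl : h = a * b := Units.ext hh
    rw [hmul, hPA a rfl, hPB b rfl, Units.val_mul, Matrix.det_mul, mul_inv]

theorem mem_maxIdeal_pow_iff {d : ℕ} {p : Poly N} :
    p ∈ maxIdeal N ^ d ↔ ∀ m, m.degree < d → p.coeff m = 0 :=
  MvPolynomial.mem_pow_idealOfVars_iff' d p

theorem C_mem_maxIdeal_iff {c : ℂ} : (MvPolynomial.C c : Poly N) ∈ maxIdeal N ^ 1 ↔ c = 0 :=
  (MvPolynomial.C_mem_pow_idealOfVars_iff 1 c).trans (by simp)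

theorem sub_C_mem_maxIdeal (p : Poly N) :
    p - MvPolynomial.C (MvPolynomial.constantCoeff p) ∈ maxIdeal N ^ 1 := by
  rw [mem_maxIdeal_pow_iff]
  intro m hm
  have : m = 0 := by
    rwa [Nat.lt_one_iff, Finsupp.degree_eq_zero_iff] at hm
  subst this
  simp [MvPolynomial.constantCoeff_eq]

theorem firstVars_self : firstVars N N = maxIdeal N ^ 1 := by
  rw [pow_one, firstVars, maxIdeal, ← Set.image_univ]
  congr 2
  ext i
  simp

theorem ext_residue_torus :
    (∀ j ≠ N, ∀ x : ExtPow N 1 j, x = 0) ∧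
    ∃ ω : ExtPow N 1 N, (∀ x, ∃ s : Poly N, x = s • ω) ∧
      (∀ s : Poly N, s • ω = 0 ↔ s ∈ maxIdeal N ^ 1) ∧
      ∀ t : Fin N → ℂˣ, extAct N 1 N (torus t) ω = (∏ i, (t i : ℂ)⁻¹) • ω := by
  have key : ∀ I : Ideal (Poly N), firstVars N N = I →
      (∀ j ≠ N, ∀ x : Ext.{0} (idealQuot I) (freeModule N) j, x = 0) ∧
      ∃ ω : Ext.{0} (idealQuot I) (freeModule N) N,
        (∀ x, ∃ s : Poly N, x = s • ω) ∧ (∀ s : Poly N, s • ω = 0 ↔ s ∈ I) ∧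
        ∀ (t : Fin N → ℂˣ) (h : I ≤ I.comap (polyAct N (torus t)⁻¹ : Poly N →+* Poly N)),
          genAct (torus t) (idealQuot I) (idealQuotAct I (torus t)⁻¹ h)
            (idealQuotAct_smul _ _ _) N ω = (∏ i, (t i : ℂ)⁻¹) • ω := by
    rintro _ rfl
    obtain ⟨h1, ω, h2, h3, h4⟩ := ext_firstVars (le_refl N)
    refine ⟨h1, ω, h2, h3, fun t h => (h4 t h).trans ?_⟩
    simp
  obtain ⟨h1, ω, h2, h3, h4⟩ := key _ firstVars_self
  exact ⟨h1, ω, h2, h3, fun t => h4 t (maxIdeal_pow_le_comap 1 (torus t)⁻¹)⟩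

theorem eq_zero_of_ext_residue {j : ℕ} (hj : j ≠ N) (x : ExtPow N 1 j) : x = 0 :=
  ext_residue_torus.1 j hj x

variable (N) in
/-- A generator of the one-dimensional space `Ext^N_S(S / 𝔪, S)`. -/
def residueGen : ExtPow N 1 N := ext_residue_torus.2.choose

theorem smul_residueGen_eq_zero_iff (s : Poly N) : s • residueGen N = 0 ↔ s ∈ maxIdeal N ^ 1 :=
  ext_residue_torus.2.choose_spec.2.1 s

theorem smul_residueGen (s : Poly N) :
    s • residueGen N = MvPolynomial.constantCoeff s • residueGen N := by
  rw [complex_smul_eq, ← sub_eq_zero, ← sub_smul, smul_residueGen_eq_zero_iff]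
  exact sub_C_mem_maxIdeal s

theorem exists_eq_smul_residueGen (x : ExtPow N 1 N) : ∃ c : ℂ, x = c • residueGen N := by
  obtain ⟨s, hs⟩ := ext_residue_torus.2.choose_spec.1 x
  exact ⟨_, hs.trans (smul_residueGen s)⟩

theorem residueGen_smul_injective {c c' : ℂ} (h : c • residueGen N = c' • residueGen N) :
    c = c' := by
  rw [← sub_eq_zero, ← sub_smul, complex_smul_eq, smul_residueGen_eq_zero_iff,
    C_mem_maxIdeal_iff, sub_eq_zero] at h
  exact h

variable (N) in
/-- The coordinate on the one-dimensional space `Ext^N_S(S / 𝔪, S)`. -/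
def residueCoord : ExtPow N 1 N ≃ₗ[ℂ] ℂ :=
  (LinearEquiv.ofBijective (LinearMap.toSpanSingleton ℂ _ (residueGen N))
    ⟨fun _ _ h => residueGen_smul_injective h, fun x =>
      (exists_eq_smul_residueGen x).imp fun _ h => h.symm⟩).symm

theorem residueCoord_smul_residueGen (x : ExtPow N 1 N) : residueCoord N x • residueGen N = x :=
  (residueCoord N).symm_apply_apply x

theorem residueCoord_eq {x : ExtPow N 1 N} {c : ℂ} (h : x = c • residueGen N) :
    residueCoord N x = c :=
  residueGen_smul_injective ((residueCoord_smul_residueGen x).trans h)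

/-- The group `GL_N(ℂ)` acts on `Ext^N_S(S / 𝔪, S)` by the inverse of the determinant. -/
theorem extAct_residueGen (g : GL (Fin N) ℂ) :
    extAct N 1 N g (residueGen N) = (g.val.det)⁻¹ • residueGen N := by
  rw [← character_eq_det_inv (fun g => residueCoord N (extAct N 1 N g (residueGen N))) ?_ ?_ g,
    residueCoord_smul_residueGen]
  · intro g h
    refine residueCoord_eq ?_
    rw [extAct_mul, ← residueCoord_smul_residueGen (extAct N 1 N h (residueGen N)), extAct_smul,
      ← residueCoord_smul_residueGen (extAct N 1 N g (residueGen N)), smul_smul,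
      residueCoord_smul_residueGen, residueCoord_smul_residueGen, mul_comm]
  · exact fun t => residueCoord_eq (ext_residue_torus.2.choose_spec.2.2 t)

theorem residueCoord_extAct (g : GL (Fin N) ℂ) (x : ExtPow N 1 N) :
    residueCoord N (extAct N 1 N g x) = (g.val.det)⁻¹ * residueCoord N x := by
  refine residueCoord_eq ?_
  rw [mul_comm, mul_smul, ← extAct_residueGen, ← extAct_smul, residueCoord_smul_residueGen]

end PowerExt

end

/-! ### The filtration by powers of the maximal ideal -/

noncomputable section

namespace PowerExt

open Abelian

variable {N : ℕ}

/-- The multiplication by an element of `𝔪^d`, as a linear map from `S / 𝔪` to `S / 𝔪^(d+1)`. -/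
def mulMap {d : ℕ} (p : Poly N) (hp : p ∈ maxIdeal N ^ d) :
    PowQuot N 1 →ₗ[Poly N] PowQuot N (d + 1) :=
  Submodule.mapQ _ _ (LinearMap.toSpanSingleton (Poly N) (Poly N) p) fun s hs => by
    rw [Submodule.mem_comap, add_comm, pow_add]
    exact Ideal.mul_mem_mul hs hp

/-- The exponents of the monomials of degree `d`. -/
abbrev Exponents (N d : ℕ) : Type := (Finset.univ : Finset (Fin N)).piAntidiag d

theorem Exponents.sum_eq {d : ℕ} (k : Exponents N d) : ∑ i, k.1 i = d :=
  (Finset.mem_piAntidiag.mp k.2).1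

/-- The exponent of a monomial, as a finitely supported function. -/
def Exponents.toFinsupp {d : ℕ} (k : Exponents N d) : Fin N →₀ ℕ := Finsupp.equivFunOnFinite.symm k

theorem Exponents.degree_toFinsupp {d : ℕ} (k : Exponents N d) : k.toFinsupp.degree = d := by
  rw [Finsupp.degree_eq_sum]
  exact k.sum_eq

theorem Exponents.toFinsupp_injective {d : ℕ} :
    Function.Injective (Exponents.toFinsupp : Exponents N d → _) :=
  fun _ _ h => Subtype.ext (Finsupp.equivFunOnFinite.symm.injective h)

theorem Exponents.exists_toFinsupp_eq {d : ℕ} (m : Fin N →₀ ℕ) (hm : m.degree = d) :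
    ∃ k : Exponents N d, k.toFinsupp = m :=
  ⟨⟨m, Finset.mem_piAntidiag.mpr ⟨by rw [← hm, Finsupp.degree_eq_sum], by simp⟩⟩,
    Finsupp.ext fun _ => rfl⟩

/-- The monomial with a given exponent. -/
def Exponents.monomial {d : ℕ} (k : Exponents N d) : Poly N := MvPolynomial.monomial k.toFinsupp 1

theorem Exponents.monomial_mem {d : ℕ} (k : Exponents N d) : k.monomial ∈ maxIdeal N ^ d := by
  rw [mem_maxIdeal_pow_iff]
  intro m hm
  refine (MvPolynomial.coeff_monomial _ _ _).trans (if_neg ?_)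
  rintro rfl
  exact hm.ne k.degree_toFinsupp

theorem Exponents.coeff_sum_mul_monomial {d : ℕ} (s : Exponents N d → Poly N)
    (k : Exponents N d) : (∑ l, s l * l.monomial).coeff k.toFinsupp =
      MvPolynomial.constantCoeff (s k) := by
  rw [MvPolynomial.coeff_sum, Finset.sum_eq_single k]
  · rw [monomial, MvPolynomial.coeff_mul_monomial', if_pos le_rfl, tsub_self, mul_one,
      MvPolynomial.constantCoeff_eq]
  · intro l _ hl
    rw [monomial, MvPolynomial.coeff_mul_monomial', if_neg]
    intro h
    obtain ⟨c, hc⟩ := exists_add_of_le h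
    have := congrArg Finsupp.degree hc
    rw [map_add, k.degree_toFinsupp, l.degree_toFinsupp, left_eq_add,
      Finsupp.degree_eq_zero_iff] at this
    rw [this, add_zero] at hc
    exact hl (toFinsupp_injective hc.symm)
  · simp

variable (N) in
/-- The map `(S / 𝔪)^r → S / 𝔪^(d+1)` given by the `r` monomials of degree `d`. -/
def monomialsMap (d : ℕ) : (Exponents N d → PowQuot N 1) →ₗ[Poly N] PowQuot N (d + 1) :=
  ∑ k, mulMap k.monomial k.monomial_mem ∘ₗ LinearMap.proj k

theorem monomialsMap_mk {d : ℕ} (s : Exponents N d → Poly N) :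
    monomialsMap N d (fun k => Ideal.Quotient.mk _ (s k)) =
      Ideal.Quotient.mk _ (∑ l, s l * l.monomial) := by
  rw [monomialsMap, LinearMap.sum_apply, map_sum]
  rfl

theorem monomialsMap_single {d : ℕ} (k : Exponents N d) (x : PowQuot N 1) :
    monomialsMap N d (Pi.single k x) = mulMap k.monomial k.monomial_mem x := by
  rw [monomialsMap, LinearMap.sum_apply, Finset.sum_eq_single k]
  · simp
  · intro l _ hl
    simp [Pi.single_eq_of_ne hl]
  · simp

variable (N) in
/-- The projection `S / 𝔪^(d+1) → S / 𝔪^d`. -/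
def powFactor (d : ℕ) : PowQuot N (d + 1) →ₗ[Poly N] PowQuot N d :=
  Submodule.factor (Ideal.pow_le_pow_right (Nat.le_succ d))

variable (N) in
theorem powFactor_comp_monomialsMap (d : ℕ) : powFactor N d ∘ₗ monomialsMap N d = 0 := by
  refine LinearMap.ext fun c => ?_
  choose s hs using fun k => Ideal.Quotient.mk_surjective (c k)
  obtain rfl : (fun k => Ideal.Quotient.mk _ (s k)) = c := funext hs
  rw [LinearMap.comp_apply, monomialsMap_mk]
  exact Ideal.Quotient.eq_zero_iff_mem.mpr (Ideal.sum_mem _ fun k _ =>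
    Ideal.mul_mem_left _ _ k.monomial_mem)

variable (N) in
/-- The short exact sequence `0 → (S / 𝔪)^r → S / 𝔪^(d+1) → S / 𝔪^d → 0`, where `r` is the number of
monomials of degree `d`. -/
abbrev powSeq (d : ℕ) : ShortComplex (ModuleCat.{0} (Poly N)) :=
  ShortComplex.mk (X₁ := ModuleCat.of (Poly N) (Exponents N d → PowQuot N 1))
    (X₂ := quotModule N (d + 1)) (X₃ := quotModule N d)
    (ModuleCat.ofHom (monomialsMap N d)) (ModuleCat.ofHom (powFactor N d))
    (ModuleCat.hom_ext (powFactor_comp_monomialsMap N d))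

variable (N) in
theorem powSeq_shortExact (d : ℕ) : (powSeq N d).ShortExact where
  exact := by
    rw [ShortComplex.moduleCat_exact_iff]
    intro x hx
    obtain ⟨p, rfl⟩ := Ideal.Quotient.mk_surjective x
    have hp : p ∈ maxIdeal N ^ d := Ideal.Quotient.eq_zero_iff_mem.mp hx
    refine ⟨fun k => Ideal.Quotient.mk _ (MvPolynomial.C (p.coeff k.toFinsupp)), ?_⟩
    refine (monomialsMap_mk _).trans (Ideal.Quotient.eq.mpr ?_)
    rw [mem_maxIdeal_pow_iff] at hp ⊢
    intro m hm
    rw [MvPolynomial.coeff_sub, sub_eq_zero]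
    rcases Nat.lt_succ_iff_lt_or_eq.mp hm with h | h
    · rw [hp m h]
      refine mem_maxIdeal_pow_iff.mp (Ideal.sum_mem _ fun k _ => ?_) m h
      exact Ideal.mul_mem_left _ _ k.monomial_mem
    · obtain ⟨k, rfl⟩ := Exponents.exists_toFinsupp_eq m h
      rw [Exponents.coeff_sum_mul_monomial]
      simp
  mono_f := by
    rw [ModuleCat.mono_iff_injective, ← LinearMap.ker_eq_bot, LinearMap.ker_eq_bot']
    intro c hc
    choose s hs using fun k => Ideal.Quotient.mk_surjective (c k)
    obtain rfl : (fun k => Ideal.Quotient.mk _ (s k)) = c := funext hs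
    have h0 := (monomialsMap_mk s).symm.trans hc
    rw [Ideal.Quotient.eq_zero_iff_mem, mem_maxIdeal_pow_iff] at h0
    funext k
    refine Ideal.Quotient.eq_zero_iff_mem.mpr ?_
    have := h0 k.toFinsupp (by rw [k.degree_toFinsupp]; exact Nat.lt_succ_self d)
    rw [Exponents.coeff_sum_mul_monomial] at this
    have h1 := sub_C_mem_maxIdeal (s k)
    rwa [this, map_zero, sub_zero] at h1
  epi_g := by
    rw [ModuleCat.epi_iff_surjective]
    intro x
    obtain ⟨p, rfl⟩ := Ideal.Quotient.mk_surjective x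
    exact ⟨Ideal.Quotient.mk _ p, rfl⟩

section

variable {κ : Type} [Fintype κ] [DecidableEq κ]

/-- A class in the `Ext` of a finite power of `S / 𝔪` is determined by its restrictions to the
factors. -/
theorem ext_pi_ext {j : ℕ}
    {x y : Ext.{0} (ModuleCat.of (Poly N) (κ → PowQuot N 1)) (freeModule N) j}
    (h : ∀ k, (Ext.mk₀ (ModuleCat.ofHom (LinearMap.single (Poly N) (fun _ : κ => PowQuot N 1) k) :
        quotModule N 1 ⟶ _)).comp x (zero_add j) =
      (Ext.mk₀ (ModuleCat.ofHom (LinearMap.single (Poly N) (fun _ : κ => PowQuot N 1) k) :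
        quotModule N 1 ⟶ _)).comp y (zero_add j)) : x = y := by
  have hid : 𝟙 (ModuleCat.of (Poly N) (κ → PowQuot N 1)) =
      ∑ k, (ModuleCat.ofHom (LinearMap.proj k) : _ ⟶ quotModule N 1) ≫
        ModuleCat.ofHom (LinearMap.single (Poly N) (fun _ : κ => PowQuot N 1) k) := by
    refine ModuleCat.hom_ext (LinearMap.ext fun c => ?_)
    rw [ModuleCat.hom_sum, LinearMap.sum_apply]
    exact (Finset.univ_sum_single c).symm
  rw [← Ext.mk₀_id_comp x, ← Ext.mk₀_id_comp y, hid, Ext.mk₀_sum, Ext.sum_comp, Ext.sum_comp]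
  refine Finset.sum_congr rfl fun k _ => ?_
  rw [← Ext.mk₀_comp_mk₀_assoc, h, Ext.mk₀_comp_mk₀_assoc]

/-- Classes in `Ext(S / 𝔪, S)` are the restrictions of a class in the `Ext` of a finite power. -/
theorem exists_ext_pi {j : ℕ} (c : κ → ExtPow N 1 j) :
    ∃ x : Ext.{0} (ModuleCat.of (Poly N) (κ → PowQuot N 1)) (freeModule N) j, ∀ k,
      (Ext.mk₀ (ModuleCat.ofHom (LinearMap.single (Poly N) (fun _ : κ => PowQuot N 1) k) :
        quotModule N 1 ⟶ _)).comp x (zero_add j) = c k := by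
  refine ⟨∑ k, (Ext.mk₀ (ModuleCat.ofHom (LinearMap.proj k) : _ ⟶ quotModule N 1)).comp (c k)
    (zero_add j), fun k => ?_⟩
  rw [Ext.comp_sum, Finset.sum_eq_single k]
  · rw [Ext.mk₀_comp_mk₀_assoc]
    rw [show (ModuleCat.ofHom (LinearMap.single (Poly N) (fun _ : κ => PowQuot N 1) k) :
        quotModule N 1 ⟶ _) ≫ ModuleCat.ofHom (LinearMap.proj k) = 𝟙 (quotModule N 1) from
      ModuleCat.hom_ext (LinearMap.ext fun x => Pi.single_eq_same (M := fun _ : κ => PowQuot N 1)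
        k x)]
    exact Ext.mk₀_id_comp _
  · intro l _ hl
    rw [Ext.mk₀_comp_mk₀_assoc]
    rw [show (ModuleCat.ofHom (LinearMap.single (Poly N) (fun _ : κ => PowQuot N 1) k) :
        quotModule N 1 ⟶ _) ≫ (ModuleCat.ofHom (LinearMap.proj l) : _ ⟶ quotModule N 1) = 0 from
      ModuleCat.hom_ext (LinearMap.ext fun x => Pi.single_eq_of_ne (M := fun _ : κ => PowQuot N 1)
        hl x)]
    rw [Ext.mk₀_zero, Ext.zero_comp]
  · simp

end

theorem eq_zero_of_ext_pi {κ : Type} [Fintype κ] [DecidableEq κ] {j : ℕ} (hj : j ≠ N)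
    (x : Ext.{0} (ModuleCat.of (Poly N) (κ → PowQuot N 1)) (freeModule N) j) : x = 0 :=
  ext_pi_ext fun _ => (eq_zero_of_ext_residue hj _).trans (eq_zero_of_ext_residue hj _).symm

theorem eq_zero_of_extPow_zero {j : ℕ} (x : ExtPow N 0 j) : x = 0 := by
  have : Subsingleton (PowQuot N 0) := by
    rw [PowQuot, pow_zero, Ideal.one_eq_top]
    infer_instance
  have h : 𝟙 (quotModule N 0) = 0 :=
    ModuleCat.hom_ext (LinearMap.ext fun x => Subsingleton.elim _ _)
  rw [← Ext.mk₀_id_comp x, h, Ext.mk₀_zero, Ext.zero_comp]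

theorem eq_zero_of_extPow {d j : ℕ} (hj : j ≠ N) (x : ExtPow N d j) : x = 0 := by
  induction d with
  | zero => exact eq_zero_of_extPow_zero x
  | succ d ih =>
    obtain ⟨y, rfl⟩ := Ext.contravariant_sequence_exact₂ (powSeq_shortExact N d) _ x
      (eq_zero_of_ext_pi hj _)
    rw [ih y, Ext.comp_zero]

variable (N) in
/-- The map `Ext^N(S / 𝔪^d, S) → Ext^N(S / 𝔪^(d+1), S)` induced by the projection. -/
def extFactor (d : ℕ) : ExtPow N d N →ₗ[ℂ] ExtPow N (d + 1) N where
  toFun x := (Ext.mk₀ (ModuleCat.ofHom (powFactor N d))).comp x (zero_add N)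
  map_add' _ _ := Ext.comp_add _ _ _ _
  map_smul' _ _ := Ext.comp_smul _ _ _ _

variable (N) in
theorem extFactor_injective (d : ℕ) : Function.Injective (extFactor N d) := by
  rw [← LinearMap.ker_eq_bot, LinearMap.ker_eq_bot']
  intro x hx
  by_cases hN : N = 0
  · have key : ∀ (j : ℕ), j = 0 → ∀ x : ExtPow N d j,
        (Ext.mk₀ (ModuleCat.ofHom (powFactor N d))).comp x (zero_add j) = 0 → x = 0 := by
      rintro _ rfl x hx
      have : Epi (ModuleCat.ofHom (powFactor N d)) := (powSeq_shortExact N d).epi_g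
      exact Ext.precomp_mk₀_injective_of_epi (freeModule N) (ModuleCat.ofHom (powFactor N d))
        (hx.trans (map_zero _).symm)
    exact key N hN x hx
  · obtain ⟨y, rfl⟩ := Ext.contravariant_sequence_exact₃ (powSeq_shortExact N d) _ x hx
      (Nat.add_sub_cancel' (Nat.one_le_iff_ne_zero.mpr hN))
    rw [eq_zero_of_ext_pi (by omega) y, Ext.comp_zero]

variable (N) in
/-- The restriction of a class to the image of `S / 𝔪` under the multiplication by `p`. -/
def extCoeff {d : ℕ} (p : Poly N) (hp : p ∈ maxIdeal N ^ d) : ExtPow N (d + 1) N →ₗ[ℂ] ℂ :=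
  (residueCoord N).toLinearMap ∘ₗ
  { toFun x := (Ext.mk₀ (ModuleCat.ofHom (mulMap p hp))).comp x (zero_add N)
    map_add' _ _ := Ext.comp_add _ _ _ _
    map_smul' _ _ := Ext.comp_smul _ _ _ _ }

theorem ofHom_mulMap_monomial {d : ℕ} (k : Exponents N d) :
    ModuleCat.ofHom (mulMap k.monomial k.monomial_mem) =
      ModuleCat.ofHom (LinearMap.single (Poly N) (fun _ => PowQuot N 1) k) ≫
        ModuleCat.ofHom (monomialsMap N d) :=
  ModuleCat.hom_ext (LinearMap.ext fun x => (monomialsMap_single k x).symm)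

theorem extCoeff_monomial {d : ℕ} (k : Exponents N d) (x : ExtPow N (d + 1) N) :
    extCoeff N k.monomial k.monomial_mem x =
      residueCoord N ((Ext.mk₀ (ModuleCat.ofHom (LinearMap.single (Poly N) (fun _ => PowQuot N 1)
        k) ≫
        ModuleCat.ofHom (monomialsMap N d))).comp x (zero_add N)) := by
  rw [← ofHom_mulMap_monomial]
  rfl

theorem exists_extFactor_eq {d : ℕ} (x : ExtPow N (d + 1) N)
    (hx : ∀ k : Exponents N d, extCoeff N k.monomial k.monomial_mem x = 0) :
    ∃ y, extFactor N d y = x := by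
  refine Ext.contravariant_sequence_exact₂ (powSeq_shortExact N d) _ x (ext_pi_ext fun k => ?_)
  rw [Ext.comp_zero, Ext.mk₀_comp_mk₀_assoc]
  refine (residueCoord N).injective ((map_zero (residueCoord N)).symm ▸ ?_)
  exact (extCoeff_monomial k x).symm.trans (hx k)

theorem exists_extCoeff_eq {d : ℕ} (c : Exponents N d → ℂ) :
    ∃ x, ∀ k : Exponents N d, extCoeff N k.monomial k.monomial_mem x = c k := by
  obtain ⟨y, hy⟩ := exists_ext_pi fun k => (residueCoord N).symm (c k)
  obtain ⟨x, hx⟩ := Ext.contravariant_sequence_exact₁ (powSeq_shortExact N d) _ y (add_comm 1 N)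
    (eq_zero_of_extPow (by omega) _)
  refine ⟨x, fun k => ?_⟩
  rw [← (residueCoord N).apply_symm_apply (c k), ← hy, ← hx, Ext.mk₀_comp_mk₀_assoc]
  exact extCoeff_monomial k x

theorem extCoeff_extFactor {d : ℕ} (p : Poly N) (hp : p ∈ maxIdeal N ^ d) (x : ExtPow N d N) :
    extCoeff N p hp (extFactor N d x) = 0 := by
  change residueCoord N ((Ext.mk₀ (ModuleCat.ofHom (mulMap p hp))).comp
    ((Ext.mk₀ (ModuleCat.ofHom (powFactor N d))).comp x (zero_add N)) (zero_add N)) = 0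
  rw [Ext.mk₀_comp_mk₀_assoc, show ModuleCat.ofHom (mulMap p hp) ≫
    ModuleCat.ofHom (powFactor N d) = 0 from ?_, Ext.mk₀_zero, Ext.zero_comp, map_zero]
  refine ModuleCat.hom_ext (LinearMap.ext fun m => ?_)
  obtain ⟨s, rfl⟩ := Ideal.Quotient.mk_surjective m
  exact Ideal.Quotient.eq_zero_iff_mem.mpr (Ideal.mul_mem_left _ _ hp)

theorem extAct_extFactor {d : ℕ} (g : GL (Fin N) ℂ) (x : ExtPow N d N) :
    extAct N (d + 1) N g (extFactor N d x) = extFactor N d (extAct N d N g x) := by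
  refine genAct_mk₀_comp _ _ _ _ (fun m => ?_) x
  obtain ⟨s, rfl⟩ := Ideal.Quotient.mk_surjective m
  rfl

theorem polyAct_mem_maxIdeal_pow {d : ℕ} (g : GL (Fin N) ℂ) {p : Poly N}
    (hp : p ∈ maxIdeal N ^ d) : polyAct N g p ∈ maxIdeal N ^ d :=
  maxIdeal_pow_le_comap d g hp

theorem extCoeff_extAct {d : ℕ} (g : GL (Fin N) ℂ) (p : Poly N) (hp : p ∈ maxIdeal N ^ d)
    (x : ExtPow N (d + 1) N) :
    extCoeff N p hp (extAct N (d + 1) N g x) =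
      (g.val.det)⁻¹ * extCoeff N (polyAct N g⁻¹ p) (polyAct_mem_maxIdeal_pow g⁻¹ hp) x := by
  refine Eq.trans ?_ (residueCoord_extAct g _)
  refine congrArg (residueCoord N) (genAct_mk₀_comp _ _ _ _ (fun m => ?_) x).symm
  obtain ⟨s, rfl⟩ := Ideal.Quotient.mk_surjective m
  exact congrArg (Ideal.Quotient.mk _) (map_mul (polyAct N g⁻¹) s p).symm

theorem extCoeff_sum {d : ℕ} {κ : Type*} [Fintype κ] (c : κ → ℂ) (p : κ → Poly N)
    (hp : ∀ i, p i ∈ maxIdeal N ^ d)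
    (q : Poly N) (hq : q ∈ maxIdeal N ^ d) (h : q = ∑ i, MvPolynomial.C (c i) * p i)
    (x : ExtPow N (d + 1) N) :
    extCoeff N q hq x = ∑ i, c i * extCoeff N (p i) (hp i) x := by
  have hsum : ModuleCat.ofHom (mulMap q hq) =
      ∑ i, (MvPolynomial.C (c i) : Poly N) • ModuleCat.ofHom (mulMap (p i) (hp i)) := by
    refine ModuleCat.hom_ext (LinearMap.ext fun m => ?_)
    obtain ⟨t, rfl⟩ := Ideal.Quotient.mk_surjective m
    rw [ModuleCat.hom_sum, LinearMap.sum_apply]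
    subst h
    change Ideal.Quotient.mk _ (t * _) = _
    rw [Finset.mul_sum, map_sum]
    refine Finset.sum_congr rfl fun i _ => ?_
    rw [mul_left_comm]
    rfl
  change residueCoord N ((Ext.mk₀ (ModuleCat.ofHom (mulMap q hq))).comp x (zero_add N)) = _
  rw [hsum, Ext.mk₀_sum, Ext.sum_comp, map_sum]
  refine Finset.sum_congr rfl fun i _ => ?_
  rw [Ext.mk₀_smul, Ext.smul_comp, ← complex_smul_eq, map_smul]
  rfl

end PowerExt

end

/-! ### The equivariant splitting of the filtration -/

noncomputable section

namespace PowerExt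

open Abelian

variable {N : ℕ}

/-- The linear form with coefficient vector `η`. -/
def linForm (η : Fin N → ℂ) : Poly N := ∑ i, MvPolynomial.C (η i) * MvPolynomial.X i

theorem linForm_pow_mem (η : Fin N → ℂ) (d : ℕ) : linForm η ^ d ∈ maxIdeal N ^ d := by
  have : linForm η ∈ maxIdeal N :=
    Ideal.sum_mem _ fun i _ => Ideal.mul_mem_left _ _ (Ideal.subset_span ⟨i, rfl⟩)
  exact Ideal.pow_mem_pow this d

theorem polyAct_linForm (g : GL (Fin N) ℂ) (η : Fin N → ℂ) :
    polyAct N g (linForm η) = linForm (g.val.mulVec η) := by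
  simp only [linForm, map_sum, map_mul, polyAct_apply, linSubst_X, Matrix.mulVec, dotProduct,
    Finset.sum_mul, Finset.mul_sum, MvPolynomial.smul_eq_C_mul]
  rw [Finset.sum_comm]
  refine Finset.sum_congr rfl fun i _ => Finset.sum_congr rfl fun j _ => ?_
  rw [← MvPolynomial.algebraMap_eq, AlgHom.commutes]
  ring

variable (N) in
/-- The space of homogeneous polynomial functions of degree `d` on `ℂ^N`. -/
def polyFun (d : ℕ) : Submodule ℂ ((Fin N → ℂ) → ℂ) :=
  (MvPolynomial.homogeneousSubmodule (Fin N) ℂ d).map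
    (LinearMap.pi fun η => (MvPolynomial.aeval η : Poly N →ₐ[ℂ] ℂ).toLinearMap)

theorem mem_polyFun_iff {d : ℕ} {F : (Fin N → ℂ) → ℂ} :
    F ∈ polyFun N d ↔
      ∃ P : Poly N, P.IsHomogeneous d ∧ ∀ η, F η = MvPolynomial.eval η P := by
  constructor
  · rintro ⟨P, hP, rfl⟩
    exact ⟨P, hP, fun η => by simp [MvPolynomial.aeval_eq_eval]⟩
  · rintro ⟨P, hP, h⟩
    exact ⟨P, hP, funext fun η => by simp [h, MvPolynomial.aeval_eq_eval]⟩

/-- The homogeneous polynomial with given coefficients. -/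
def Exponents.poly {d : ℕ} (c : Exponents N d → ℂ) : Poly N :=
  ∑ k, MvPolynomial.C (c k) * k.monomial

theorem Exponents.coeff_poly {d : ℕ} (c : Exponents N d → ℂ) (k : Exponents N d) :
    (Exponents.poly c).coeff k.toFinsupp = c k := by
  rw [poly, coeff_sum_mul_monomial, MvPolynomial.constantCoeff_C]

theorem Exponents.isHomogeneous_poly {d : ℕ} (c : Exponents N d → ℂ) :
    (Exponents.poly c).IsHomogeneous d :=
  MvPolynomial.IsHomogeneous.sum _ _ _ fun k _ => by
    rw [monomial, MvPolynomial.C_mul_monomial]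
    exact MvPolynomial.isHomogeneous_monomial _ k.degree_toFinsupp

theorem Exponents.poly_coeff {d : ℕ} {P : Poly N} (hP : P.IsHomogeneous d) :
    Exponents.poly (fun k : Exponents N d => P.coeff k.toFinsupp) = P := by
  ext m
  by_cases hm : m.degree = d
  · obtain ⟨k, rfl⟩ := exists_toFinsupp_eq m hm
    rw [coeff_poly]
  · rw [(isHomogeneous_poly _).coeff_eq_zero hm, hP.coeff_eq_zero hm]

theorem Exponents.eval_poly {d : ℕ} (c : Exponents N d → ℂ) (η : Fin N → ℂ) :
    MvPolynomial.eval η (Exponents.poly c) = ∑ k, c k * ∏ i, η i ^ k.1 i := by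
  rw [poly, map_sum]
  refine Finset.sum_congr rfl fun k _ => ?_
  rw [map_mul, MvPolynomial.eval_C, monomial, MvPolynomial.eval_monomial, one_mul,
    Finsupp.prod_fintype _ _ fun i => pow_zero _]
  rfl

theorem polyFun_smul {d : ℕ} {F : (Fin N → ℂ) → ℂ} (hF : F ∈ polyFun N d) (c : ℂ)
    (η : Fin N → ℂ) : F (c • η) = c ^ d * F η := by
  obtain ⟨P, hP, h⟩ := mem_polyFun_iff.mp hF
  rw [h, h, ← Exponents.poly_coeff hP, Exponents.eval_poly, Exponents.eval_poly, Finset.mul_sum]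
  refine Finset.sum_congr rfl fun k _ => ?_
  simp only [Pi.smul_apply, smul_eq_mul, mul_pow, Finset.prod_mul_distrib]
  rw [Finset.prod_pow_eq_pow_sum, k.sum_eq]
  ring

/-- The polynomial function attached to a class `x` in `Ext^N(S / 𝔪^(d+1), S)`: its value at `η` is
the restriction of `x` along the multiplication by `ℓ^d`, for the linear form `ℓ` with coefficient
vector `η`. -/
def topFun (d : ℕ) : ExtPow N (d + 1) N →ₗ[ℂ] ((Fin N → ℂ) → ℂ) :=
  LinearMap.pi fun η => extCoeff N (linForm η ^ d) (linForm_pow_mem η d)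

theorem topFun_extAct {d : ℕ} (g : GL (Fin N) ℂ) (x : ExtPow N (d + 1) N) (η : Fin N → ℂ) :
    topFun d (extAct N (d + 1) N g x) η =
      (g.val.det)⁻¹ * topFun d x ((g⁻¹).val.mulVec η) := by
  refine (extCoeff_extAct g _ _ x).trans ?_
  simp only [map_pow, polyAct_linForm]
  rfl

/-- The multinomial coefficient of an exponent. -/
def Exponents.multinomial {d : ℕ} (k : Exponents N d) : ℂ :=
  (Nat.multinomial Finset.univ k.1 : ℂ)

theorem Exponents.multinomial_ne_zero {d : ℕ} (k : Exponents N d) : k.multinomial ≠ 0 :=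
  Nat.cast_ne_zero.mpr (Nat.multinomial_pos _ _).ne'

theorem topFun_apply {d : ℕ} (x : ExtPow N (d + 1) N) (η : Fin N → ℂ) :
    topFun d x η = MvPolynomial.eval η (Exponents.poly fun k : Exponents N d =>
      k.multinomial * extCoeff N k.monomial k.monomial_mem x) := by
  rw [Exponents.eval_poly]
  refine (extCoeff_sum (fun k : Exponents N d => k.multinomial * ∏ i, η i ^ k.1 i)
    (fun k => k.monomial) (fun k => k.monomial_mem) _ _ ?_ x).trans ?_
  · rw [linForm, Finset.sum_pow_eq_sum_piAntidiag, ← Finset.sum_coe_sort]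
    refine Finset.sum_congr rfl fun k _ => ?_
    rw [map_mul, map_prod, Exponents.multinomial, map_natCast, mul_assoc, Exponents.monomial,
      MvPolynomial.monomial_eq, MvPolynomial.C_1, one_mul,
      Finsupp.prod_fintype _ _ fun i => pow_zero _, ← Finset.prod_mul_distrib]
    congr 1
    refine Finset.prod_congr rfl fun i _ => ?_
    rw [mul_pow, map_pow]
    rfl
  · exact Finset.sum_congr rfl fun k _ => by ring

theorem topFun_mem {d : ℕ} (x : ExtPow N (d + 1) N) : topFun d x ∈ polyFun N d :=
  mem_polyFun_iff.mpr ⟨_, Exponents.isHomogeneous_poly _, topFun_apply x⟩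

theorem exists_extFactor_eq_of_topFun {d : ℕ} (x : ExtPow N (d + 1) N) (hx : topFun d x = 0) :
    ∃ y, extFactor N d y = x := by
  refine exists_extFactor_eq x fun k => ?_
  have h : Exponents.poly (fun k : Exponents N d =>
      k.multinomial * extCoeff N k.monomial k.monomial_mem x) = 0 :=
    MvPolynomial.funext fun η => by rw [← topFun_apply, hx, map_zero, Pi.zero_apply]
  have := Exponents.coeff_poly (fun k : Exponents N d =>
      k.multinomial * extCoeff N k.monomial k.monomial_mem x) k
  rw [h, MvPolynomial.coeff_zero] at this
  exact (mul_eq_zero.mp this.symm).resolve_left k.multinomial_ne_zero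

theorem topFun_extFactor {d : ℕ} (y : ExtPow N d N) : topFun d (extFactor N d y) = 0 :=
  funext fun _ => extCoeff_extFactor _ _ y

theorem exists_topFun_eq {d : ℕ} {F : (Fin N → ℂ) → ℂ} (hF : F ∈ polyFun N d) :
    ∃ x, topFun d x = F := by
  obtain ⟨P, hP, h⟩ := mem_polyFun_iff.mp hF
  obtain ⟨x, hx⟩ := exists_extCoeff_eq
    fun k : Exponents N d => k.multinomial⁻¹ * P.coeff k.toFinsupp
  refine ⟨x, funext fun η => ?_⟩
  rw [topFun_apply, h]
  simp only [hx, mul_inv_cancel_left₀ (Exponents.multinomial_ne_zero _), Exponents.poly_coeff hP]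

/-- The scalar matrix `2`. -/
def doubling (N : ℕ) : GL (Fin N) ℂ := torus fun _ => Units.mk0 2 two_ne_zero

theorem doubling_mul (g : GL (Fin N) ℂ) : doubling N * g = g * doubling N := by
  refine Units.ext ?_
  ext i j
  simp [doubling, torus, mul_comm]

theorem det_doubling : (doubling N).val.det = 2 ^ N := by
  simp [doubling, torus]

theorem doubling_inv_mulVec (η : Fin N → ℂ) :
    ((doubling N)⁻¹).val.mulVec η = (2 : ℂ)⁻¹ • η := by
  rw [doubling, torus_inv]
  ext i
  simp [torus, Matrix.mulVec_diagonal]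

theorem doubling_polyFun {d : ℕ} {F : (Fin N → ℂ) → ℂ} (hF : F ∈ polyFun N d) (η : Fin N → ℂ) :
    ((doubling N).val.det)⁻¹ * F (((doubling N)⁻¹).val.mulVec η) = (2⁻¹ : ℂ) ^ (N + d) * F η := by
  rw [det_doubling, doubling_inv_mulVec, polyFun_smul hF, pow_add, ← mul_assoc,
    inv_pow 2 N]

theorem half_pow_sub_ne_zero {a b : ℕ} (h : a < b) : (2⁻¹ : ℂ) ^ a - (2⁻¹ : ℂ) ^ b ≠ 0 := by
  rw [sub_ne_zero, inv_pow, inv_pow, Ne, inv_inj]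
  intro hab
  have : 2 ^ a = 2 ^ b := by exact_mod_cast hab
  exact h.ne (Nat.pow_right_injective le_rfl this)

/-- The space `Ext^N(S / 𝔪^d, S)` is the direct sum of the spaces of homogeneous polynomial
functions of degrees less than `d`, on which `g` acts by `F ↦ det(g)⁻¹ F(g⁻¹ ·)`. The filtration by
the subspaces `Ext^N(S / 𝔪^i, S)` is split by the eigenspaces of the scalar matrix `2`. -/
theorem exists_splitting (d : ℕ) :
    ∃ e : ℕ → ExtPow N d N →ₗ[ℂ] ((Fin N → ℂ) → ℂ),
      (∀ i < d, ∀ x, e i x ∈ polyFun N i) ∧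
      (∀ x, (∀ i < d, e i x = 0) → x = 0) ∧
      (∀ F : ℕ → (Fin N → ℂ) → ℂ, (∀ i, F i ∈ polyFun N i) → ∃ x, ∀ i < d, e i x = F i) ∧
      ∀ (g : GL (Fin N) ℂ) (x), ∀ i < d, ∀ η,
        e i (extAct N d N g x) η = (g.val.det)⁻¹ * e i x ((g⁻¹).val.mulVec η) := by
  induction d with
  | zero =>
    have h0 : ∀ x : ExtPow N 0 N, x = 0 := eq_zero_of_extPow_zero
    exact ⟨0, by simp, fun x _ => h0 x, fun F _ => ⟨0, by simp⟩, by simp⟩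
  | succ d ih =>
    obtain ⟨e, hmem, hinj, hsurj, hact⟩ := ih
    let T : ExtPow N (d + 1) N →ₗ[ℂ] ExtPow N (d + 1) N :=
      { toFun x := extAct N (d + 1) N (doubling N) x - (2⁻¹ : ℂ) ^ (N + d) • x
        map_add' x y := by
          rw [extAct_add, smul_add]
          abel
        map_smul' c x := by
          rw [extAct_smul, smul_comm, ← smul_sub]
          rfl }
    have hT : ∀ x, ∃ y, extFactor N d y = T x := by
      intro x
      refine exists_extFactor_eq_of_topFun _ (funext fun η => ?_)
      change topFun d (extAct N (d + 1) N (doubling N) x - (2⁻¹ : ℂ) ^ (N + d) • x) η = 0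
      rw [map_sub, map_smul, Pi.sub_apply, topFun_extAct, doubling_polyFun (topFun_mem x)]
      exact sub_self _
    let s : ExtPow N (d + 1) N →ₗ[ℂ] ExtPow N d N :=
      (LinearEquiv.ofInjective _ (extFactor_injective N d)).symm.toLinearMap ∘ₗ
        T.codRestrict (LinearMap.range (extFactor N d)) hT
    have hs : ∀ x, extFactor N d (s x) = T x := fun x =>
      congrArg Subtype.val ((LinearEquiv.ofInjective _ (extFactor_injective N d)).apply_symm_apply
        (T.codRestrict (LinearMap.range (extFactor N d)) hT x))
    have hsf : ∀ y, s (extFactor N d y) =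
        extAct N d N (doubling N) y - (2⁻¹ : ℂ) ^ (N + d) • y := by
      intro y
      refine extFactor_injective N d ?_
      rw [hs, map_sub, map_smul, ← extAct_extFactor]
      rfl
    have hsact : ∀ g x, s (extAct N (d + 1) N g x) = extAct N d N g (s x) := by
      intro g x
      refine extFactor_injective N d ?_
      rw [hs, ← extAct_extFactor, hs]
      change extAct N (d + 1) N (doubling N) (extAct N (d + 1) N g x) - _ • extAct N (d + 1) N g x =
        extAct N (d + 1) N g (extAct N (d + 1) N (doubling N) x - _ • x)
      rw [← extAct_mul, doubling_mul, extAct_mul, sub_eq_add_neg, ← neg_smul, ← extAct_smul,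
        ← extAct_add, neg_smul, ← sub_eq_add_neg]
    let e' : ℕ → ExtPow N (d + 1) N →ₗ[ℂ] ((Fin N → ℂ) → ℂ) := fun i =>
      if i < d then ((2⁻¹ : ℂ) ^ (N + i) - (2⁻¹ : ℂ) ^ (N + d))⁻¹ • (e i ∘ₗ s) else topFun d
    have he' : ∀ i < d, ∀ x,
        e' i x = ((2⁻¹ : ℂ) ^ (N + i) - (2⁻¹ : ℂ) ^ (N + d))⁻¹ • e i (s x) :=
      fun i hi x => by simp only [e', if_pos hi]; rfl
    have hd' : ∀ x, e' d x = topFun d x := fun x => by simp only [e', lt_irrefl, if_false]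
    have hef : ∀ i < d, ∀ y, e' i (extFactor N d y) = e i y := by
      intro i hi y
      rw [he' i hi, hsf]
      funext η
      rw [map_sub, map_smul, Pi.smul_apply, Pi.sub_apply, hact _ _ i hi,
        doubling_polyFun (hmem i hi y), Pi.smul_apply, smul_eq_mul, smul_eq_mul, ← sub_mul,
        inv_mul_cancel_left₀ (half_pow_sub_ne_zero (by omega))]
    refine ⟨e', ?_, ?_, ?_, ?_⟩
    · intro i hi x
      rcases Nat.lt_succ_iff_lt_or_eq.mp hi with h | rfl
      · rw [he' i h]
        exact Submodule.smul_mem _ _ (hmem i h _)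
      · rw [hd']
        exact topFun_mem x
    · intro x hx
      obtain ⟨y, rfl⟩ := exists_extFactor_eq_of_topFun x
        ((hd' x).symm.trans (hx d (Nat.lt_succ_self d)))
      rw [hinj y fun i hi => (hef i hi y).symm.trans (hx i (hi.trans (Nat.lt_succ_self d))),
          map_zero]
    · intro F hF
      obtain ⟨x, hx⟩ := exists_topFun_eq (hF d)
      obtain ⟨y, hy⟩ := hsurj (fun i => if i < d then F i - e' i x else 0) fun i => by
        split_ifs with h
        · rw [he' i h]
          exact sub_mem (hF i) (Submodule.smul_mem _ _ (hmem i h _))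
        · exact zero_mem _
      refine ⟨x + extFactor N d y, fun i hi => ?_⟩
      rcases Nat.lt_succ_iff_lt_or_eq.mp hi with h | rfl
      · rw [map_add, hef i h, hy i h, if_pos h, add_sub_cancel]
      · rw [map_add, hd', hd', topFun_extFactor, hx, add_zero]
    · intro g x i hi η
      rcases Nat.lt_succ_iff_lt_or_eq.mp hi with h | rfl
      · rw [he' i h, he' i h, hsact, Pi.smul_apply, Pi.smul_apply, hact g _ i h, smul_eq_mul,
          smul_eq_mul]
        ring
      · rw [hd', hd', topFun_extAct]

end PowerExt

end

/-! ### Evaluations of tensors and row-symmetric tensors -/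

noncomputable section

namespace PowerExt

section Evaluation

variable {N : ℕ} {μ : Fin N → ℕ}

/-- The linear form on the tensor power that is the product of a linear form on each factor. -/
def prodForm (f : Box μ → Module.Dual ℂ (Fin N → ℂ)) : BoxTensor μ →ₗ[ℂ] ℂ :=
  PiTensorProduct.lift ((MultilinearMap.mkPiAlgebra ℂ (Box μ) ℂ).compLinearMap f)

theorem prodForm_tprod (f : Box μ → Module.Dual ℂ (Fin N → ℂ)) (v : Box μ → Fin N → ℂ) :
    prodForm f (PiTensorProduct.tprod ℂ v) = ∏ b, f b (v b) := by
  simp [prodForm]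

/-- The evaluation of tensors at a matrix `B`: the form that applies the `k`-th row of `B` to the
factors in the `k`-th row of the diagram. -/
def rowForm (B : Matrix (Fin N) (Fin N) ℂ) : BoxTensor μ →ₗ[ℂ] ℂ :=
  prodForm fun b => LinearMap.proj b.1 ∘ₗ Matrix.toLin' B

theorem rowForm_tprod (B : Matrix (Fin N) (Fin N) ℂ) (v : Box μ → Fin N → ℂ) :
    rowForm B (PiTensorProduct.tprod ℂ v) = ∏ b, B.mulVec (v b) b.1 := by
  rw [rowForm, prodForm_tprod]
  simp

theorem permFactors_tprod (σ : Equiv.Perm (Box μ)) (v : Box μ → Fin N → ℂ) :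
    permFactors μ σ (PiTensorProduct.tprod ℂ v) = PiTensorProduct.tprod ℂ fun b => v (σ.symm b) :=
  PiTensorProduct.reindex_tprod σ v

theorem tensor_linearMap_ext {E : Type*} [AddCommMonoid E] [Module ℂ E]
    {f g : BoxTensor μ →ₗ[ℂ] E}
    (h : ∀ v, f (PiTensorProduct.tprod ℂ v) = g (PiTensorProduct.tprod ℂ v)) : f = g :=
  PiTensorProduct.ext (MultilinearMap.ext h)

theorem rowForm_permFactors (B : Matrix (Fin N) (Fin N) ℂ) {σ : Equiv.Perm (Box μ)}
    (hσ : σ ∈ rowPerms μ) (T : BoxTensor μ) : rowForm B (permFactors μ σ T) = rowForm B T := by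
  refine LinearMap.congr_fun (tensor_linearMap_ext (f := rowForm B ∘ₗ permFactors μ σ)
    fun v => ?_) T
  rw [LinearMap.comp_apply, permFactors_tprod, rowForm_tprod, rowForm_tprod,
    ← Equiv.prod_comp σ]
  refine Finset.prod_congr rfl fun b _ => ?_
  rw [Equiv.symm_apply_apply, (Finset.mem_filter.mp hσ).2 b]

/-- The basis of the tensor power given by the standard basis. -/
def tensorBasis (μ : Fin N → ℕ) : Module.Basis (Box μ → Fin N) ℂ (BoxTensor μ) :=
  Basis.piTensorProduct fun _ => Pi.basisFun ℂ (Fin N)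

theorem tensorBasis_repr_tprod (v : Box μ → Fin N → ℂ) (p : Box μ → Fin N) :
    (tensorBasis μ).repr (PiTensorProduct.tprod ℂ v) p = ∏ b, v b (p b) := by
  rw [tensorBasis, Basis.piTensorProduct_repr_tprod_apply]
  simp

theorem tensorBasis_repr_permFactors (σ : Equiv.Perm (Box μ)) (T : BoxTensor μ)
    (p : Box μ → Fin N) :
    (tensorBasis μ).repr (permFactors μ σ T) p = (tensorBasis μ).repr T (p ∘ σ) := by
  refine LinearMap.congr_fun (tensor_linearMap_ext
    (f := (tensorBasis μ).coord p ∘ₗ permFactors μ σ) (g := (tensorBasis μ).coord (p ∘ σ))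
    fun v => ?_) T
  rw [LinearMap.comp_apply, permFactors_tprod, Module.Basis.coord_apply, Module.Basis.coord_apply,
    tensorBasis_repr_tprod, tensorBasis_repr_tprod, ← Equiv.prod_comp σ]
  simp

theorem rowForm_eq_sum (B : Matrix (Fin N) (Fin N) ℂ) (T : BoxTensor μ) :
    rowForm B T = ∑ p, (tensorBasis μ).repr T p * ∏ b : Box μ, B b.1 (p b) := by
  conv_lhs => rw [← (tensorBasis μ).sum_repr T]
  rw [map_sum]
  refine Finset.sum_congr rfl fun p _ => ?_
  rw [map_smul, smul_eq_mul, tensorBasis, Basis.piTensorProduct_apply, rowForm_tprod]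
  congr 1
  refine Finset.prod_congr rfl fun b _ => ?_
  rw [Pi.basisFun_apply, Matrix.mulVec_single_one]
  rfl

/-- The exponent of the monomial in the entries of the matrix `B` by which `rowForm B` multiplies
the coefficient of a tensor at the multi-index `p`. -/
def rowExponent (p : Box μ → Fin N) : Fin N × Fin N →₀ ℕ := ∑ b, Finsupp.single (b.1, p b) 1

theorem rowExponent_apply (p : Box μ → Fin N) (c : Fin N × Fin N) :
    rowExponent p c = Fintype.card {b : Box μ // (b.1, p b) = c} := by
  rw [rowExponent, Finsupp.finsetSum_apply, Fintype.card_subtype, Finset.card_filter]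
  exact Finset.sum_congr rfl fun b _ => Finsupp.single_apply

theorem exists_rowPerm_of_rowExponent_eq {p q : Box μ → Fin N}
    (h : rowExponent p = rowExponent q) : ∃ σ ∈ rowPerms μ, q ∘ σ = p := by
  have e : ∀ c, {b : Box μ // (b.1, p b) = c} ≃ {b : Box μ // (b.1, q b) = c} := fun c =>
    Fintype.equivOfCardEq (by rw [← rowExponent_apply, ← rowExponent_apply, h])
  have hσ := Equiv.ofFiberEquiv_map e
  refine ⟨Equiv.ofFiberEquiv e, Finset.mem_filter.mpr ⟨Finset.mem_univ _, fun b => ?_⟩,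
    funext fun b => ?_⟩
  · exact congrArg Prod.fst (hσ b)
  · exact congrArg Prod.snd (hσ b)

/-- A tensor that is symmetric in the factors of each row is determined by its evaluations at
matrices: these evaluations form a polynomial function of the matrix, whose coefficients are
multiples of those of the tensor. -/
theorem eq_zero_of_rowForm_eq_zero (T : BoxTensor μ)
    (hT : ∀ σ ∈ rowPerms μ, permFactors μ σ T = T) (h : ∀ B, rowForm B T = 0) : T = 0 := by
  classical
  let Q : MvPolynomial (Fin N × Fin N) ℂ :=
    ∑ p, MvPolynomial.monomial (rowExponent p) ((tensorBasis μ).repr T p)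
  have hQ : Q = 0 := by
    refine MvPolynomial.funext fun x => ?_
    rw [map_zero, ← h (Matrix.of fun i j => x (i, j)), rowForm_eq_sum, map_sum]
    refine Finset.sum_congr rfl fun p _ => ?_
    rw [MvPolynomial.eval_monomial, rowExponent, Finsupp.prod_fintype _ _ fun i => pow_zero _]
    congr 1
    simp only [Finsupp.finsetSum_apply, ← Finset.prod_pow_eq_pow_sum]
    rw [Finset.prod_comm]
    refine Finset.prod_congr rfl fun b _ => ?_
    rw [Finset.prod_eq_single (b.1, p b)]
    · simp
    · intro c _ hc
      rw [Finsupp.single_eq_of_ne hc, pow_zero]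
    · simp
  refine (tensorBasis μ).ext_elem fun p => ?_
  rw [map_zero, Finsupp.zero_apply]
  have h1 : ∑ q, (if rowExponent q = rowExponent p then (tensorBasis μ).repr T q else 0) = 0 := by
    have := congrArg (MvPolynomial.coeff (rowExponent p)) hQ
    rw [MvPolynomial.coeff_sum, MvPolynomial.coeff_zero] at this
    refine Eq.trans ?_ this
    exact Finset.sum_congr rfl fun q _ => (MvPolynomial.coeff_monomial _ _ _).symm
  have h2 : ∀ q, (if rowExponent q = rowExponent p then (tensorBasis μ).repr T q else 0) =
      (if rowExponent q = rowExponent p then 1 else 0) * (tensorBasis μ).repr T p := by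
    intro q
    split_ifs with hq
    · obtain ⟨σ, hσ, rfl⟩ := exists_rowPerm_of_rowExponent_eq hq
      rw [one_mul, ← tensorBasis_repr_permFactors, hT σ hσ]
    · rw [zero_mul]
  simp only [h2, ← Finset.sum_mul, Finset.sum_boole] at h1
  refine (mul_eq_zero.mp h1).resolve_left (Nat.cast_ne_zero.mpr ?_)
  exact (Finset.card_pos.mpr ⟨p, by simp⟩).ne'

theorem rowPerms_mul_mem {σ τ : Equiv.Perm (Box μ)} (hσ : σ ∈ rowPerms μ) (hτ : τ ∈ rowPerms μ) :
    σ * τ ∈ rowPerms μ := by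
  rw [rowPerms, Finset.mem_filter] at *
  exact ⟨Finset.mem_univ _, fun b => (hσ.2 _).trans (hτ.2 b)⟩

theorem rowPerms_inv_mem {σ : Equiv.Perm (Box μ)} (hσ : σ ∈ rowPerms μ) : σ⁻¹ ∈ rowPerms μ := by
  rw [rowPerms, Finset.mem_filter] at *
  refine ⟨Finset.mem_univ _, fun b => ?_⟩
  have := hσ.2 (σ⁻¹ b)
  rw [show σ (σ⁻¹ b) = b from σ.apply_symm_apply b] at this
  exact this.symm

theorem permFactors_mul (σ τ : Equiv.Perm (Box μ)) (T : BoxTensor μ) :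
    permFactors μ (σ * τ) T = permFactors μ σ (permFactors μ τ T) := by
  refine LinearMap.congr_fun (tensor_linearMap_ext
    (g := permFactors μ σ ∘ₗ permFactors μ τ) fun v => ?_) T
  rw [LinearMap.comp_apply, permFactors_tprod, permFactors_tprod, permFactors_tprod]
  rfl

theorem permFactors_youngSymmetrizer {σ : Equiv.Perm (Box μ)} (hσ : σ ∈ rowPerms μ)
    (T : BoxTensor μ) :
    permFactors μ σ (youngSymmetrizer μ T) = youngSymmetrizer μ T := by
  rw [youngSymmetrizer, LinearMap.comp_apply]
  generalize (∑ τ ∈ colPerms μ, ((Equiv.Perm.sign τ : ℤ) : ℂ) • permFactors μ τ) T = U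
  rw [LinearMap.sum_apply, map_sum]
  refine Finset.sum_nbij' (fun τ => σ * τ) (fun τ => σ⁻¹ * τ) ?_ ?_ ?_ ?_ ?_
  · exact fun τ hτ => rowPerms_mul_mem hσ hτ
  · exact fun τ hτ => rowPerms_mul_mem (rowPerms_inv_mem hσ) hτ
  · intro τ _
    simp
  · intro τ _
    simp
  · exact fun τ _ => (permFactors_mul σ τ U).symm

variable (μ) in
/-- The antisymmetrization along the columns. -/
def colAntisymmetrizer : BoxTensor μ →ₗ[ℂ] BoxTensor μ :=
  ∑ τ ∈ colPerms μ, ((Equiv.Perm.sign τ : ℤ) : ℂ) • permFactors μ τ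

theorem rowForm_youngSymmetrizer (B : Matrix (Fin N) (Fin N) ℂ) (T : BoxTensor μ) :
    rowForm B (youngSymmetrizer μ T) =
      ((rowPerms μ).card : ℂ) * rowForm B (colAntisymmetrizer μ T) := by
  rw [youngSymmetrizer, LinearMap.comp_apply, LinearMap.sum_apply, map_sum,
    Finset.sum_congr rfl fun σ hσ => rowForm_permFactors B hσ _, Finset.sum_const, nsmul_eq_mul]
  rfl

/-- The kernel of the Young symmetrizer is detected by the evaluations at matrices. -/
theorem youngSymmetrizer_eq_zero_iff (T : BoxTensor μ) :
    youngSymmetrizer μ T = 0 ↔ ∀ B, rowForm B (colAntisymmetrizer μ T) = 0 := by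
  have hcard : ((rowPerms μ).card : ℂ) ≠ 0 :=
    Nat.cast_ne_zero.mpr (Finset.card_pos.mpr ⟨1, by simp [rowPerms]⟩).ne'
  constructor
  · intro h B
    have := rowForm_youngSymmetrizer B T
    rw [h, map_zero] at this
    exact (mul_eq_zero.mp this.symm).resolve_left hcard
  · intro h
    refine eq_zero_of_rowForm_eq_zero _ (fun σ hσ => permFactors_youngSymmetrizer hσ T) fun B => ?_
    rw [rowForm_youngSymmetrizer, h, mul_zero]

/-- The evaluation at a matrix of the antisymmetrization of a pure tensor, as a determinant indexed
by the boxes. -/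
theorem rowForm_colAntisymmetrizer_tprod (B : Matrix (Fin N) (Fin N) ℂ) (v : Box μ → Fin N → ℂ) :
    rowForm B (colAntisymmetrizer μ (PiTensorProduct.tprod ℂ v)) =
      (Matrix.of fun b c : Box μ =>
        if (b.2 : ℕ) = (c.2 : ℕ) then B.mulVec (v c) b.1 else 0).det := by
  rw [Matrix.det_apply', colAntisymmetrizer, LinearMap.sum_apply, map_sum, colPerms,
    Finset.sum_filter]
  refine Finset.sum_congr rfl fun τ _ => ?_
  split_ifs with h
  · rw [LinearMap.smul_apply, map_smul, smul_eq_mul, permFactors_tprod, rowForm_tprod,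
      ← Equiv.prod_comp τ]
    congr 1
    refine Finset.prod_congr rfl fun b _ => ?_
    rw [Equiv.symm_apply_apply, Matrix.of_apply, if_pos (h b)]
  · push Not at h
    obtain ⟨b, hb⟩ := h
    rw [Finset.prod_eq_zero (Finset.mem_univ b), mul_zero]
    rw [Matrix.of_apply, if_neg hb]

end Evaluation

end PowerExt

end

/-! ### Schur functors of rectangular diagrams as spaces of polynomial functions -/

noncomputable section

namespace PowerExt

section Rectangle

variable {n i : ℕ} {μ : Fin (n + 1) → ℕ}

theorem exists_boxEquiv (hμ : ∀ k, μ k = if k = ⊤ then 0 else i) :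
    ∃ β : Fin n × Fin i ≃ Box μ, (∀ p, (β p).1 = p.1.castSucc) ∧ ∀ p, ((β p).2 : ℕ) = p.2 := by
  have h1 : ∀ k : Fin n, μ k.castSucc = i := fun k => by
    rw [hμ, if_neg]
    exact (Fin.castSucc_lt_last k).ne
  have h2 : μ (Fin.last n) = 0 := by
    rw [hμ, if_pos]
    rfl
  refine ⟨Equiv.ofBijective (fun p => ⟨p.1.castSucc, Fin.cast (h1 p.1).symm p.2⟩) ⟨?_, ?_⟩,
    fun _ => rfl, fun _ => rfl⟩
  · rintro ⟨k, j⟩ ⟨k', j'⟩ h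
    rw [Sigma.mk.injEq] at h
    obtain ⟨hk, hj⟩ := h
    obtain rfl := Fin.castSucc_injective n hk
    rw [heq_eq_eq] at hj
    exact Prod.ext rfl (Fin.cast_injective _ hj)
  · rintro ⟨k, j⟩
    induction k using Fin.lastCases with
    | last => exact (Fin.cast h2 j).elim0
    | cast k => exact ⟨(k, Fin.cast (h1 k) j), rfl⟩

variable (β : Fin n × Fin i ≃ Box μ)

/-- The matrix whose first columns are the vectors in the `j`-th column of the diagram, followed by
a column of zeros. -/
def colMat (v : Box μ → Fin (n + 1) → ℂ) (j : Fin i) : Matrix (Fin (n + 1)) (Fin (n + 1)) ℂ :=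
  Matrix.of fun a => Fin.snoc (α := fun _ => ℂ) (fun k => v (β (k, j)) a) 0

theorem colMat_castSucc (v : Box μ → Fin (n + 1) → ℂ) (j : Fin i) (a : Fin (n + 1)) (k : Fin n) :
    colMat β v j a k.castSucc = v (β (k, j)) a := by
  simp [colMat]

theorem colMat_last (v : Box μ → Fin (n + 1) → ℂ) (j : Fin i) (a : Fin (n + 1)) :
    colMat β v j a (Fin.last n) = 0 := by
  simp [colMat]

theorem adjugate_mulVec_last (A : Matrix (Fin (n + 1)) (Fin (n + 1)) ℂ) (η : Fin (n + 1) → ℂ) :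
    A.adjugate.mulVec η (Fin.last n) = (A.updateCol (Fin.last n) η).det := by
  rw [← Matrix.cramer_eq_adjugate_mulVec, Matrix.cramer_apply]

/-- The map from the tensor power to the functions on `ℂ^N` that sends a pure tensor to the function
whose value at `η` is the product, over the columns of the diagram, of the determinants of the
vectors in the column completed by `η`; the determinants are expanded to display the linearity. -/
def schurFun : BoxTensor μ →ₗ[ℂ] ((Fin (n + 1) → ℂ) → ℂ) :=
  LinearMap.pi fun η => ∑ π : Fin i → Equiv.Perm (Fin (n + 1)),
    (∏ j, ((Equiv.Perm.sign (π j) : ℤ) : ℂ) * η (π j (Fin.last n))) •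
      prodForm fun b => LinearMap.proj (π (β.symm b).2 b.1)

variable {β} (h1 : ∀ p, (β p).1 = p.1.castSucc)
include h1

theorem schurFun_tprod (v : Box μ → Fin (n + 1) → ℂ) (η : Fin (n + 1) → ℂ) :
    schurFun β (PiTensorProduct.tprod ℂ v) η =
      ∏ j, (colMat β v j).adjugate.mulVec η (Fin.last n) := by
  simp only [adjugate_mulVec_last, Matrix.det_apply', Finset.prod_univ_sum, Fintype.piFinset_univ]
  rw [schurFun, LinearMap.pi_apply, LinearMap.sum_apply]
  refine Finset.sum_congr rfl fun π _ => ?_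
  rw [LinearMap.smul_apply, prodForm_tprod, smul_eq_mul, ← β.prod_comp,
    Fintype.prod_prod_type_right, ← Finset.prod_mul_distrib]
  refine Finset.prod_congr rfl fun j _ => ?_
  rw [Fin.prod_univ_castSucc, Matrix.updateCol_self, mul_assoc, mul_comm (η _)]
  congr 2
  refine Finset.prod_congr rfl fun k _ => ?_
  rw [Matrix.updateCol_ne (Fin.castSucc_lt_last k).ne, colMat_castSucc, β.symm_apply_apply, h1]
  rfl

theorem schurFun_mem (T : BoxTensor μ) : schurFun β T ∈ polyFun (n + 1) i := by
  induction T using PiTensorProduct.induction_on with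
  | smul_tprod r v =>
    rw [map_smul]
    refine Submodule.smul_mem _ _ (mem_polyFun_iff.mpr
      ⟨∏ j, linForm ((colMat β v j).adjugate (Fin.last n)), ?_, fun η => ?_⟩)
    · have := MvPolynomial.IsHomogeneous.prod Finset.univ
        (fun j => linForm ((colMat β v j).adjugate (Fin.last n))) (fun _ => 1) fun j _ =>
          MvPolynomial.IsHomogeneous.sum _ _ _ fun k _ => MvPolynomial.isHomogeneous_C_mul_X _ k
      simpa using this
    · rw [schurFun_tprod h1, map_prod]
      refine Finset.prod_congr rfl fun j _ => ?_
      simp [linForm, Matrix.mulVec, dotProduct]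
  | add x y hx hy =>
    rw [map_add]
    exact add_mem hx hy

theorem schurFun_tensorAct (g : GL (Fin (n + 1)) ℂ) (T : BoxTensor μ) (η : Fin (n + 1) → ℂ) :
    schurFun β (tensorAct μ g.val T) η =
      g.val.det ^ i * schurFun β T ((g⁻¹).val.mulVec η) := by
  refine LinearMap.congr_fun (tensor_linearMap_ext
    (f := LinearMap.proj η ∘ₗ schurFun β ∘ₗ tensorAct μ g.val)
    (g := g.val.det ^ i • (LinearMap.proj ((g⁻¹).val.mulVec η) ∘ₗ schurFun β)) fun v => ?_) T
  simp only [LinearMap.comp_apply, LinearMap.smul_apply, LinearMap.proj_apply, smul_eq_mul]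
  have hg : tensorAct μ g.val (PiTensorProduct.tprod ℂ v) =
      PiTensorProduct.tprod ℂ fun b => g.val.mulVec (v b) :=
    PiTensorProduct.map_tprod _ _
  have hadj : g.val.adjugate = g.val.det • (g⁻¹).val := by
    rw [← mul_one g.val.adjugate, ← g.mul_inv, ← mul_assoc, Matrix.adjugate_mul, Matrix.smul_mul,
      one_mul]
  rw [hg, schurFun_tprod h1, schurFun_tprod h1]
  have hj : ∀ j, (colMat β (fun b => g.val.mulVec (v b)) j).adjugate.mulVec η (Fin.last n) =
      g.val.det * (colMat β v j).adjugate.mulVec ((g⁻¹).val.mulVec η) (Fin.last n) := by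
    intro j
    have : colMat β (fun b => g.val.mulVec (v b)) j = g.val * colMat β v j := by
      ext a k
      rw [Matrix.mul_apply]
      induction k using Fin.lastCases with
      | last => simp [colMat_last]
      | cast k => simp only [colMat_castSucc]; rfl
    rw [this, Matrix.adjugate_mul_distrib, hadj, ← Matrix.mulVec_mulVec, Matrix.smul_mulVec,
      Matrix.mulVec_smul]
    rfl
  simp only [hj, Finset.prod_mul_distrib, Finset.prod_const, Finset.card_univ, Fintype.card_fin]

omit h1 in
theorem exists_prod_eq_monomial (i : ℕ) (m : Fin (n + 1) →₀ ℕ) (hm : m.degree = i) :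
    ∃ a : Fin i → Fin (n + 1), ∀ η : Fin (n + 1) → ℂ, ∏ j, η (a j) = ∏ x, η x ^ m x := by
  induction i generalizing m with
  | zero =>
    rw [Finsupp.degree_eq_zero_iff] at hm
    subst hm
    exact ⟨Fin.elim0, fun η => by simp⟩
  | succ i ih =>
    have hm0 : m ≠ 0 := by
      rintro rfl
      simp at hm
    obtain ⟨x, hx⟩ := Finsupp.ne_iff.mp hm0
    obtain ⟨m', rfl⟩ : ∃ m', m = Finsupp.single x 1 + m' :=
      exists_add_of_le (Finsupp.single_le_iff.mpr (Nat.one_le_iff_ne_zero.mpr hx))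
    rw [map_add, Finsupp.degree_single] at hm
    obtain ⟨a, ha⟩ := ih m' (by omega)
    refine ⟨Fin.cons x a, fun η => ?_⟩
    rw [Fin.prod_univ_succ, Fin.cons_zero]
    simp only [Fin.cons_succ, ha, Finsupp.add_apply, pow_add, Finset.prod_mul_distrib]
    congr 1
    rw [Finset.prod_eq_single x]
    · simp
    · intro y _ hy
      rw [Finsupp.single_eq_of_ne hy, pow_zero]
    · simp

/-- A product of coordinate functions is the image of the pure tensor whose vectors in each column
are the standard basis vectors, except for the one that is dual to the coordinate. -/
theorem prod_coord_mem_range_schurFun (a : Fin i → Fin (n + 1)) :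
    (fun η : Fin (n + 1) → ℂ => ∏ j, η (a j)) ∈ LinearMap.range (schurFun β) := by
  let M : Fin i → Matrix (Fin (n + 1)) (Fin (n + 1)) ℂ := fun j => Matrix.swap ℂ (Fin.last n) (a j)
  have hM : ∀ j, M j * M j = 1 := fun j => Matrix.swap_mul_self _ _
  have hdet : ∀ j, (M j).det * (M j).det = 1 := fun j => by
    rw [← Matrix.det_mul, hM, Matrix.det_one]
  have hadj : ∀ j, (M j).adjugate = (M j).det • M j := fun j => by
    rw [← mul_one (M j).adjugate, ← hM, ← mul_assoc, Matrix.adjugate_mul, Matrix.smul_mul, one_mul]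
  let v : Box μ → Fin (n + 1) → ℂ := fun b x => M (β.symm b).2 x b.1
  refine ⟨(∏ j, (M j).det) • PiTensorProduct.tprod ℂ v, funext fun η => ?_⟩
  rw [map_smul, Pi.smul_apply, schurFun_tprod h1, smul_eq_mul, ← Finset.prod_mul_distrib]
  refine Finset.prod_congr rfl fun j _ => ?_
  have : (colMat β v j).updateCol (Fin.last n) η = (M j).updateCol (Fin.last n) η := by
    ext x k
    induction k using Fin.lastCases with
    | last => simp
    | cast k =>
      rw [Matrix.updateCol_ne (Fin.castSucc_lt_last k).ne,
        Matrix.updateCol_ne (Fin.castSucc_lt_last k).ne, colMat_castSucc]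
      simp only [v]
      rw [β.symm_apply_apply, h1]
  rw [adjugate_mulVec_last, this, ← adjugate_mulVec_last, hadj, Matrix.smul_mulVec, Pi.smul_apply,
    Matrix.swap_mulVec_apply, smul_eq_mul, ← mul_assoc, hdet, one_mul]

theorem range_schurFun : LinearMap.range (schurFun β) = polyFun (n + 1) i := by
  refine le_antisymm ?_ fun F hF => ?_
  · rintro _ ⟨T, rfl⟩
    exact schurFun_mem h1 T
  · obtain ⟨P, hP, h⟩ := mem_polyFun_iff.mp hF
    have : F = ∑ k : Exponents (n + 1) i, P.coeff k.toFinsupp •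
        fun η : Fin (n + 1) → ℂ => ∏ x, η x ^ k.toFinsupp x := by
      funext η
      rw [h]
      conv_lhs => rw [← Exponents.poly_coeff hP]
      rw [Exponents.eval_poly, Finset.sum_apply]
      rfl
    rw [this]
    refine Submodule.sum_mem _ fun k _ => Submodule.smul_mem _ _ ?_
    obtain ⟨a, ha⟩ := exists_prod_eq_monomial i k.toFinsupp k.degree_toFinsupp
    simp only [← ha]
    exact prod_coord_mem_range_schurFun h1 a

variable (h2 : ∀ p, ((β p).2 : ℕ) = p.2)
include h2

/-- The evaluations of an antisymmetrized tensor are values of its polynomial function: a minor of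
the product of two matrices is an entry of the product of their adjugates. -/
theorem rowForm_colAntisymmetrizer (B : Matrix (Fin (n + 1)) (Fin (n + 1)) ℂ) (T : BoxTensor μ) :
    rowForm B (colAntisymmetrizer μ T) =
      schurFun β T (B.adjugate.mulVec (Pi.single (Fin.last n) 1)) := by
  refine LinearMap.congr_fun (tensor_linearMap_ext
    (f := rowForm B ∘ₗ colAntisymmetrizer μ)
    (g := LinearMap.proj (B.adjugate.mulVec (Pi.single (Fin.last n) 1)) ∘ₗ schurFun β)
    fun v => ?_) T
  simp only [LinearMap.comp_apply, LinearMap.proj_apply]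
  rw [rowForm_colAntisymmetrizer_tprod, schurFun_tprod h1, ← Matrix.det_submatrix_equiv_self β]
  have : (Matrix.of fun b c : Box μ =>
      if (b.2 : ℕ) = (c.2 : ℕ) then B.mulVec (v c) b.1 else 0).submatrix β β =
      Matrix.blockDiagonal fun j => Matrix.of fun k k' : Fin n =>
        B.mulVec (v (β (k', j))) k.castSucc := by
    ext ⟨k, j⟩ ⟨k', j'⟩
    rw [Matrix.submatrix_apply, Matrix.of_apply, Matrix.blockDiagonal_apply, h2, h2, h1]
    by_cases hj : j = j'
    · subst hj
      simp
    · rw [if_neg hj, if_neg fun h => hj (Fin.ext h)]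
  rw [this, Matrix.det_blockDiagonal]
  refine Finset.prod_congr rfl fun j _ => ?_
  rw [Matrix.mulVec_mulVec, ← Matrix.adjugate_mul_distrib, Matrix.mulVec_single_one,
    Matrix.col_apply, Matrix.adjugate_fin_succ_eq_det_submatrix, ← two_mul, pow_mul, neg_one_sq,
    one_pow, one_mul]
  congr 1
  ext k k'
  rw [Matrix.submatrix_apply, Fin.succAbove_last, Matrix.mul_apply]
  simp only [colMat_castSucc]
  rfl

theorem youngSymmetrizer_eq_zero_iff_schurFun (T : BoxTensor μ) :
    youngSymmetrizer μ T = 0 ↔ schurFun β T = 0 := by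
  rw [youngSymmetrizer_eq_zero_iff]
  simp only [rowForm_colAntisymmetrizer h1 h2]
  refine ⟨fun h => ?_, fun h B => by rw [h]; rfl⟩
  -- every vector with nonzero last coordinate is the last column of an invertible matrix
  have key : ∀ η : Fin (n + 1) → ℂ, η (Fin.last n) ≠ 0 → schurFun β T η = 0 := by
    intro η hη
    let A := (1 : Matrix (Fin (n + 1)) (Fin (n + 1)) ℂ).updateCol (Fin.last n) η
    have hdet : A.det = η (Fin.last n) := by
      rw [← adjugate_mulVec_last, Matrix.adjugate_one, Matrix.one_mulVec]
    have hA : A.adjugate.adjugate = A.det ^ n • (A.det⁻¹ • A) := by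
      have hd : A.det ≠ 0 := hdet ▸ hη
      have e1 : A.adjugate.adjugate * A.adjugate * A = A.det ^ n • A := by
        rw [Matrix.adjugate_mul, Matrix.det_adjugate, Fintype.card_fin, Nat.add_sub_cancel,
          Matrix.smul_mul, one_mul]
      rw [mul_assoc, Matrix.adjugate_mul, Matrix.mul_smul, mul_one] at e1
      rw [smul_comm, ← e1, smul_smul, inv_mul_cancel₀ hd, one_smul]
    have := h A.adjugate
    rw [hA, Matrix.smul_mulVec, Matrix.smul_mulVec, Matrix.mulVec_single_one,
      show A.col (Fin.last n) = η from funext fun x => by simp [A],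
      polyFun_smul (schurFun_mem h1 T), polyFun_smul (schurFun_mem h1 T), hdet] at this
    exact (mul_eq_zero.mp ((mul_eq_zero.mp this).resolve_left
      (pow_ne_zero _ (pow_ne_zero _ hη)))).resolve_left (pow_ne_zero _ (inv_ne_zero hη))
  obtain ⟨P, -, hP⟩ := mem_polyFun_iff.mp (schurFun_mem h1 T)
  have h0 : MvPolynomial.X (Fin.last n) * P = 0 := MvPolynomial.funext fun η => by
    rw [map_mul, ← hP, MvPolynomial.eval_X, map_zero, mul_eq_zero]
    exact or_iff_not_imp_left.mpr (key η)
  funext η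
  rw [hP, (mul_eq_zero.mp h0).resolve_left (MvPolynomial.X_ne_zero _), map_zero]
  rfl

end Rectangle

theorem exists_schurSpace_equiv {n i : ℕ} {μ : Fin (n + 1) → ℕ}
    (hμ : ∀ k, μ k = if k = ⊤ then 0 else i) :
    ∃ E : schurSpace μ ≃ₗ[ℂ] polyFun (n + 1) i, ∀ (g : GL (Fin (n + 1)) ℂ) (y) (η),
      (E (schurRep μ g y)).1 η = g.val.det ^ i * (E y).1 ((g⁻¹).val.mulVec η) := by
  obtain ⟨β, h1, h2⟩ := exists_boxEquiv hμ
  have hker : LinearMap.ker (youngSymmetrizer μ) = LinearMap.ker (schurFun β) :=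
    Submodule.ext (youngSymmetrizer_eq_zero_iff_schurFun h1 h2)
  let E : schurSpace μ ≃ₗ[ℂ] polyFun (n + 1) i :=
    (youngSymmetrizer μ).quotKerEquivRange.symm ≪≫ₗ Submodule.quotEquivOfEq _ _ hker ≪≫ₗ
      (schurFun β).quotKerEquivRange ≪≫ₗ LinearEquiv.ofEq _ _ (range_schurFun h1)
  have hE : ∀ T (h : youngSymmetrizer μ T ∈ schurSpace μ),
      (E ⟨youngSymmetrizer μ T, h⟩).1 = schurFun β T := by
    intro T h
    have h0 : (youngSymmetrizer μ).quotKerEquivRange.symm ⟨youngSymmetrizer μ T, h⟩ =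
        Submodule.Quotient.mk T := by
      rw [LinearEquiv.symm_apply_eq]
      rfl
    exact congrArg (fun z => ((LinearEquiv.ofEq _ _ (range_schurFun h1))
      ((schurFun β).quotKerEquivRange (Submodule.quotEquivOfEq _ _ hker z))).1) h0
  refine ⟨E, ?_⟩
  rintro g ⟨_, T, rfl⟩ η
  have hg : schurRep μ g ⟨youngSymmetrizer μ T, T, rfl⟩ =
      ⟨youngSymmetrizer μ (tensorAct μ g.val T), _, rfl⟩ :=
    Subtype.ext (tensorAct_youngSymmetrizer μ g.val T)
  rw [hg]
  refine (congrFun (hE _ _) η).trans ((schurFun_tensorAct h1 g T η).trans ?_)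
  exact congrArg (g.val.det ^ i * ·) (congrFun (hE T _) _).symm

theorem weightPartition_extWeight (N : ℕ) [NeZero N] (i : ℕ) (k : Fin N) :
    weightPartition (extWeight N i) k = if k = ⊤ then 0 else i := by
  by_cases hk : k = ⊤
  · simp [weightPartition, extWeight, hk]
  · simp only [weightPartition, extWeight, hk, if_true, if_false]
    omega

/-- The representation of weight `(-1, …, -1, -i-1)` is the space of homogeneous polynomial
functions of degree `i` on `ℂ^N`, on which `g` acts by `F ↦ det(g)⁻¹ F(g⁻¹ ·)`. -/
theorem exists_weightSpace_equiv (N : ℕ) [NeZero N] (i : ℕ) :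
    ∃ E : WeightSpace (extWeight N i) ≃ₗ[ℂ] polyFun N i, ∀ (g : GL (Fin N) ℂ) (y) (η),
      (E (weightRep (extWeight N i) g y)).1 η =
        (g.val.det)⁻¹ * (E y).1 ((g⁻¹).val.mulVec η) := by
  obtain ⟨n, rfl⟩ := Nat.exists_eq_succ_of_ne_zero (NeZero.ne N)
  obtain ⟨E, hE⟩ := exists_schurSpace_equiv (weightPartition_extWeight (n + 1) i)
  refine ⟨E, fun g y η => ?_⟩
  have hw : weightRep (extWeight (n + 1) i) g y =
      (g.val.det ^ (-(i : ℤ) - 1)) • schurRep (weightPartition (extWeight (n + 1) i)) g y := by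
    change ((Matrix.GeneralLinearGroup.det g ^ extWeight (n + 1) i ⊤ : ℂˣ) : ℂ) •
      schurRep (weightPartition (extWeight (n + 1) i)) g y = _
    rw [Units.val_zpow_eq_zpow_val, extWeight, if_pos rfl]
    rfl
  have hd : g.val.det ≠ 0 := (Matrix.GeneralLinearGroup.det g).ne_zero
  refine (congrArg (fun z => (E z).1 η) hw).trans ?_
  rw [map_smul]
  change _ * (E (schurRep _ g y)).1 η = _
  rw [hE, ← mul_assoc, ← zpow_natCast, ← zpow_add₀ hd, show -(i : ℤ) - 1 + i = -1 by ring,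
      zpow_neg_one]

end PowerExt

end

/-! ### Homogeneous classes are eigenvectors of the scalar matrices -/

noncomputable section

namespace PowerExt

open Abelian

variable {N : ℕ}

theorem mem_polyGrading_iff {k : ℤ} {p : Poly N} :
    p ∈ polyGrading N k ↔ ∀ m, p.coeff m ≠ 0 → (m.degree : ℤ) = k := by
  rw [polyGrading]
  split_ifs with hk
  · change p.IsHomogeneous k.toNat ↔ _
    constructor
    · intro h m hm
      by_contra hmk
      exact hm (h.coeff_eq_zero (by omega))
    · intro h m hm
      have := h m hm
      have hw : Finsupp.weight (1 : Fin N → ℕ) m = m.degree := by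
        rw [Finsupp.degree_eq_weight_one]
        rfl
      omega
  · rw [AddSubgroup.mem_bot]
    constructor
    · rintro rfl m hm
      simp at hm
    · intro h
      ext m
      by_contra hm
      exact hk (h m hm ▸ Int.natCast_nonneg _)

/-- The homogeneous component of degree `k` of a polynomial. -/
def polyComp (k : ℤ) : Poly N →+ Poly N :=
  if 0 ≤ k then (MvPolynomial.homogeneousComponent k.toNat).toAddMonoidHom else 0

theorem coeff_polyComp (k : ℤ) (p : Poly N) (m : Fin N →₀ ℕ) :
    (polyComp k p).coeff m = if (m.degree : ℤ) = k then p.coeff m else 0 := by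
  rw [polyComp]
  split_ifs with hk hm hm
  · exact (MvPolynomial.coeff_homogeneousComponent _ _ _).trans (if_pos (by omega))
  · exact (MvPolynomial.coeff_homogeneousComponent _ _ _).trans (if_neg (by omega))
  · omega
  · simp

theorem polyComp_mem (k : ℤ) (p : Poly N) : polyComp k p ∈ polyGrading N k := by
  rw [mem_polyGrading_iff]
  intro m hm
  rw [coeff_polyComp] at hm
  by_contra h
  exact hm (if_neg h)

theorem polyComp_of_mem {k : ℤ} {p : Poly N} (hp : p ∈ polyGrading N k) (l : ℤ) :
    polyComp l p = if k = l then p else 0 := by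
  ext m
  rw [coeff_polyComp]
  by_cases hm : p.coeff m = 0
  · split_ifs <;> simp [hm]
  · rw [mem_polyGrading_iff.mp hp m hm]
    split_ifs <;> simp

/-- The degrees of the nonzero homogeneous components of a polynomial. -/
def polyDegrees (p : Poly N) : Finset ℤ := p.support.image fun m => (m.degree : ℤ)

theorem polyComp_eq_zero {k : ℤ} {p : Poly N} (hk : k ∉ polyDegrees p) : polyComp k p = 0 := by
  ext m
  rw [coeff_polyComp, MvPolynomial.coeff_zero]
  split_ifs with hm
  · by_contra h
    exact hk (Finset.mem_image.mpr ⟨m, MvPolynomial.mem_support_iff.mpr h, hm⟩)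
  · rfl

theorem sum_polyComp {p : Poly N} {s : Finset ℤ} (hs : ∀ k ∉ s, polyComp k p = 0) :
    ∑ k ∈ s, polyComp k p = p := by
  ext m
  rw [MvPolynomial.coeff_sum]
  simp only [coeff_polyComp, Finset.sum_ite_eq]
  split_ifs with hm
  · rfl
  · have := congrArg (MvPolynomial.coeff m) (hs _ hm)
    rw [coeff_polyComp, if_pos rfl] at this
    exact this.symm

theorem mul_mem_polyGrading {a b : ℤ} {p q : Poly N} (hp : p ∈ polyGrading N a)
    (hq : q ∈ polyGrading N b) : p * q ∈ polyGrading N (a + b) := by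
  classical
  rw [mem_polyGrading_iff] at *
  intro m hm
  rw [MvPolynomial.coeff_mul] at hm
  obtain ⟨x, hx, hne⟩ := Finset.exists_ne_zero_of_sum_ne_zero hm
  rw [← Finset.HasAntidiagonal.mem_antidiagonal.mp hx, map_add, Nat.cast_add, hp _
      (left_ne_zero_of_mul hne),
    hq _ (right_ne_zero_of_mul hne)]

theorem polyComp_mul_of_mem {a : ℤ} {p : Poly N} (hp : p ∈ polyGrading N a) (b : ℤ) (q : Poly N) :
    polyComp (a + b) (p * q) = p * polyComp b q := by
  conv_lhs => rw [← sum_polyComp (p := q) fun k hk => polyComp_eq_zero hk]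
  conv_rhs => rw [← sum_polyComp (p := q) fun k hk => polyComp_eq_zero hk]
  rw [Finset.mul_sum, map_sum, map_sum, Finset.mul_sum]
  refine Finset.sum_congr rfl fun k _ => ?_
  rw [polyComp_of_mem (mul_mem_polyGrading hp (polyComp_mem k q)),
    polyComp_of_mem (polyComp_mem k q)]
  simp only [add_right_inj]
  split_ifs <;> simp

/-- The scalar matrix `t`. -/
def scalarGL (N : ℕ) (t : ℂˣ) : GL (Fin N) ℂ := torus fun _ => t

theorem scalarGL_inv (t : ℂˣ) : (scalarGL N t)⁻¹ = scalarGL N t⁻¹ := torus_inv _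

theorem polyAct_scalarGL (t : ℂˣ) {a : ℤ} {p : Poly N} (hp : p ∈ polyGrading N a) :
    polyAct N (scalarGL N t) p = MvPolynomial.C ((t ^ a : ℂˣ) : ℂ) * p := by
  have hX : ∀ m : Fin N →₀ ℕ, ∀ c : ℂ, polyAct N (scalarGL N t) (MvPolynomial.monomial m c) =
      MvPolynomial.C ((t : ℂ) ^ m.degree) * MvPolynomial.monomial m c := by
    intro m c
    rw [MvPolynomial.monomial_eq, map_mul, Finsupp.prod_fintype _ _ fun i => pow_zero _, map_prod,
      ← MvPolynomial.algebraMap_eq, AlgEquiv.commutes]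
    simp only [map_pow, scalarGL, polyAct_torus_X, mul_pow, Finset.prod_mul_distrib]
    rw [Finset.prod_pow_eq_pow_sum, Finsupp.degree_eq_sum, MvPolynomial.algebraMap_eq]
    ring
  rw [mem_polyGrading_iff] at hp
  conv_lhs => rw [← MvPolynomial.support_sum_monomial_coeff p]
  conv_rhs => rw [← MvPolynomial.support_sum_monomial_coeff p]
  rw [map_sum, Finset.mul_sum]
  refine Finset.sum_congr rfl fun m hm => ?_
  rw [hX, ← hp m (MvPolynomial.mem_support_iff.mp hm), zpow_natCast, Units.val_pow_eq_pow_val]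

section GradedModule

variable {M : ModuleCat.{0} (Poly N)} {𝓜 : ℤ → AddSubgroup M}

theorem IsGradedModule.induction (h : IsGradedModule M 𝓜) {P : M → Prop}
    (mem : ∀ a, ∀ x ∈ 𝓜 a, P x) (add : ∀ x y, P x → P y → P (x + y)) (x : M) : P x := by
  obtain ⟨y, rfl⟩ := h.isInternal.2 x
  induction y using DirectSum.induction_on with
  | zero => exact mem 0 _ (by rw [map_zero]; exact zero_mem _)
  | of a x => exact mem a _ (by rw [DirectSum.coeAddMonoidHom_of]; exact x.2)
  | add x y hx hy => exact map_add (DirectSum.coeAddMonoidHom 𝓜) x y ▸ add _ _ hx hy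

theorem poly_induction {P : Poly N → Prop} (mem : ∀ a, ∀ p ∈ polyGrading N a, P p)
    (add : ∀ p q, P p → P q → P (p + q)) (p : Poly N) : P p := by
  rw [← sum_polyComp (p := p) fun k hk => polyComp_eq_zero hk]
  exact Finset.sum_induction _ P add (mem 0 0 (zero_mem _)) fun k _ => mem k _ (polyComp_mem k p)

/-- The additive map that multiplies the homogeneous elements of degree `a` of a graded module by
`c a`. -/
def IsGradedModule.scale (h : IsGradedModule M 𝓜) (c : ℤ → ℂ) : M →+ M :=
  (DirectSum.toAddMonoid fun a => (DistribSMul.toAddMonoidHom M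
    (MvPolynomial.C (c a) : Poly N)).comp (𝓜 a).subtype).comp
    (AddEquiv.ofBijective (DirectSum.coeAddMonoidHom 𝓜) h.isInternal).symm.toAddMonoidHom

theorem IsGradedModule.scale_of_mem (h : IsGradedModule M 𝓜) (c : ℤ → ℂ) {a : ℤ} {x : M}
    (hx : x ∈ 𝓜 a) : h.scale c x = (MvPolynomial.C (c a) : Poly N) • x := by
  have : (AddEquiv.ofBijective (DirectSum.coeAddMonoidHom 𝓜) h.isInternal).symm x =
      DirectSum.of (fun a => 𝓜 a) a ⟨x, hx⟩ := by
    rw [AddEquiv.symm_apply_eq]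
    exact (DirectSum.coeAddMonoidHom_of 𝓜 a ⟨x, hx⟩).symm
  change DirectSum.toAddMonoid _
    ((AddEquiv.ofBijective (DirectSum.coeAddMonoidHom 𝓜) h.isInternal).symm x) = _
  rw [this, DirectSum.toAddMonoid_of]
  rfl

theorem IsGradedModule.scale_smul (h : IsGradedModule M 𝓜) (t : ℂˣ) (s : Poly N) (x : M) :
    h.scale (fun a => ((t ^ (-a) : ℂˣ) : ℂ)) (s • x) =
      polyAct N (scalarGL N t)⁻¹ s • h.scale (fun a => ((t ^ (-a) : ℂˣ) : ℂ)) x := by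
  refine poly_induction (P := fun s => ∀ x, h.scale (fun a => ((t ^ (-a) : ℂˣ) : ℂ)) (s • x) =
      polyAct N (scalarGL N t)⁻¹ s • h.scale (fun a => ((t ^ (-a) : ℂˣ) : ℂ)) x) ?_ ?_ s x
  · intro a s hs x
    refine h.induction (P := fun x => h.scale (fun a => ((t ^ (-a) : ℂˣ) : ℂ)) (s • x) =
      polyAct N (scalarGL N t)⁻¹ s • h.scale (fun a => ((t ^ (-a) : ℂˣ) : ℂ)) x) ?_ ?_ x
    · intro b x hx
      rw [h.scale_of_mem _ hx, h.scale_of_mem _ (h.smul_mem a b s x hs hx), scalarGL_inv,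
        polyAct_scalarGL _ hs, smul_smul, smul_smul, inv_zpow', mul_right_comm, ← map_mul,
        ← Units.val_mul, ← zpow_add, neg_add]
    · intro x y hx hy
      rw [smul_add, map_add, map_add, smul_add, hx, hy]
  · intro p q hp hq x
    rw [add_smul, map_add, map_add, add_smul, hp, hq]

end GradedModule

theorem extMk_smul {M : ModuleCat.{0} (Poly N)} (P : ProjectiveResolution M) {j : ℕ} (s : Poly N)
    (f : P.complex.X j ⟶ freeModule N) (hf : P.complex.d (j + 1) j ≫ f = 0) :
    P.extMk (s • f) (j + 1) rfl (by rw [Linear.comp_smul, hf, smul_zero]) =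
      s • P.extMk f (j + 1) rfl hf := by
  rw [Ext.smul_eq_comp_mk₀, ProjectiveResolution.extMk_comp_mk₀]
  congr 1

/-- The scalar matrix `t` acts by `t^k` on the homogeneous classes of degree `k`: it acts by `t^a`
on the elements of degree `a` of each term of a graded resolution. -/
theorem extAct_scalarGL {d j : ℕ} {k : ℤ} {x : ExtPow N d j} (hx : x ∈ extPowGrading N d j k)
    (t : ℂˣ) : extAct N d j (scalarGL N t) x = ((t ^ k : ℂˣ) : ℂ) • x := by
  obtain ⟨P, 𝓟, hP, hd, hε, f, hf, hfk, rfl⟩ := hx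
  rw [extAct_eq_genAct, complex_smul_eq, ← extMk_smul]
  refine genAct_extMk _ P (fun n => (hP n).scale fun a => ((t ^ (-a) : ℂˣ) : ℂ))
    (fun n => (hP n).scale_smul t) ?_ ?_ f _ hf _ ?_
  · intro i l x
    by_cases hil : l + 1 = i
    · subst hil
      refine (hP (l + 1)).induction (P := fun x => (hP l).scale (fun a => ((t ^ (-a) : ℂˣ) : ℂ))
        ((P.complex.d (l + 1) l).hom x) = (P.complex.d (l + 1) l).hom
          ((hP (l + 1)).scale (fun a => ((t ^ (-a) : ℂˣ) : ℂ)) x)) ?_ ?_ x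
      · intro a x hx
        have := hd l a x hx
        rw [add_zero] at this
        rw [(hP l).scale_of_mem _ this, (hP (l + 1)).scale_of_mem _ hx, map_smul]
      · intro x y hx hy
        rw [map_add, map_add, map_add, map_add, hx, hy]
    · rw [P.complex.shape i l hil]
      exact map_zero _
  · refine (hP 0).induction ?_ ?_
    · intro a x hx
      have := hε a x hx
      rw [add_zero] at this
      obtain ⟨p, hp, hpx⟩ := this
      have hp' : P.augmentation.hom x = Ideal.Quotient.mk _ p := hpx.symm
      rw [(hP 0).scale_of_mem _ hx, map_smul, hp']
      change Ideal.Quotient.mk _ (polyAct N (scalarGL N t)⁻¹ p) = Ideal.Quotient.mk _ (_ * p)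
      rw [scalarGL_inv, polyAct_scalarGL _ hp, inv_zpow']
    · intro x y hx hy
      rw [map_add, map_add, map_add, map_add, hx, hy]
  · have key : ∀ x, polyAct N (scalarGL N t)
        (f.hom ((hP j).scale (fun a => ((t ^ (-a) : ℂˣ) : ℂ)) x)) =
          (MvPolynomial.C ((t ^ k : ℂˣ) : ℂ) : Poly N) * f.hom x := by
      refine (hP j).induction ?_ ?_
      · intro a x hx
        have h1 : f.hom ((hP j).scale (fun a => ((t ^ (-a) : ℂˣ) : ℂ)) x) =
            (MvPolynomial.C ((t ^ (-a) : ℂˣ) : ℂ) : Poly N) * f.hom x := by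
          rw [(hP j).scale_of_mem _ hx]
          exact map_smul f.hom _ x
        rw [h1, map_mul, polyAct_scalarGL t (hfk a x hx), ← MvPolynomial.algebraMap_eq,
          AlgEquiv.commutes, ← mul_assoc, ← map_mul, ← Units.val_mul, ← zpow_add,
          neg_add_cancel_left]
      · intro x y hx hy
        rw [map_add, map_add, map_add, map_add, hx, hy, mul_add]
    exact key

end PowerExt

end

/-! ### Graded free resolutions -/

noncomputable section

namespace PowerExt

open Abelian

variable {N r : ℕ}

/-- The grading of the free module `S^r` for which the `j`-th basis vector has degree `δ j`. -/
def freeGrading (δ : Fin r → ℤ) (a : ℤ) : AddSubgroup (Fin r → Poly N) :=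
  AddSubgroup.pi Set.univ fun j => polyGrading N (a - δ j)

theorem mem_freeGrading {δ : Fin r → ℤ} {a : ℤ} {f : Fin r → Poly N} :
    f ∈ freeGrading δ a ↔ ∀ j, f j ∈ polyGrading N (a - δ j) := by
  simp [freeGrading, AddSubgroup.mem_pi]

/-- The homogeneous component of degree `a` of an element of a graded free module. -/
def freeComp (δ : Fin r → ℤ) (a : ℤ) : (Fin r → Poly N) →+ (Fin r → Poly N) :=
  AddMonoidHom.mk' (fun f j => polyComp (a - δ j) (f j)) fun f g =>
    funext fun j => map_add _ (f j) (g j)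

theorem freeComp_apply (δ : Fin r → ℤ) (a : ℤ) (f : Fin r → Poly N) (j : Fin r) :
    freeComp δ a f j = polyComp (a - δ j) (f j) := rfl

theorem freeComp_mem (δ : Fin r → ℤ) (a : ℤ) (f : Fin r → Poly N) :
    freeComp δ a f ∈ freeGrading δ a :=
  mem_freeGrading.mpr fun _ => polyComp_mem _ _

theorem freeComp_of_mem {δ : Fin r → ℤ} {a : ℤ} {f : Fin r → Poly N} (hf : f ∈ freeGrading δ a)
    (b : ℤ) : freeComp δ b f = if a = b then f else 0 := by
  funext j
  rw [freeComp_apply, polyComp_of_mem (mem_freeGrading.mp hf j)]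
  simp only [sub_left_inj]
  split_ifs <;> rfl

/-- Only finitely many homogeneous components of an element of a graded free module are nonzero. -/
theorem exists_freeComp_eq_zero (δ : Fin r → ℤ) (f : Fin r → Poly N) :
    ∃ s : Finset ℤ, ∀ a ∉ s, freeComp δ a f = 0 := by
  refine ⟨Finset.univ.biUnion fun j => (polyDegrees (f j)).image (· + δ j), fun a ha => ?_⟩
  funext j
  refine polyComp_eq_zero fun h => ha ?_
  exact Finset.mem_biUnion.mpr ⟨j, Finset.mem_univ j, Finset.mem_image.mpr ⟨_, h, by ring⟩⟩

theorem sum_freeComp {δ : Fin r → ℤ} {f : Fin r → Poly N} {s : Finset ℤ}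
    (hs : ∀ a ∉ s, freeComp δ a f = 0) : ∑ a ∈ s, freeComp δ a f = f := by
  funext j
  rw [Finset.sum_apply]
  simp only [freeComp_apply]
  have := sum_polyComp (p := f j) (s := s.image (· - δ j)) fun k hk => by
    have h := congrFun (hs (k + δ j) fun h => hk (Finset.mem_image.mpr ⟨_, h, by ring⟩)) j
    rwa [freeComp_apply, add_sub_cancel_right] at h
  rwa [Finset.sum_image fun _ _ _ _ h => sub_left_injective h] at this

/-- A graded free `S`-module. -/
abbrev freeMod (N r : ℕ) : ModuleCat.{0} (Poly N) := ModuleCat.of (Poly N) (Fin r → Poly N)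

theorem freeGrading_isGradedModule (δ : Fin r → ℤ) :
    IsGradedModule (freeMod N r) (freeGrading δ) where
  isInternal := by
    have h : ∀ (y : ⨁ a, freeGrading (N := N) δ a) (b : ℤ),
        freeComp δ b (DirectSum.coeAddMonoidHom (freeGrading δ) y) = y b := by
      intro y b
      induction y using DirectSum.induction_on with
      | zero => simp
      | of a x =>
        rw [DirectSum.coeAddMonoidHom_of, freeComp_of_mem x.2]
        split_ifs with hab
        · subst hab
          rw [DirectSum.of_eq_same]
        · rw [DirectSum.of_eq_of_ne _ _ _ (Ne.symm hab)]
          rfl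
      | add x y hx hy =>
        rw [map_add, map_add, hx, hy]
        rfl
    constructor
    · intro x y hxy
      refine DFinsupp.ext fun b => Subtype.ext ?_
      rw [← h x b, ← h y b]
      exact congrArg _ hxy
    · intro f
      obtain ⟨s, hs⟩ := exists_freeComp_eq_zero δ f
      refine ⟨∑ a ∈ s, DirectSum.of (fun a => freeGrading δ a) a ⟨_, freeComp_mem δ a f⟩, ?_⟩
      rw [map_sum]
      refine Eq.trans (Finset.sum_congr rfl fun a _ => ?_) (sum_freeComp hs)
      exact DirectSum.coeAddMonoidHom_of (freeGrading δ) a ⟨_, freeComp_mem δ a f⟩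
  smul_mem a k s x hs hx := by
    refine mem_freeGrading.mpr fun j => ?_
    have := mul_mem_polyGrading hs (mem_freeGrading.mp hx j)
    rwa [← add_sub_assoc] at this

variable (N) in
/-- A homogeneous submodule of a graded free module of finite rank. -/
structure SyzygyData where
  /-- The rank of the free module. -/
  rank : ℕ
  /-- The degrees of the basis vectors. -/
  shift : Fin rank → ℤ
  /-- The submodule. -/
  rel : Submodule (Poly N) (Fin rank → Poly N)
  freeComp_mem_rel : ∀ a, ∀ f ∈ rel, freeComp shift a f ∈ rel

namespace SyzygyData

variable (D : SyzygyData N)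

theorem exists_generators : ∃ (r : ℕ) (δ : Fin r → ℤ) (x : Fin r → Fin D.rank → Poly N),
    (∀ j, x j ∈ freeGrading D.shift (δ j)) ∧ Submodule.span (Poly N) (Set.range x) = D.rel := by
  obtain ⟨n, f, hf⟩ := Submodule.fg_iff_exists_fin_generating_family.mp
    (IsNoetherian.noetherian D.rel)
  choose s hs using fun i => exists_freeComp_eq_zero D.shift (f i)
  let e := Fintype.equivFin (Σ i, s i)
  refine ⟨Fintype.card (Σ i, s i), fun j => (e.symm j).2,
    fun j => freeComp D.shift (e.symm j).2 (f (e.symm j).1), fun j => freeComp_mem _ _ _,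
    le_antisymm ?_ ?_⟩
  · rw [Submodule.span_le]
    rintro _ ⟨j, rfl⟩
    refine D.freeComp_mem_rel _ _ ?_
    rw [← hf]
    exact Submodule.subset_span ⟨_, rfl⟩
  · rw [← hf, Submodule.span_le]
    rintro _ ⟨i, rfl⟩
    rw [SetLike.mem_coe, ← sum_freeComp (hs i)]
    refine Submodule.sum_mem _ fun a ha => Submodule.subset_span ⟨e ⟨i, a, ha⟩, ?_⟩
    exact congrArg (fun z : Σ i, s i => freeComp D.shift z.2 (f z.1)) (e.symm_apply_apply _)

/-- The number of homogeneous generators of the submodule. -/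
def genRank : ℕ := D.exists_generators.choose

/-- The degrees of the homogeneous generators of the submodule. -/
def genShift : Fin D.genRank → ℤ := D.exists_generators.choose_spec.choose

/-- The homogeneous generators of the submodule. -/
def gen : Fin D.genRank → Fin D.rank → Poly N :=
  D.exists_generators.choose_spec.choose_spec.choose

theorem gen_mem (j : Fin D.genRank) : D.gen j ∈ freeGrading D.shift (D.genShift j) :=
  D.exists_generators.choose_spec.choose_spec.choose_spec.1 j

theorem span_gen : Submodule.span (Poly N) (Set.range D.gen) = D.rel :=
  D.exists_generators.choose_spec.choose_spec.choose_spec.2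

/-- The map from a free module to the submodule given by the homogeneous generators. -/
def cover : (Fin D.genRank → Poly N) →ₗ[Poly N] (Fin D.rank → Poly N) :=
  Fintype.linearCombination (Poly N) D.gen

theorem range_cover : LinearMap.range D.cover = D.rel :=
  (Fintype.range_linearCombination (Poly N) D.gen).trans D.span_gen

theorem cover_apply (c : Fin D.genRank → Poly N) (k : Fin D.rank) :
    D.cover c k = ∑ j, D.gen j k * c j := by
  rw [cover, Fintype.linearCombination_apply, Finset.sum_apply]
  exact Finset.sum_congr rfl fun j _ => mul_comm _ _

theorem freeComp_cover (a : ℤ) (c : Fin D.genRank → Poly N) :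
    freeComp D.shift a (D.cover c) = D.cover (freeComp D.genShift a c) := by
  funext k
  rw [freeComp_apply, cover_apply, cover_apply, map_sum]
  refine Finset.sum_congr rfl fun j _ => ?_
  rw [freeComp_apply, ← polyComp_mul_of_mem (mem_freeGrading.mp (D.gen_mem j) k),
    show D.genShift j - D.shift k + (a - D.genShift j) = a - D.shift k by ring]

theorem cover_mem {a : ℤ} {c : Fin D.genRank → Poly N} (hc : c ∈ freeGrading D.genShift a) :
    D.cover c ∈ freeGrading D.shift a := by
  have := D.freeComp_cover a c
  rw [freeComp_of_mem hc, if_pos rfl] at this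
  rw [← this]
  exact freeComp_mem _ _ _

/-- The module of relations between the homogeneous generators. -/
def next : SyzygyData N where
  rank := D.genRank
  shift := D.genShift
  rel := LinearMap.ker D.cover
  freeComp_mem_rel a f hf := by
    rw [LinearMap.mem_ker] at hf ⊢
    rw [← freeComp_cover, hf, map_zero]

/-- The successive modules of syzygies. -/
def syzygy : ℕ → SyzygyData N
  | 0 => D
  | n + 1 => (syzygy n).next

/-- The terms of the free resolution given by the successive modules of syzygies. -/
abbrev obj (n : ℕ) : ModuleCat.{0} (Poly N) := freeMod N (D.syzygy n).rank

/-- The differentials of the free resolution given by the successive modules of syzygies. -/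
def diff (n : ℕ) : D.obj (n + 1) ⟶ D.obj n := ModuleCat.ofHom (D.syzygy n).cover

theorem diff_comp_diff (n : ℕ) : D.diff (n + 1) ≫ D.diff n = 0 := by
  refine ModuleCat.hom_ext (LinearMap.ext fun x => ?_)
  have : (D.syzygy (n + 1)).cover x ∈ (D.syzygy (n + 1)).rel := by
    rw [← range_cover]
    exact ⟨x, rfl⟩
  exact this

theorem diff_exact (n : ℕ) : (ShortComplex.mk _ _ (D.diff_comp_diff n)).Exact := by
  rw [ShortComplex.moduleCat_exact_iff]
  intro x hx
  have h : x ∈ (D.syzygy (n + 1)).rel := hx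
  rw [← range_cover] at h
  exact h

/-- The complex of the free resolution given by the successive modules of syzygies. -/
def complex : ChainComplex (ModuleCat.{0} (Poly N)) ℕ :=
  ChainComplex.of D.obj D.diff D.diff_comp_diff

theorem complex_d (n : ℕ) : D.complex.d (n + 1) n = D.diff n := by
  exact ChainComplex.of_d _ _ _

theorem complex_exactAt (n : ℕ) : D.complex.ExactAt (n + 1) := by
  rw [HomologicalComplex.exactAt_iff' _ (n + 1 + 1) (n + 1) n (by simp) (by simp)]
  have h := D.diff_exact n
  have e : D.complex.sc' (n + 1 + 1) (n + 1) n = ShortComplex.mk _ _ (D.diff_comp_diff n) := by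
    simp only [HomologicalComplex.sc', HomologicalComplex.shortComplexFunctor']
    congr 1
    · exact D.complex_d (n + 1)
    · exact D.complex_d n
  exact e ▸ h

section Resolution

variable {D} {M : ModuleCat.{0} (Poly N)} (ε : freeMod N D.rank ⟶ M)
  (hε : Function.Surjective ε.hom) (hker : ∀ x, ε.hom x = 0 ↔ x ∈ D.rel)
include hker

theorem diff_comp_eq_zero : D.diff 0 ≫ ε = 0 := by
  refine ModuleCat.hom_ext (LinearMap.ext fun x => (hker _).mpr ?_)
  rw [← range_cover]
  exact ⟨x, rfl⟩

theorem augmentation_exact : (ShortComplex.mk _ _ (diff_comp_eq_zero ε hker)).Exact := by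
  rw [ShortComplex.moduleCat_exact_iff]
  intro x hx
  have h : x ∈ D.rel := (hker x).mp hx
  rw [← range_cover] at h
  exact h

/-- The augmentation of the complex of the free resolution. -/
def complexAugmentation : D.complex ⟶ (ChainComplex.single₀ (ModuleCat.{0} (Poly N))).obj M :=
  (ChainComplex.toSingle₀Equiv D.complex M).symm ⟨ε, by
    rw [D.complex_d 0]
    exact diff_comp_eq_zero ε hker⟩

theorem complexAugmentation_f_zero : (complexAugmentation ε hker).f 0 = ε :=
  ChainComplex.toSingle₀Equiv_symm_apply_f_zero (C := D.complex) ε _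

include hε

/-- The free resolution of a quotient of a graded free module by a homogeneous submodule. -/
def resolution : ProjectiveResolution M where
  complex := D.complex
  π := complexAugmentation ε hker
  projective n := inferInstanceAs (Projective (D.obj n))
  quasiIso := ⟨fun n => by
    have : Epi ε := (ModuleCat.epi_iff_surjective _).mpr hε
    cases n
    · rw [ChainComplex.quasiIsoAt₀_iff, ShortComplex.quasiIso_iff_of_zeros']
      · refine (ShortComplex.exact_and_epi_g_iff_of_iso ?_).2
          ⟨augmentation_exact ε hker, this⟩
        exact ShortComplex.isoMk (Iso.refl _) (Iso.refl _) (Iso.refl _)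
          ((Category.id_comp _).trans ((D.complex_d 0).symm.trans (Category.comp_id _).symm))
          ((Category.id_comp _).trans ((complexAugmentation_f_zero ε hker).symm.trans
            (Category.comp_id _).symm))
      all_goals rfl
    · rw [quasiIsoAt_iff_exactAt']
      · apply complex_exactAt
      · apply ChainComplex.exactAt_succ_single_obj⟩

end Resolution

end SyzygyData

end PowerExt

end

/-! ### Homogeneous decomposition of classes -/

noncomputable section

namespace PowerExt

open Abelian

variable {N : ℕ}

section

variable {r : ℕ} (δ : Fin r → ℤ) (l : ℤ) (φ : (Fin r → Poly N) →ₗ[Poly N] Poly N)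

/-- The homogeneous component of degree `l` of a linear form on a graded free module. -/
def formComp : (Fin r → Poly N) →ₗ[Poly N] Poly N :=
  Fintype.linearCombination (Poly N) fun i => polyComp (l + δ i) (φ (Pi.single i 1))

theorem formComp_of_mem {a : ℤ} {u : Fin r → Poly N} (hu : u ∈ freeGrading δ a) :
    formComp δ l φ u = polyComp (a + l) (φ u) := by
  rw [formComp, Fintype.linearCombination_apply, LinearMap.pi_apply_eq_sum_univ φ u, map_sum]
  refine Finset.sum_congr rfl fun i _ => ?_
  rw [show a + l = a - δ i + (l + δ i) by ring, smul_eq_mul, smul_eq_mul,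
    polyComp_mul_of_mem (mem_freeGrading.mp hu i)]
  congr 3
  funext j
  rw [Pi.single_apply]
  simp only [eq_comm]

theorem exists_sum_formComp :
    ∃ s : Finset ℤ, ∑ l ∈ s, formComp δ l φ = φ ∧ ∀ l ∉ s, formComp δ l φ = 0 := by
  let s := Finset.univ.biUnion fun i => (polyDegrees (φ (Pi.single i 1))).image (· - δ i)
  have hs : ∀ l ∉ s, ∀ i, polyComp (l + δ i) (φ (Pi.single i 1)) = 0 := fun l hl i =>
    polyComp_eq_zero fun h => hl (Finset.mem_biUnion.mpr
      ⟨i, Finset.mem_univ i, Finset.mem_image.mpr ⟨_, h, by ring⟩⟩)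
  refine ⟨s, (Pi.basisFun (Poly N) (Fin r)).ext fun i => ?_, fun l hl => ?_⟩
  · rw [LinearMap.sum_apply, Pi.basisFun_apply]
    have h1 : ∀ l, formComp δ l φ (Pi.single i 1) = polyComp (l + δ i) (φ (Pi.single i 1)) := by
      intro l
      rw [formComp, Fintype.linearCombination_apply_single, one_smul]
    simp only [h1]
    have := sum_polyComp (p := φ (Pi.single i 1)) (s := s.image (· + δ i)) fun k hk => by
      have h := hs (k - δ i) (fun h => hk (Finset.mem_image.mpr ⟨_, h, by ring⟩)) i
      rwa [sub_add_cancel] at h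
    rwa [Finset.sum_image fun _ _ _ _ h => add_left_injective _ h] at this
  · refine (Pi.basisFun (Poly N) (Fin r)).ext fun i => ?_
    rw [formComp, Pi.basisFun_apply, Fintype.linearCombination_apply_single, hs l hl i, smul_zero]
    rfl

end

theorem formComp_comp_cover (D : SyzygyData N) (l : ℤ)
    (φ : (Fin D.rank → Poly N) →ₗ[Poly N] Poly N) (hφ : φ ∘ₗ D.cover = 0) :
    formComp D.shift l φ ∘ₗ D.cover = 0 := by
  refine LinearMap.ext ((freeGrading_isGradedModule D.genShift).induction
    (P := fun x => (formComp D.shift l φ ∘ₗ D.cover) x =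
      (0 : (Fin D.genRank → Poly N) →ₗ[Poly N] Poly N) x) ?_ ?_)
  · intro a x hx
    rw [LinearMap.comp_apply, formComp_of_mem _ _ _ (D.cover_mem hx), ← LinearMap.comp_apply, hφ]
    exact map_zero _
  · intro x y hx hy
    exact (map_add (formComp D.shift l φ ∘ₗ D.cover) x y).trans ((congrArg₂ _ hx hy).trans
      (map_add (0 : (Fin D.genRank → Poly N) →ₗ[Poly N] Poly N) x y).symm)

theorem extMk_sum {M : ModuleCat.{0} (Poly N)} (P : ProjectiveResolution M) {j : ℕ} {κ : Type*}
    (s : Finset κ) (f : κ → (P.complex.X j ⟶ freeModule N))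
    (hf : ∀ i, P.complex.d (j + 1) j ≫ f i = 0) (g : P.complex.X j ⟶ freeModule N)
    (hg : P.complex.d (j + 1) j ≫ g = 0) (h : ∑ i ∈ s, f i = g) :
    P.extMk g (j + 1) rfl hg = ∑ i ∈ s, P.extMk (f i) (j + 1) rfl (hf i) := by
  classical
  induction s using Finset.induction_on generalizing g with
  | empty =>
    rw [Finset.sum_empty] at h ⊢
    subst h
    exact P.extMk_zero _ _
  | insert i s hi ih =>
    rw [Finset.sum_insert hi] at h ⊢
    subst h
    have h0 : P.complex.d (j + 1) j ≫ ∑ i ∈ s, f i = 0 := by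
      rw [Preadditive.comp_sum]
      exact Finset.sum_eq_zero fun i _ => hf i
    rw [← ih _ h0 rfl, P.add_extMk]

variable (N) in
/-- The homogeneous ideal `𝔪^d`, as a submodule of the free module of rank one. -/
def powData (d : ℕ) : SyzygyData N where
  rank := 1
  shift := 0
  rel := Submodule.comap
    (LinearMap.proj (R := Poly N) (φ := fun _ : Fin 1 => Poly N) (0 : Fin 1)) (maxIdeal N ^ d)
  freeComp_mem_rel a f hf := by
    have hf' : f (0 : Fin 1) ∈ maxIdeal N ^ d := hf
    change polyComp _ (f (0 : Fin 1)) ∈ maxIdeal N ^ d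
    rw [mem_maxIdeal_pow_iff] at hf' ⊢
    intro m hm
    rw [coeff_polyComp, hf' m hm, ite_self]

variable (N) in
/-- The projection from the free module of rank one to `S / 𝔪^d`. -/
def powAugmentation (d : ℕ) : freeMod N (powData N d).rank ⟶ quotModule N d :=
  ModuleCat.ofHom ((maxIdeal N ^ d).mkQ ∘ₗ LinearMap.proj (0 : Fin 1))

theorem powAugmentation_surjective (d : ℕ) : Function.Surjective (powAugmentation N d).hom := by
  intro x
  obtain ⟨p, rfl⟩ := Ideal.Quotient.mk_surjective x
  exact ⟨fun _ => p, rfl⟩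

theorem powAugmentation_eq_zero_iff (d : ℕ) (x : freeMod N (powData N d).rank) :
    (powAugmentation N d).hom x = 0 ↔ x ∈ (powData N d).rel :=
  Ideal.Quotient.eq_zero_iff_mem (I := maxIdeal N ^ d) (a := x (0 : Fin 1))

variable (N) in
/-- A graded free resolution of `S / 𝔪^d`. -/
def powResolution (d : ℕ) : ProjectiveResolution (quotModule N d) :=
  SyzygyData.resolution (powAugmentation N d) (powAugmentation_surjective d)
    (powAugmentation_eq_zero_iff d)

theorem powResolution_d (d n : ℕ) :
    (powResolution N d).complex.d (n + 1) n = (powData N d).diff n :=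
  (powData N d).complex_d n

theorem powResolution_π (d : ℕ) : (powResolution N d).π.f 0 = powAugmentation N d :=
  SyzygyData.complexAugmentation_f_zero _ (powAugmentation_eq_zero_iff d)

theorem extMk_mem_extPowGrading {d j : ℕ} {l : ℤ}
    (f : (powResolution N d).complex.X j ⟶ freeModule N)
    (hf : (powResolution N d).complex.d (j + 1) j ≫ f = 0)
    (hfl : ∀ (a : ℤ) (x : Fin ((powData N d).syzygy j).rank → Poly N),
      x ∈ freeGrading ((powData N d).syzygy j).shift a → f.hom x ∈ polyGrading N (a + l)) :
    (powResolution N d).extMk f (j + 1) rfl hf ∈ extPowGrading N d j l := by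
  refine ⟨powResolution N d, fun n => freeGrading ((powData N d).syzygy n).shift,
    fun n => freeGrading_isGradedModule _, ?_, ?_, f, hf, hfl, rfl⟩
  · intro n a x hx
    rw [powResolution_d, add_zero]
    exact ((powData N d).syzygy n).cover_mem hx
  · intro a x hx
    rw [powResolution_π, add_zero]
    refine ⟨x (0 : Fin 1), ?_, rfl⟩
    have : x (0 : Fin 1) ∈ polyGrading N (a - 0) := mem_freeGrading.mp hx (0 : Fin 1)
    rwa [sub_zero] at this

/-- Every class is a finite sum of homogeneous classes: a cocycle on a graded free resolution of
finite rank is the sum of its homogeneous components, which are cocycles. -/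
theorem exists_eq_sum_homogeneous {d j : ℕ} (x : ExtPow N d j) :
    ∃ (s : Finset ℤ) (y : ℤ → ExtPow N d j),
      (∀ l, y l ∈ extPowGrading N d j l) ∧ (∀ l ∉ s, y l = 0) ∧ x = ∑ l ∈ s, y l := by
  obtain ⟨f, hf, rfl⟩ := (powResolution N d).extMk_surjective x (j + 1) rfl
  let D := (powData N d).syzygy j
  let φ : (Fin D.rank → Poly N) →ₗ[Poly N] Poly N := f.hom
  have hφ : φ ∘ₗ D.cover = 0 := by
    rw [powResolution_d] at hf
    exact congrArg ModuleCat.Hom.hom hf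
  obtain ⟨s, hs, hs0⟩ := exists_sum_formComp D.shift φ
  let F : ℤ → ((powResolution N d).complex.X j ⟶ freeModule N) :=
    fun l => ModuleCat.ofHom (X := Fin D.rank → Poly N) (formComp D.shift l φ)
  have hF : ∀ l, (powResolution N d).complex.d (j + 1) j ≫ F l = 0 := by
    intro l
    rw [powResolution_d]
    exact ModuleCat.hom_ext (formComp_comp_cover D l φ hφ)
  refine ⟨s, fun l => (powResolution N d).extMk (F l) (j + 1) rfl (hF l), fun l => ?_,
    fun l hl => ?_, ?_⟩
  · refine extMk_mem_extPowGrading _ _ fun a x hx => ?_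
    change formComp D.shift l φ x ∈ _
    rw [formComp_of_mem _ _ _ hx]
    exact polyComp_mem _ _
  · have h0 : F l = 0 := ModuleCat.hom_ext (hs0 l hl)
    exact (extMk_sum _ (∅ : Finset ℤ) F hF _ _ (by rw [Finset.sum_empty, h0])).trans
      Finset.sum_empty
  · refine extMk_sum _ s F hF f hf (ModuleCat.hom_ext ?_)
    rw [ModuleCat.hom_sum]
    exact hs

end PowerExt

end

/-! ### The decomposition of `Ext` of the powers of the maximal ideal -/

noncomputable section

namespace PowerExt

variable {N : ℕ}

/-- An equivariant map to the polynomial functions of degree `i` kills the classes of degree other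
than `-i - N`, as the scalar matrix `2` acts on source and target by distinct scalars. -/
theorem eq_zero_of_mem_extPowGrading {d : ℕ} {i : ℕ} {e : ExtPow N d N →ₗ[ℂ] ((Fin N → ℂ) → ℂ)}
    (hmem : ∀ x, e x ∈ polyFun N i)
    (hact : ∀ (g : GL (Fin N) ℂ) (x) (η),
      e (extAct N d N g x) η = (g.val.det)⁻¹ * e x ((g⁻¹).val.mulVec η))
    {k : ℤ} {x : ExtPow N d N} (hx : x ∈ extPowGrading N d N k) (hk : -(i : ℤ) - (N : ℤ) ≠ k) :
    e x = 0 := by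
  have h : (2 : ℂ) ^ k • e x = (2 : ℂ) ^ (-(i : ℤ) - N) • e x := by
    have h1 := extAct_scalarGL hx (Units.mk0 2 two_ne_zero)
    rw [Units.val_zpow_eq_zpow_val, Units.val_mk0] at h1
    rw [← map_smul, ← h1]
    funext η
    refine (hact (doubling N) x η).trans ((doubling_polyFun (hmem x) η).trans ?_)
    rw [Pi.smul_apply, smul_eq_mul, inv_pow, ← zpow_natCast, ← zpow_neg]
    congr 2
    push_cast
    ring
  rw [← sub_eq_zero, ← sub_smul, smul_eq_zero, sub_eq_zero] at h
  refine h.resolve_left fun h2 => hk ?_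
  have h3 := congrArg (‖·‖) h2
  simp only [norm_zpow, Complex.norm_ofNat] at h3
  exact (zpow_right_injective₀ (by norm_num) (by norm_num) h3).symm

end PowerExt

end

theorem mainTheorem2 (N : ℕ) [NeZero N] (d : ℕ) :
    (∃ e : PowerExt.ExtPow N d N ≃ₗ[ℂ]
        ⨁ i : Fin d, PowerExt.WeightSpace (PowerExt.extWeight N i),
      (∀ (g : GL (Fin N) ℂ) (x : PowerExt.ExtPow N d N) (i : Fin d),
        e (PowerExt.extAct N d N g x) i =
          PowerExt.weightRep (PowerExt.extWeight N i) g (e x i)) ∧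
      (∀ (k : ℤ) (x : PowerExt.ExtPow N d N),
        x ∈ PowerExt.extPowGrading N d N k ↔
          ∀ i : Fin d, -(i : ℤ) - (N : ℤ) ≠ k → e x i = 0)) ∧
    (∀ j : ℕ, j ≠ N → Subsingleton (PowerExt.ExtPow N d j)) := by
  refine ⟨?_, fun j hj => ⟨fun x y => (PowerExt.eq_zero_of_extPow hj x).trans
    (PowerExt.eq_zero_of_extPow hj y).symm⟩⟩
  obtain ⟨e, hmem, hinj, hsurj, hact⟩ := PowerExt.exists_splitting (N := N) d
  choose E hE using PowerExt.exists_weightSpace_equiv N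
  obtain ⟨c, hc⟩ : ∃ c : PowerExt.ExtPow N d N →ₗ[ℂ]
      ∀ i : Fin d, PowerExt.WeightSpace (PowerExt.extWeight N i),
      ∀ x (i : Fin d), (E i (c x i)).1 = e i x :=
    ⟨LinearMap.pi fun i => (E i).symm.toLinearMap ∘ₗ (e i).codRestrict _ (hmem i i.2),
      fun x i => congrArg Subtype.val
        ((E i).apply_symm_apply ((e i).codRestrict _ (hmem i i.2) x))⟩
  have hc0 : ∀ x (i : Fin d), c x i = 0 ↔ e i x = 0 := by
    intro x i
    rw [← hc]
    exact ⟨fun h => congrArg Subtype.val ((congrArg (E i) h).trans (map_zero (E i))),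
      fun h => (E i).injective ((Subtype.ext h).trans (map_zero (E i)).symm)⟩
  have hbij : Function.Bijective c := by
    constructor
    · exact (injective_iff_map_eq_zero c).mpr fun x hx =>
        hinj x fun i hi => (hc0 x ⟨i, hi⟩).mp (congrFun hx _)
    · intro w
      obtain ⟨x, hx⟩ := hsurj (fun i => if h : i < d then (E i (w ⟨i, h⟩)).1 else 0) fun i => by
        split_ifs with h
        · exact (E i (w ⟨i, h⟩)).2
        · exact zero_mem _
      refine ⟨x, funext fun i => (E i).injective (Subtype.ext ?_)⟩
      rw [hc, hx i i.2, dif_pos i.2]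
  let e' := LinearEquiv.ofBijective c hbij ≪≫ₗ (DirectSum.linearEquivFunOnFintype ℂ (Fin d)
    fun i => PowerExt.WeightSpace (PowerExt.extWeight N i)).symm
  have he' : ∀ x i, e' x i = c x i := fun x i => rfl
  have hdeg : ∀ {k : ℤ} {x : PowerExt.ExtPow N d N}, x ∈ PowerExt.extPowGrading N d N k →
      ∀ i < d, -(i : ℤ) - (N : ℤ) ≠ k → e i x = 0 := fun hx i hi hk =>
    PowerExt.eq_zero_of_mem_extPowGrading (hmem i hi) (fun g x => hact g x i hi) hx hk
  refine ⟨e', fun g x i => (E i).injective (Subtype.ext (funext fun η => ?_)), fun k x => ?_⟩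
  · rw [he', he', hE, hc, hc, hact g x i i.2]
  · simp only [he', hc0]
    refine ⟨fun hx i => hdeg hx i i.2, fun h => ?_⟩
    obtain ⟨s, y, hy, hy0, rfl⟩ := PowerExt.exists_eq_sum_homogeneous x
    -- the class and its component of degree `k` have the same image under each `e i`
    have key : ∑ l ∈ s, y l = y k := by
      rw [← sub_eq_zero]
      refine hinj _ fun i hi => ?_
      rw [map_sub, sub_eq_zero]
      by_cases hik : -(i : ℤ) - (N : ℤ) = k
      · rw [map_sum]
        refine Finset.sum_eq_single k (fun l _ hl => hdeg (hy l) i hi fun h => hl (h ▸ hik)) ?_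
        intro hk
        rw [hy0 k hk, map_zero]
      · rw [h ⟨i, hi⟩ hik, hdeg (hy k) i hi hik]
    rw [key]
    exact hy k
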